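/- For $\tau$ in the upper half plane $\mathbb{H}$ and $\alpha\in\mathbb{C}$ put $q=e^{2\pi i\tau}$, $w=e^{2\pi i\alpha}$, $\zeta_3=e^{2\pi i/3}$, $q^{x}=e^{2\pi i x\tau}$, $w^{3/2}=e^{3\pi i\alpha}$, $(a;q)_n=\prod_{j=0}^{n-1}(1-aq^j)$, $$g_3(w;q)=\sum_{n=0}^\infty\frac{q^{n(n+1)}}{(w;q)_{n+1}(q/w;q)_{n+1}},\qquad \eta(\tau)=q^{1/24}\prod_{n\ge1}(1-q^n),$$ $$\vartheta(z;\tau)=\sum_{n\in\mathbb{Z}}(-1)^{n+1}e^{\pi i(2n+1)z}q^{n(n+1)/2+1/8}=q^{1/8}x^{-1/2}\prod_{n\ge1}(1-q^n)(1-xq^{n-1})(1-x^{-1}q^n)\quad(x=e^{2\pi iz}).$$ (1) If $3\alpha\ne 3n\tau+m$ for all $m,n\in\mathbb{Z}$, then the series $g_3(w;q)$, $g_3(\zeta_3w;q)$, $g_3(\zeta_3^2w;q)$ converge absolutely and $$F(\alpha,\tau):=w^{3/2}q^{-1/24}\bigl(g_3(w;q)+g_3(\zeta_3w;q)+g_3(\zeta_3^2w;q)\bigr)=\frac{3\eta^3(3\tau)}{\eta(\tau)\vartheta(3\alpha;3\tau)}.$$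 (2) $F$ is a meromorphic Jacobi form of weight $1/2$ and index $-3/2$ on $\Gamma_0(3)$ with a multiplier system $\chi$ of finite order. That is: $F$ is meromorphic on $\mathbb{C}\times\mathbb{H}$; as identities of meromorphic functions $$(c\tau+d)^{-1/2}e^{3\pi i c\alpha^2/(c\tau+d)}F\Bigl(\frac{\alpha}{c\tau+d},\frac{a\tau+b}{c\tau+d}\Bigr)=\chi(\gamma)F(\alpha,\tau)\quad\text{for }\gamma=\begin{pmatrix}a&b\\c&d\end{pmatrix}\in\Gamma_0(3),$$ where the $\chi(\gamma)$ are $n$-th roots of unity for one $n\ge1$, and $$F(\alpha+l\tau+m,\tau)=(-1)^{l+m}e^{3\pi i(l^2\tau+2l\alpha)}F(\alpha,\tau)\quad\text{for }l,m\in\mathbb{Z};$$ and $F$ is meromorphic at the cusps: for every $A\in SL_2(\mathbb{Z})$, if $F|A$ denotes the left side of the first law with $A$ in place of $\gamma$, then for all $r,s\in\mathbb{Q}$ such that $F$ is regular at $\bigl(\frac{r\tau+s}{c\tau+d},A\tau\bigr)$ for all $\tau$ with $\operatorname{Im}\tau$ large, $q^{-3r^2/2}(F|A)(r\tau+s,\tau)=O(e^{C\operatorname{Im}\tau})$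 as $\operatorname{Im}\tau\to\infty$ for some $C$. (3) For every $r\in\mathbb{Q}$ and every integer $D\ge1$ there is a congruence subgroup $\Gamma\subseteq\Gamma_0(4)$ of $SL_2(\mathbb{Z})$ such that for every $s\in\mathbb{Q}$ with denominator dividing $D$, and not both $r\in\mathbb{Z}$ and $3s\in\mathbb{Z}$, the function $f(\tau)=q^{-3r^2/2}F(r\tau+s,\tau)$ is a weakly holomorphic modular form of weight $1/2$ on $\Gamma$. That is: $f$ is holomorphic on $\mathbb{H}$; $f(\gamma\tau)=\frac{\theta(\gamma\tau)}{\theta(\tau)}f(\tau)$ for $\gamma\in\Gamma$, where $\theta(\tau)=\sum_{n\in\mathbb{Z}}q^{n^2}$; and for every $A=\begin{pmatrix}a&b\\c&d\end{pmatrix}\in SL_2(\mathbb{Z})$ there is $C$ with $(c\tau+d)^{-1/2}f(A\tau)=O(e^{C\operatorname{Im}\tau})$ as $\operatorname{Im}\tau\to\infty$. -/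

import Mathlib

open scoped MatrixGroups UpperHalfPlane

noncomputable section

/-- The finite `q`-Pochhammer symbol `(a; q)_n = ∏_{j < n} (1 - a q^j)`. -/
def qPoch (a q : ℂ) (n : ℕ) : ℂ :=
  ∏ j ∈ Finset.range n, (1 - a * q ^ j)

/-- The `n`-th term of the series defining the universal mock theta function `g₃(w; q)`. -/
def g3Term (w q : ℂ) (n : ℕ) : ℂ :=
  q ^ (n * (n + 1)) / (qPoch w q (n + 1) * qPoch (q / w) q (n + 1))

/-- The universal mock theta function
`g₃(w; q) = ∑_{n ≥ 0} q^{n(n+1)} / ((w; q)_{n+1} (q/w; q)_{n+1})`. -/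
def universalG3 (w q : ℂ) : ℂ :=
  ∑' n : ℕ, g3Term w q n

/-- `expTwoPiI x = e^{2πi x}`; a power `q^x` of `q = e^{2πiτ}` always means `expTwoPiI (x * τ)`. -/
def expTwoPiI (x : ℂ) : ℂ :=
  Complex.exp (2 * Real.pi * Complex.I * x)

/-- The primitive cube root of unity `ζ₃ = e^{2πi/3}`. -/
def zeta3 : ℂ :=
  expTwoPiI (1 / 3)

/-- The odd Jacobi theta function
`ϑ(z; τ) = ∑_{n ∈ ℤ} (-1)^{n+1} e^{πi(2n+1)z} q^{n(n+1)/2 + 1/8}`. The sign is the one for which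
`ϑ(z; τ) = q^{1/8} x^{-1/2} ∏_{n ≥ 1} (1 - q^n)(1 - x q^{n-1})(1 - x^{-1} q^n)`, `x = e^{2πiz}`. -/
def oddTheta (z τ : ℂ) : ℂ :=
  ∑' n : ℤ, (-1 : ℂ) ^ (n + 1) * Complex.exp (Real.pi * Complex.I * (2 * n + 1) * z)
    * expTwoPiI (((n : ℂ) * (n + 1) / 2 + 1 / 8) * τ)

/-- The function `w^{3/2} q^{-1/24} (g₃(w; q) + g₃(ζ₃ w; q) + g₃(ζ₃² w; q))` of `(α, τ)`, where
`w = e^{2πiα}`, `q = e^{2πiτ}`, `w^{3/2} = e^{3πiα}` and `q^{-1/24} = e^{-2πiτ/24}`. -/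
def g3Sum (α τ : ℂ) : ℂ :=
  expTwoPiI (3 / 2 * α) * expTwoPiI (-1 / 24 * τ) *
    (universalG3 (expTwoPiI α) (expTwoPiI τ)
      + universalG3 (zeta3 * expTwoPiI α) (expTwoPiI τ)
      + universalG3 (zeta3 ^ 2 * expTwoPiI α) (expTwoPiI τ))

/-- A function of two complex variables is meromorphic at `p` if near `p` it is a quotient `g / h`
of analytic functions, the germ of `h` at `p` being nonzero. No condition is put on its values
at the zeros of `h`. -/
def MeromorphicAtTwoVar (φ : ℂ → ℂ → ℂ) (p : ℂ × ℂ) : Prop :=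
  ∃ g h : ℂ × ℂ → ℂ, AnalyticAt ℂ g p ∧ AnalyticAt ℂ h p ∧ ¬ (∀ᶠ x in nhds p, h x = 0) ∧
    ∀ᶠ x in nhds p, h x ≠ 0 → φ x.1 x.2 = g x / h x

/-- `φ` is regular (holomorphic) at the point `(z, τ)`. -/
def RegularAt (φ : ℂ → ℂ → ℂ) (z τ : ℂ) : Prop :=
  AnalyticAt ℂ (fun x : ℂ × ℂ => φ x.1 x.2) (z, τ)

/-- The automorphy denominator `cτ + d` of `A = (a b; c d)`. -/
def autDenom (A : SL(2, ℤ)) (τ : ℂ) : ℂ :=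
  (A 1 0 : ℂ) * τ + (A 1 1 : ℂ)

/-- The action of `A = (a b; c d)` on functions of `(z, τ)` in weight `κ/2` and index `M/2`:
`(cτ+d)^{-κ/2} e^{-2πi (M/2) c z² / (cτ+d)} φ(z / (cτ+d), Aτ)`, with the principal branch. -/
def jacobiSlash (κ M : ℤ) (A : SL(2, ℤ)) (φ : ℂ → ℂ → ℂ) (z : ℂ) (τ : ℍ) : ℂ :=
  autDenom A τ ^ (-(κ : ℂ) / 2)
    * expTwoPiI (-((M : ℂ) / 2) * (A 1 0 : ℂ) * z ^ 2 / autDenom A τ)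
    * φ (z / autDenom A τ) ((A • τ : ℍ) : ℂ)

/-- Meromorphic Jacobi forms of weight `κ/2` and index `M/2` for `Γ ≤ SL₂(ℤ)`, with a multiplier
system of finite order on `Γ` and the character `(-1)^{M(l+m)}` on the lattice.
The transformation laws are identities of meromorphic functions, so they are only required where
both sides are regular. The growth condition is meromorphy at all cusps: on the torsion
curves `z = rτ + s` the form and its translates by `SL₂(ℤ)`, multiplied by `q^{(M/2) r²}`,
have at most a pole at `i∞` in the variable `q`. -/
structure IsMeromorphicJacobiForm (κ M : ℤ) (Γ : Subgroup SL(2, ℤ)) (φ : ℂ → ℂ → ℂ) : Prop where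
  meromorphic : ∀ (z : ℂ) (τ : ℍ), MeromorphicAtTwoVar φ (z, (τ : ℂ))
  modular : ∃ χ : SL(2, ℤ) → ℂ, (∃ n : ℕ, 0 < n ∧ ∀ γ ∈ Γ, χ γ ^ n = 1) ∧
    ∀ γ ∈ Γ, ∀ (z : ℂ) (τ : ℍ), RegularAt φ z τ →
      RegularAt φ (z / autDenom γ τ) ((γ • τ : ℍ) : ℂ) →
      jacobiSlash κ M γ φ z τ = χ γ * φ z τ
  elliptic : ∀ (l m : ℤ) (z : ℂ) (τ : ℍ), RegularAt φ z τ → RegularAt φ (z + l * τ + m) τ →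
    φ (z + l * τ + m) τ
      = (-1 : ℂ) ^ (M * (l + m)) * expTwoPiI (-((M : ℂ) / 2) * (l ^ 2 * τ + 2 * l * z)) * φ z τ
  growth : ∀ (A : SL(2, ℤ)) (r s : ℚ),
    (∀ᶠ τ : ℍ in UpperHalfPlane.atImInfty,
      RegularAt φ ((r * τ + s) / autDenom A τ) ((A • τ : ℍ) : ℂ)) →
    ∃ C : ℝ, (fun τ : ℍ => expTwoPiI ((M : ℂ) / 2 * r ^ 2 * τ)
        * jacobiSlash κ M A φ (r * τ + s) τ)
      =O[UpperHalfPlane.atImInfty] (fun τ : ℍ => Real.exp (C * τ.im))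

/-- Weakly holomorphic modular forms of half-integral weight `κ/2` (`κ` odd) on `Γ ≤ Γ₀(4)`:
holomorphic on the upper half plane, with the automorphy factor `(θ(γτ)/θ(τ))^κ` of
`θ(τ) = ∑_{n ∈ ℤ} q^{n²}` (which is `jacobiTheta (2 * τ)`), and meromorphic at all cusps. -/
structure IsWeaklyHolomorphicHalfIntegral (κ : ℤ) (Γ : Subgroup SL(2, ℤ)) (f : ℂ → ℂ) :
    Prop where
  odd : Odd κ
  le_Gamma0 : Γ ≤ CongruenceSubgroup.Gamma0 4
  holomorphic : DifferentiableOn ℂ f {τ : ℂ | 0 < τ.im}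
  modular : ∀ γ ∈ Γ, ∀ τ : ℍ, f ((γ • τ : ℍ) : ℂ)
    = (jacobiTheta (2 * ((γ • τ : ℍ) : ℂ)) / jacobiTheta (2 * (τ : ℂ))) ^ κ * f τ
  cusps : ∀ A : SL(2, ℤ), ∃ C : ℝ,
    (fun τ : ℍ => autDenom A τ ^ (-(κ : ℂ) / 2) * f ((A • τ : ℍ) : ℂ))
      =O[UpperHalfPlane.atImInfty] (fun τ : ℍ => Real.exp (C * τ.im))

end

noncomputable section

open Filter Topology

/-! ### The infinite `q`-Pochhammer symbol -/

/-! Everything rests on one identity. Telescoping gives g₃(wq) = -w³ g₃(w) - w - w² (`g3Reg_mul`, in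
pole-free form). In the sum over w, ζw, ζ²w with 1 + ζ + ζ² = 0 the inhomogeneous terms cancel, so
this sum times (w³; q³)_∞ (q³/w³; q³)_∞ is invariant under w ↦ wq. The theta factor also cancels all
poles, so the product is an entire, doubly periodic function of log w, hence constant by Liouville
(`g3RegSum_eq`). At w = 1 two of the three summands vanish and Cauchy's identity (`tsum_cauchyTerm`)
evaluates the third. The Jacobi triple product (`jacobiTheta₂_eq_thetaProd`) identifies the theta
factor with ϑ(3α; 3τ), which is (1).

Put κ = ϑ/η³, so that F = 3 / (η(τ) κ(3α; 3τ)). In κ the roots of unity from ϑ and η³ cancel: it has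
weight -1, index 1/2 and trivial multiplier on all of SL₂(ℤ) (`kleinTheta_smul`). The multiplier of
F therefore comes from η alone and is a 24th root of unity (`exists_eta_smul`). Replacing τ by 3τ
restricts the law to Γ₀(3). For an arbitrary A, factoring diag(3, 1) A into a unimodular and a
triangular matrix (`exists_triangular_factor`) again expresses F|A through η and κ, and the product
formula for κ bounds it at the cusp. This gives (2).

On a torsion curve κ becomes a Klein form, of weight -1 on some Γ(2n²), and f is a constant over
η(τ) times a Klein form at 3τ. It remains to compare 1/η with θ, for which it suffices that ηθ has
weight 1 and trivial multiplier on some Γ(N) (`isCongruenceInvariant_eta_mul_jacobiTheta`). No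
explicit eta multiplier is needed: the values of κ at 1/2, 1/3, 1/4 are eta quotients and allow a
descent from η²⁴ to lower powers of η. Then f/θ has weight 0, which is the law in (3). -/

/-- The infinite `q`-Pochhammer symbol `(a; q)_∞ = ∏_{j ≥ 0} (1 - a q^j)`. -/
def qPochInf (a q : ℂ) : ℂ := ∏' j : ℕ, (1 - a * q ^ j)

lemma summable_norm_mul_pow (a : ℂ) {q : ℂ} (hq : ‖q‖ < 1) :
    Summable fun j : ℕ => ‖-(a * q ^ j)‖ := by
  simpa using (summable_geometric_of_lt_one (norm_nonneg q) hq).mul_left ‖a‖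

lemma multipliable_qPochInf (a : ℂ) {q : ℂ} (hq : ‖q‖ < 1) :
    Multipliable fun j : ℕ => 1 - a * q ^ j := by
  simpa only [sub_eq_add_neg] using multipliable_one_add_of_summable (summable_norm_mul_pow a hq)

lemma tendsto_qPoch (a : ℂ) {q : ℂ} (hq : ‖q‖ < 1) :
    Tendsto (qPoch a q) atTop (𝓝 (qPochInf a q)) :=
  (multipliable_qPochInf a hq).hasProd.tendsto_prod_nat

@[simp] lemma qPoch_zero (a q : ℂ) : qPoch a q 0 = 1 := by simp [qPoch]

lemma qPoch_succ (a q : ℂ) (n : ℕ) : qPoch a q (n + 1) = qPoch a q n * (1 - a * q ^ n) := by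
  simp [qPoch, Finset.prod_range_succ]

lemma qPoch_succ' (a q : ℂ) (n : ℕ) : qPoch a q (n + 1) = (1 - a) * qPoch (a * q) q n := by
  simp only [qPoch, Finset.prod_range_succ']
  rw [mul_comm]
  simp only [pow_zero, mul_one, pow_succ']
  congr 1
  exact Finset.prod_congr rfl fun j _ => by ring

lemma qPochInf_eq_qPoch_mul (a : ℂ) {q : ℂ} (hq : ‖q‖ < 1) (n : ℕ) :
    qPochInf a q = qPoch a q n * qPochInf (a * q ^ n) q := by
  have h1 : Tendsto (fun m => qPoch a q (m + n)) atTop (𝓝 (qPochInf a q)) :=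
    (tendsto_add_atTop_iff_nat n).2 (tendsto_qPoch a hq)
  have h2 := (tendsto_qPoch (a * q ^ n) hq).const_mul (qPoch a q n)
  refine tendsto_nhds_unique h1 (h2.congr fun m => ?_)
  rw [add_comm m n]
  simp only [qPoch, Finset.prod_range_add]
  congr 1
  exact Finset.prod_congr rfl fun j _ => by ring

lemma qPochInf_eq_one_sub_mul (a : ℂ) {q : ℂ} (hq : ‖q‖ < 1) :
    qPochInf a q = (1 - a) * qPochInf (a * q) q := by
  simpa [qPoch_succ] using qPochInf_eq_qPoch_mul a hq 1

lemma qPoch_ne_zero {a q : ℂ} (h : ∀ j : ℕ, a * q ^ j ≠ 1) (n : ℕ) : qPoch a q n ≠ 0 :=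
  Finset.prod_ne_zero_iff.2 fun j _ => sub_ne_zero.2 (h j).symm

lemma qPochInf_ne_zero {a q : ℂ} (hq : ‖q‖ < 1) (h : ∀ j : ℕ, a * q ^ j ≠ 1) :
    qPochInf a q ≠ 0 := by
  have := tprod_one_add_ne_zero_of_summable (f := fun j : ℕ => -(a * q ^ j))
    (fun j => by simpa [← sub_eq_add_neg, sub_eq_zero] using (h j).symm)
    (summable_norm_mul_pow a hq)
  simpa only [qPochInf, ← sub_eq_add_neg] using this

lemma mul_pow_ne_one {a q : ℂ} (ha : ‖a‖ < 1) (hq : ‖q‖ < 1) (j : ℕ) : a * q ^ j ≠ 1 := by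
  intro h
  have h1 : ‖a * q ^ j‖ = 1 := by rw [h, norm_one]
  rw [norm_mul, norm_pow] at h1
  have : ‖q‖ ^ j ≤ 1 := pow_le_one₀ (norm_nonneg _) hq.le
  nlinarith [norm_nonneg a, pow_nonneg (norm_nonneg q) j]

lemma qPochInf_ne_zero_of_norm_lt_one {a q : ℂ} (ha : ‖a‖ < 1) (hq : ‖q‖ < 1) :
    qPochInf a q ≠ 0 :=
  qPochInf_ne_zero hq (mul_pow_ne_one ha hq)

lemma qPoch_ne_zero_of_norm_lt_one {a q : ℂ} (ha : ‖a‖ < 1) (hq : ‖q‖ < 1) (n : ℕ) :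
    qPoch a q n ≠ 0 :=
  qPoch_ne_zero (mul_pow_ne_one ha hq) n

lemma sum_norm_mul_pow_le (a : ℂ) {q : ℂ} (hq : ‖q‖ < 1) (n : ℕ) :
    ∑ j ∈ Finset.range n, ‖-(a * q ^ j)‖ ≤ ‖a‖ / (1 - ‖q‖) := by
  refine ((summable_norm_mul_pow a hq).sum_le_tsum _ fun _ _ => norm_nonneg _).trans_eq ?_
  simp [tsum_mul_left, tsum_geometric_of_lt_one (norm_nonneg q) hq, div_eq_mul_inv]

lemma norm_qPoch_sub_one_le (a : ℂ) {q : ℂ} (hq : ‖q‖ < 1) (n : ℕ) :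
    ‖qPoch a q n - 1‖ ≤ Real.exp (‖a‖ / (1 - ‖q‖)) - 1 := by
  have h := Finset.norm_prod_one_add_sub_one_le (Finset.range n) fun j : ℕ => -(a * q ^ j)
  simp only [← sub_eq_add_neg] at h
  refine h.trans (sub_le_sub_right (Real.exp_le_exp.2 ?_) 1)
  exact sum_norm_mul_pow_le a hq n

lemma norm_qPochInf_sub_one_le (a : ℂ) {q : ℂ} (hq : ‖q‖ < 1) :
    ‖qPochInf a q - 1‖ ≤ Real.exp (‖a‖ / (1 - ‖q‖)) - 1 :=
  le_of_tendsto ((tendsto_qPoch a hq).sub_const 1).norm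
    (Eventually.of_forall (norm_qPoch_sub_one_le a hq))

lemma norm_qPoch_le (a : ℂ) {q : ℂ} (hq : ‖q‖ < 1) (n : ℕ) :
    ‖qPoch a q n‖ ≤ Real.exp (‖a‖ / (1 - ‖q‖)) := by
  have h1 := norm_qPoch_sub_one_le a hq n
  have h2 := norm_sub_norm_le (qPoch a q n) 1
  rw [norm_one] at h2
  linarith

lemma norm_qPochInf_le (a : ℂ) {q : ℂ} (hq : ‖q‖ < 1) :
    ‖qPochInf a q‖ ≤ Real.exp (‖a‖ / (1 - ‖q‖)) :=
  le_of_tendsto (tendsto_qPoch a hq).norm (Eventually.of_forall (norm_qPoch_le a hq))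

/-- The reciprocals converge to 1/(a; q)_∞, hence are bounded. The uniform bound dominates the
series in Cauchy's identity and in the triple product. -/
lemma exists_le_norm_qPoch {a q : ℂ} (hq : ‖q‖ < 1) (h : ∀ j : ℕ, a * q ^ j ≠ 1) :
    ∃ c > 0, ∀ n, c ≤ ‖qPoch a q n‖ := by
  have hl : Tendsto (fun n => ‖qPoch a q n‖⁻¹) atTop (𝓝 ‖qPochInf a q‖⁻¹) :=
    (tendsto_qPoch a hq).norm.inv₀ (norm_ne_zero_iff.2 (qPochInf_ne_zero hq h))
  obtain ⟨B, hB⟩ := hl.bddAbove_range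
  have hB' : ∀ n, ‖qPoch a q n‖⁻¹ ≤ B := fun n => hB ⟨n, rfl⟩
  have hpos : ∀ n, 0 < ‖qPoch a q n‖ := fun n => norm_pos_iff.2 (qPoch_ne_zero h n)
  have hB0 : 0 < B := (inv_pos.2 (hpos 0)).trans_le (hB' 0)
  exact ⟨B⁻¹, inv_pos.2 hB0, fun n => (inv_le_comm₀ (hpos n) hB0).1 (hB' n)⟩

lemma differentiable_qPochInf {q : ℂ} (hq : ‖q‖ < 1) :
    Differentiable ℂ fun a => qPochInf a q := by
  intro a
  have hu : Summable fun j : ℕ => (‖a‖ + 1) * ‖q‖ ^ j :=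
    (summable_geometric_of_lt_one (norm_nonneg q) hq).mul_left _
  have h : HasProdLocallyUniformlyOn (fun (j : ℕ) (x : ℂ) => 1 + -(x * q ^ j))
      (fun x => ∏' j : ℕ, (1 + -(x * q ^ j))) (Metric.ball 0 (‖a‖ + 1)) := by
    refine hu.hasProdLocallyUniformlyOn_nat_one_add Metric.isOpen_ball
      (Eventually.of_forall fun j x hx => ?_) (fun j => by fun_prop)
    rw [norm_neg, norm_mul, norm_pow]
    gcongr
    simpa using (mem_ball_zero_iff.1 hx).le
  have hd := h.differentiableOn (Eventually.of_forall fun s => by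
    simpa [Finset.prod_fn] using DifferentiableOn.finsetProd (fun _ _ => by fun_prop))
    Metric.isOpen_ball
  have := hd.differentiableAt (Metric.isOpen_ball.mem_nhds (x := a) (by simp))
  simpa only [qPochInf, sub_eq_add_neg] using this

lemma qPochInf_mul_neg (a : ℂ) {q : ℂ} (hq : ‖q‖ < 1) :
    qPochInf a q * qPochInf (-a) q = qPochInf (a ^ 2) (q ^ 2) := by
  rw [qPochInf, qPochInf, ← (multipliable_qPochInf a hq).tprod_mul (multipliable_qPochInf (-a) hq)]
  exact tprod_congr fun j => by ring

lemma norm_pow_lt_one {q : ℂ} (hq : ‖q‖ < 1) {k : ℕ} (hk : k ≠ 0) : ‖q ^ k‖ < 1 := by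
  rw [norm_pow]; exact pow_lt_one₀ (norm_nonneg q) hq hk

/-- Factor by factor, (1 - x)(1 - ζx)(1 - ζ²x) = 1 - x³. This is the source of the modulus q³. -/
lemma qPochInf_mul_cube {ζ : ℂ} (hζ : ζ ^ 2 + ζ + 1 = 0) (a : ℂ) {q : ℂ} (hq : ‖q‖ < 1) :
    qPochInf a q * qPochInf (ζ * a) q * qPochInf (ζ ^ 2 * a) q = qPochInf (a ^ 3) (q ^ 3) := by
  rw [qPochInf, qPochInf, ← (multipliable_qPochInf a hq).tprod_mul (multipliable_qPochInf _ hq),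
    qPochInf, ← ((multipliable_qPochInf a hq).mul (multipliable_qPochInf _ hq)).tprod_mul
      (multipliable_qPochInf _ hq)]
  refine tprod_congr fun j => ?_
  have h3 : ζ ^ 3 = 1 := by linear_combination (ζ - 1) * hζ
  linear_combination (-(a * q ^ j) + (a * q ^ j) ^ 2 * ζ) * hζ - (a * q ^ j) ^ 3 * h3

/-! ### The sum of `g₃` over the cube roots of unity -/

/-- `(w; q)_∞ (q/w; q)_∞`. -/
def thetaProd (w q : ℂ) : ℂ := qPochInf w q * qPochInf (q / w) q

/-- The `n`-th term of `universalG3 w q * thetaProd w q`, with all poles in `w` removed. -/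
def g3RegTerm (w q : ℂ) (n : ℕ) : ℂ :=
  q ^ (n * (n + 1)) * (qPochInf (w * q ^ (n + 1)) q * qPochInf (q / w * q ^ (n + 1)) q)

/-- The function `universalG3 w q * thetaProd w q`, with its singularities removed. -/
def g3Reg (w q : ℂ) : ℂ := ∑' n : ℕ, g3RegTerm w q n

lemma thetaProd_one {q : ℂ} (hq : ‖q‖ < 1) : thetaProd 1 q = 0 := by
  rw [thetaProd, qPochInf_eq_one_sub_mul 1 hq]; simp

lemma thetaProd_mul {w q : ℂ} (hw : w ≠ 0) (hq0 : q ≠ 0) (hq : ‖q‖ < 1) :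
    thetaProd (w * q) q = -w⁻¹ * thetaProd w q := by
  have h1 := qPochInf_eq_one_sub_mul w hq
  have h2 := qPochInf_eq_one_sub_mul w⁻¹ hq
  have e1 : q / (w * q) = w⁻¹ := by field_simp
  have e2 : w⁻¹ * q = q / w := by field_simp
  rw [thetaProd, thetaProd, e1, h1, h2, e2]
  field_simp
  ring

lemma g3RegTerm_eq {w q : ℂ} (hq : ‖q‖ < 1) (h1 : ∀ j : ℕ, w * q ^ j ≠ 1)
    (h2 : ∀ j : ℕ, q / w * q ^ j ≠ 1) (n : ℕ) :
    g3RegTerm w q n = g3Term w q n * thetaProd w q := by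
  rw [thetaProd, qPochInf_eq_qPoch_mul w hq (n + 1), qPochInf_eq_qPoch_mul (q / w) hq (n + 1),
    g3RegTerm, g3Term]
  have := qPoch_ne_zero h1 (n + 1)
  have := qPoch_ne_zero h2 (n + 1)
  field_simp

lemma norm_pow_mul_succ_le {q : ℂ} (hq : ‖q‖ < 1) (n : ℕ) :
    ‖q ^ (n * (n + 1))‖ ≤ ‖q‖ ^ n := by
  rw [norm_pow]
  exact pow_le_pow_of_le_one (norm_nonneg _) hq.le (by nlinarith)

lemma norm_qPochInf_mul_pow_le {a q : ℂ} {R : ℝ} (hq : ‖q‖ < 1) (ha : ‖a‖ ≤ R) (n : ℕ) :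
    ‖qPochInf (a * q ^ n) q‖ ≤ Real.exp (R / (1 - ‖q‖)) := by
  refine (norm_qPochInf_le _ hq).trans (Real.exp_le_exp.2 ?_)
  have : 0 < 1 - ‖q‖ := by linarith
  gcongr
  rw [norm_mul, norm_pow]
  exact (mul_le_of_le_one_right (norm_nonneg a) (pow_le_one₀ (norm_nonneg _) hq.le)).trans ha

lemma norm_g3RegTerm_le {w q : ℂ} {R : ℝ} (hq : ‖q‖ < 1) (h1 : ‖w‖ ≤ R) (h2 : ‖q / w‖ ≤ R)
    (n : ℕ) : ‖g3RegTerm w q n‖ ≤ ‖q‖ ^ n *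
      (Real.exp (R / (1 - ‖q‖)) * Real.exp (R / (1 - ‖q‖))) := by
  rw [g3RegTerm, norm_mul, norm_mul]
  have e1 := norm_pow_mul_succ_le hq n
  have e2 := norm_qPochInf_mul_pow_le hq h1 (n + 1)
  have e3 := norm_qPochInf_mul_pow_le hq h2 (n + 1)
  gcongr

lemma summable_g3RegTerm (w : ℂ) {q : ℂ} (hq : ‖q‖ < 1) : Summable (g3RegTerm w q) :=
  Summable.of_norm_bounded ((summable_geometric_of_lt_one (norm_nonneg q) hq).mul_right _)
    (norm_g3RegTerm_le hq (le_max_left _ _) (le_max_right _ _))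

lemma summable_g3Term {w q : ℂ} (hq : ‖q‖ < 1) (h1 : ∀ j : ℕ, w * q ^ j ≠ 1)
    (h2 : ∀ j : ℕ, q / w * q ^ j ≠ 1) : Summable (g3Term w q) := by
  have h0 : thetaProd w q ≠ 0 := mul_ne_zero (qPochInf_ne_zero hq h1) (qPochInf_ne_zero hq h2)
  rw [← summable_mul_right_iff h0]
  exact (summable_g3RegTerm w hq).congr fun n => (g3RegTerm_eq hq h1 h2 n)

lemma g3Reg_eq {w q : ℂ} (hq : ‖q‖ < 1) (h1 : ∀ j : ℕ, w * q ^ j ≠ 1)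
    (h2 : ∀ j : ℕ, q / w * q ^ j ≠ 1) : g3Reg w q = universalG3 w q * thetaProd w q := by
  rw [g3Reg, universalG3, ← tsum_mul_right]
  exact tsum_congr (g3RegTerm_eq hq h1 h2)

lemma differentiable_thetaProd_exp {q : ℂ} (hq : ‖q‖ < 1) (c : ℂ) :
    Differentiable ℂ fun z => thetaProd (c * Complex.exp z) q := by
  have h := differentiable_qPochInf hq
  simp only [thetaProd, div_eq_mul_inv, mul_inv, ← Complex.exp_neg]
  exact (h.comp (by fun_prop)).mul (h.comp (by fun_prop))

/-- The exponential avoids w = 0. Near any point |w| and |q/w| stay below one R, so the terms have a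
common geometric majorant. -/
lemma differentiable_g3Reg_exp {q : ℂ} (hq : ‖q‖ < 1) (c : ℂ) :
    Differentiable ℂ fun z => g3Reg (c * Complex.exp z) q := by
  intro z₀
  set R : ℝ := ‖c * Complex.exp z₀‖ + ‖q / (c * Complex.exp z₀)‖ + 1
  set U : Set ℂ := {z | ‖c * Complex.exp z‖ < R} ∩ {z | ‖q * c⁻¹ * Complex.exp (-z)‖ < R}
  have hU : IsOpen U :=
    (isOpen_lt (by fun_prop) continuous_const).inter (isOpen_lt (by fun_prop) continuous_const)
  have e (z : ℂ) : q / (c * Complex.exp z) = q * c⁻¹ * Complex.exp (-z) := by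
    rw [div_eq_mul_inv, mul_inv, Complex.exp_neg, mul_assoc]
  have hz₀ : z₀ ∈ U := by
    refine ⟨?_, ?_⟩
    · show _ < R
      linarith [norm_nonneg (q / (c * Complex.exp z₀))]
    · show _ < R
      rw [← e]
      linarith [norm_nonneg (c * Complex.exp z₀)]
  refine (Complex.differentiableOn_tsum_of_summable_norm
    (F := fun (n : ℕ) z => g3RegTerm (c * Complex.exp z) q n)
    ((summable_geometric_of_lt_one (norm_nonneg q) hq).mul_right
      (Real.exp (R / (1 - ‖q‖)) * Real.exp (R / (1 - ‖q‖)))) (fun n => ?_) hU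
    fun n z hz => ?_).differentiableAt (hU.mem_nhds hz₀)
  · have h := differentiable_qPochInf hq
    simp only [g3RegTerm, e]
    exact (((h.comp (by fun_prop)).mul (h.comp (by fun_prop))).const_mul _).differentiableOn
  · exact norm_g3RegTerm_le hq hz.1.le (by rw [e]; exact hz.2.le) n

/-- Sums of telescoping series. -/
lemma Summable.tsum_sub_succ {f u : ℕ → ℂ} (hf : Summable f) (hu : Tendsto u atTop (𝓝 0))
    (h : ∀ n, f n = u (n + 1) - u n) : ∑' n, f n = -u 0 := by
  refine tendsto_nhds_unique hf.hasSum.tendsto_sum_nat ?_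
  simp only [h, Finset.sum_range_sub]
  simpa using hu.sub_const (u 0)

/-- The combination -w·(term at wq) + w³·(term at w) is a difference u (n + 1) - u n with u n → 0.
The boundary value u 0 = w(1 + w)·`thetaProd w q` is the inhomogeneous term. -/
lemma g3Reg_mul {w q : ℂ} (hw : w ≠ 0) (hq0 : q ≠ 0) (hq : ‖q‖ < 1) :
    g3Reg (w * q) q = w ^ 2 * g3Reg w q + (1 + w) * thetaProd w q := by
  set u : ℕ → ℂ := fun n => (w - w ^ 3) * (q ^ (n * (n + 1)) *
    (qPochInf (w * q ^ (n + 1)) q * qPochInf (w⁻¹ * q ^ (n + 1)) q)) with hu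
  have key (n : ℕ) : -w * g3RegTerm (w * q) q n + w ^ 3 * g3RegTerm w q n = u (n + 1) - u n := by
    have a1 := qPochInf_eq_one_sub_mul (w * q ^ (n + 1)) hq
    have a2 := qPochInf_eq_one_sub_mul (w⁻¹ * q ^ (n + 1)) hq
    have e1 : w * q * q ^ (n + 1) = w * q ^ (n + 1) * q := by ring
    have e2 : q / (w * q) * q ^ (n + 1) = w⁻¹ * q ^ (n + 1) := by field_simp
    have e3 : q / w * q ^ (n + 1) = w⁻¹ * q ^ (n + 1) * q := by field_simp
    have e4 : w * q ^ (n + 1 + 1) = w * q ^ (n + 1) * q := by ring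
    have e5 : w⁻¹ * q ^ (n + 1 + 1) = w⁻¹ * q ^ (n + 1) * q := by ring
    have e6 : q ^ ((n + 1) * (n + 1 + 1)) = q ^ (n * (n + 1)) * (q ^ (n + 1)) ^ 2 := by ring
    simp only [hu, g3RegTerm, e1, e2, e3, e4, e5, e6, a1, a2]
    generalize qPochInf (w * q ^ (n + 1) * q) q = A
    generalize qPochInf (w⁻¹ * q ^ (n + 1) * q) q = B
    generalize q ^ (n * (n + 1)) = C
    generalize q ^ (n + 1) = Q
    field_simp
    ring
  have hlim : Tendsto u atTop (𝓝 0) := by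
    have hb : Tendsto (fun n : ℕ => ‖w - w ^ 3‖ * (‖q‖ ^ n *
        (Real.exp (‖w‖ / (1 - ‖q‖)) * Real.exp (‖w⁻¹‖ / (1 - ‖q‖))))) atTop (𝓝 0) := by
      simpa using ((tendsto_pow_atTop_nhds_zero_of_lt_one (norm_nonneg q) hq).mul_const
        (Real.exp (‖w‖ / (1 - ‖q‖)) * Real.exp (‖w⁻¹‖ / (1 - ‖q‖)))).const_mul ‖w - w ^ 3‖
    refine squeeze_zero_norm (fun n => ?_) hb
    simp only [hu, norm_mul (w - w ^ 3), norm_mul (q ^ (n * (n + 1))),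
      norm_mul (qPochInf (w * q ^ (n + 1)) q)]
    have e1 := norm_pow_mul_succ_le hq n
    have e2 := norm_qPochInf_mul_pow_le hq (le_refl ‖w‖) (n + 1)
    have e3 := norm_qPochInf_mul_pow_le hq (le_refl ‖w⁻¹‖) (n + 1)
    gcongr
  have s1 := (summable_g3RegTerm (w * q) hq).mul_left (-w)
  have s2 := (summable_g3RegTerm w hq).mul_left (w ^ 3)
  have hs := (s1.add s2).tsum_sub_succ hlim key
  rw [s1.tsum_add s2, tsum_mul_left, tsum_mul_left] at hs
  have h0 : u 0 = w * (1 + w) * thetaProd w q := by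
    have e : w⁻¹ * q = q / w := by field_simp
    simp only [hu, thetaProd, qPochInf_eq_one_sub_mul w hq, zero_add, pow_one, zero_mul, pow_zero,
      e]
    ring
  rw [h0] at hs
  refine mul_left_cancel₀ hw ?_
  simp only [g3Reg] at hs ⊢
  linear_combination -hs

/-! ### Cauchy's identity and the value at w = 1 -/

/-- The terms of the regularized Cauchy series
`(zq; q)_∞ ∑ q^{n²} z^n / ((q; q)_n (zq; q)_n) = 1`. -/
def cauchyTerm (q z : ℂ) (n : ℕ) : ℂ :=
  q ^ (n ^ 2) * z ^ n * qPochInf (z * q ^ (n + 1)) q / qPoch q q n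

lemma exists_norm_cauchyTerm_le {q : ℂ} (hq : ‖q‖ < 1) :
    ∃ B : ℝ, ∀ z : ℂ, ‖z‖ ≤ 1 → ∀ n, ‖cauchyTerm q z n‖ ≤ ‖q‖ ^ n * B := by
  obtain ⟨c, hc, hcn⟩ := exists_le_norm_qPoch hq (mul_pow_ne_one hq hq)
  refine ⟨Real.exp (1 / (1 - ‖q‖)) / c, fun z hz n => ?_⟩
  rw [cauchyTerm, norm_div, norm_mul, norm_mul, ← mul_div_assoc]
  have e1 : ‖q ^ n ^ 2‖ ≤ ‖q‖ ^ n := by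
    rw [norm_pow]
    exact pow_le_pow_of_le_one (norm_nonneg _) hq.le (by nlinarith [Nat.le_self_pow two_ne_zero n])
  have e2 : ‖z ^ n‖ ≤ 1 := by rw [norm_pow]; exact pow_le_one₀ (norm_nonneg _) hz
  have e3 := norm_qPochInf_mul_pow_le hq hz (n + 1)
  have e4 := hcn n
  have e5 : ‖q ^ n ^ 2‖ * ‖z ^ n‖ ≤ ‖q‖ ^ n := by
    simpa using mul_le_mul e1 e2 (norm_nonneg _) (by positivity)
  gcongr

lemma summable_cauchyTerm {q z : ℂ} (hq : ‖q‖ < 1) (hz : ‖z‖ ≤ 1) :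
    Summable (cauchyTerm q z) := by
  obtain ⟨B, hB⟩ := exists_norm_cauchyTerm_le hq
  exact Summable.of_norm_bounded ((summable_geometric_of_lt_one (norm_nonneg q) hq).mul_right B)
    (hB z hz)

/-- The termwise difference telescopes through v n = (1 - qⁿ)·`cauchyTerm q z n`, and here v 0 = 0,
so there is no boundary term. -/
lemma tsum_cauchyTerm_mul {q z : ℂ} (hq : ‖q‖ < 1) (hz : ‖z‖ ≤ 1) :
    ∑' n, cauchyTerm q (z * q) n = ∑' n, cauchyTerm q z n := by
  set v : ℕ → ℂ := fun n => (1 - q ^ n) * cauchyTerm q z n with hv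
  have hzq : ‖z * q‖ ≤ 1 := by
    rw [norm_mul]; exact mul_le_one₀ hz (norm_nonneg _) hq.le
  have key (n : ℕ) : cauchyTerm q (z * q) n - cauchyTerm q z n = v (n + 1) - v n := by
    have a1 := qPochInf_eq_one_sub_mul (z * q ^ (n + 1)) hq
    have e1 : z * q * q ^ (n + 1) = z * q ^ (n + 1) * q := by ring
    have e2 : z * q ^ (n + 1 + 1) = z * q ^ (n + 1) * q := by ring
    have e3 : q ^ (n + 1) ^ 2 = q ^ n ^ 2 * (q ^ n) ^ 2 * q := by ring
    have e4 : qPoch q q (n + 1) = qPoch q q n * (1 - q ^ (n + 1)) := by rw [qPoch_succ]; ring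
    have n1 : qPoch q q n ≠ 0 := qPoch_ne_zero_of_norm_lt_one hq hq n
    have n2 : 1 - q ^ (n + 1) ≠ 0 := by
      have := mul_pow_ne_one hq hq n
      rw [← pow_succ'] at this
      exact sub_ne_zero.2 this.symm
    simp only [hv, cauchyTerm, e1, e2, e3, e4, a1, mul_pow, pow_succ z]
    generalize qPochInf (z * q ^ (n + 1) * q) q = A
    field_simp
    ring
  have hlim : Tendsto v atTop (𝓝 0) := by
    have h1 := (summable_cauchyTerm hq hz).tendsto_atTop_zero
    have h2 := (tendsto_pow_atTop_nhds_zero_of_norm_lt_one hq).const_sub 1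
    simpa using h2.mul h1
  have s1 := summable_cauchyTerm hq hzq
  have s2 := summable_cauchyTerm hq hz
  have hs := (s1.sub s2).tsum_sub_succ hlim key
  rw [s1.tsum_sub s2] at hs
  simpa [hv, sub_eq_zero] using hs

/-- Iterating z ↦ zq leaves the sum unchanged and drives z to 0, where only the term n = 0 survives.
The majorant uniform in |z| ≤ 1 justifies the limit. -/
lemma tsum_cauchyTerm {q z : ℂ} (hq : ‖q‖ < 1) (hz : ‖z‖ ≤ 1) : ∑' n, cauchyTerm q z n = 1 := by
  have hle (k : ℕ) : ‖z * q ^ k‖ ≤ 1 := by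
    rw [norm_mul, norm_pow]
    exact mul_le_one₀ hz (by positivity) (pow_le_one₀ (norm_nonneg _) hq.le)
  have hk (k : ℕ) : ∑' n, cauchyTerm q (z * q ^ k) n = ∑' n, cauchyTerm q z n := by
    induction k with
    | zero => simp
    | succ k ih => rw [← ih, ← tsum_cauchyTerm_mul hq (hle k), pow_succ, mul_assoc]
  have h0 : ∑' n, cauchyTerm q 0 n = 1 := by
    rw [tsum_eq_single 0 fun n hn => by simp [cauchyTerm, hn]]
    simp [cauchyTerm, qPochInf]
  obtain ⟨B, hB⟩ := exists_norm_cauchyTerm_le hq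
  have hlim : Tendsto (fun k : ℕ => ∑' n, cauchyTerm q (z * q ^ k) n) atTop
      (𝓝 (∑' n, cauchyTerm q 0 n)) := by
    refine tendsto_tsum_of_dominated_convergence
      ((summable_geometric_of_lt_one (norm_nonneg q) hq).mul_right B) (fun n => ?_)
      (Eventually.of_forall fun k n => hB _ (hle k) n)
    have hc : Continuous fun z => cauchyTerm q z n := by
      have := (differentiable_qPochInf hq).continuous
      unfold cauchyTerm
      fun_prop
    have hz0 : Tendsto (fun k : ℕ => z * q ^ k) atTop (𝓝 0) := by
      simpa using (tendsto_pow_atTop_nhds_zero_of_norm_lt_one hq).const_mul z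
    exact (hc.tendsto 0).comp hz0
  simp only [hk, h0] at hlim
  exact tendsto_nhds_unique tendsto_const_nhds hlim

/-- Since (q^{n+1}; q)_∞ = (q; q)_∞ / (q; q)_n, this is Cauchy's series at z = q. -/
lemma g3Reg_one {q : ℂ} (hq : ‖q‖ < 1) : g3Reg 1 q = qPochInf q q := by
  have h : ∀ n, g3RegTerm 1 q n = qPochInf q q * cauchyTerm q q n := fun n => by
    have n1 : qPoch q q n ≠ 0 := qPoch_ne_zero_of_norm_lt_one hq hq n
    rw [g3RegTerm, cauchyTerm, qPochInf_eq_qPoch_mul q hq n, div_one, one_mul, ← pow_succ',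
      ← pow_succ']
    field_simp
    ring
  rw [g3Reg, tsum_congr h, tsum_mul_left, tsum_cauchyTerm hq hq.le, mul_one]

/-! ### The Liouville argument -/

/-- An entire function with two periods, one purely imaginary and one not, is constant. -/
lemma Differentiable.apply_eq_of_periodic {f : ℂ → ℂ} (hf : Differentiable ℂ f) {p : ℝ} {l : ℂ}
    (hp : 0 < p) (hl : 0 < l.re) (h1 : Function.Periodic f (p * Complex.I))
    (h2 : Function.Periodic f l) (z z' : ℂ) : f z = f z' := by
  refine hf.apply_eq_apply_of_bounded ?_ z z'
  have hK : IsCompact (Set.Icc (0 : ℝ) l.re ×ℂ Set.Icc (0 : ℝ) p) :=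
    isCompact_Icc.reProdIm isCompact_Icc
  refine (hK.image hf.continuous).isBounded.subset ?_
  rintro _ ⟨z, rfl⟩
  -- The real part is reduced first: l may have an imaginary part, whereas the second period does
  -- not disturb the real part.
  set n := toIcoDiv hl 0 z.re
  set m := toIcoDiv hp 0 (z - n • l).im
  refine ⟨z - n • l - m • (p * Complex.I), ?_, ?_⟩
  · have a := toIcoMod_mem_Ico hl 0 z.re
    have b := toIcoMod_mem_Ico hp 0 (z - n • l).im
    rw [toIcoMod] at a b
    rw [zero_add] at a b
    refine ⟨?_, ?_⟩
    · have : (z - n • l - m • ((p : ℂ) * Complex.I)).re = z.re - n • l.re := by simp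
      rw [Set.mem_preimage, this]
      exact ⟨a.1, a.2.le⟩
    · have : (z - n • l - m • ((p : ℂ) * Complex.I)).im = (z - n • l).im - m • p := by simp
      rw [Set.mem_preimage, this]
      exact ⟨b.1, b.2.le⟩
  · rw [h1.sub_zsmul_eq, h2.sub_zsmul_eq]

lemma thetaProd_cube {ζ : ℂ} (hζ : ζ ^ 2 + ζ + 1 = 0) {w q : ℂ} (hw : w ≠ 0) (hq : ‖q‖ < 1) :
    thetaProd w q * thetaProd (ζ * w) q * thetaProd (ζ ^ 2 * w) q = thetaProd (w ^ 3) (q ^ 3) := by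
  have h3 : ζ ^ 3 = 1 := by linear_combination (ζ - 1) * hζ
  have hζ0 : ζ ≠ 0 := by rintro rfl; simp at hζ
  have e1 : q / (ζ * w) = ζ ^ 2 * (q / w) := by field_simp; rw [h3, mul_one]
  have e2 : q / (ζ ^ 2 * w) = ζ * (q / w) := by field_simp; rw [h3, mul_one]
  have a := qPochInf_mul_cube hζ w hq
  have b := qPochInf_mul_cube hζ (q / w) hq
  rw [div_pow] at b
  simp only [thetaProd, e1, e2]
  rw [← a, ← b]
  ring

/-- The sum of `g₃` over `w, ζw, ζ²w`, multiplied by `(w³; q³)_∞ (q³/w³; q³)_∞`. -/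
def g3RegSum (ζ w q : ℂ) : ℂ :=
  g3Reg w q * (thetaProd (ζ * w) q * thetaProd (ζ ^ 2 * w) q)
    + g3Reg (ζ * w) q * (thetaProd w q * thetaProd (ζ ^ 2 * w) q)
    + g3Reg (ζ ^ 2 * w) q * (thetaProd w q * thetaProd (ζ * w) q)

/-- The homogeneous factors w² and -1/w combine to 1 because (ζw)³ = w³; the inhomogeneous parts sum
to multiples of 1 + ζ + ζ² = 0. -/
lemma g3RegSum_mul {ζ : ℂ} (hζ : ζ ^ 2 + ζ + 1 = 0) {w q : ℂ} (hw : w ≠ 0) (hq0 : q ≠ 0)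
    (hq : ‖q‖ < 1) : g3RegSum ζ (w * q) q = g3RegSum ζ w q := by
  have h3 : ζ ^ 3 = 1 := by linear_combination (ζ - 1) * hζ
  have hζ0 : ζ ≠ 0 := by rintro rfl; simp at hζ
  have e1 : ζ * (w * q) = ζ * w * q := by ring
  have e2 : ζ ^ 2 * (w * q) = ζ ^ 2 * w * q := by ring
  have w1 : ζ * w ≠ 0 := mul_ne_zero hζ0 hw
  have w2 : ζ ^ 2 * w ≠ 0 := mul_ne_zero (pow_ne_zero _ hζ0) hw
  simp only [g3RegSum, e1, e2, g3Reg_mul hw hq0 hq, g3Reg_mul w1 hq0 hq, g3Reg_mul w2 hq0 hq,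
    thetaProd_mul hw hq0 hq, thetaProd_mul w1 hq0 hq, thetaProd_mul w2 hq0 hq]
  have i1 : (ζ * w)⁻¹ = ζ ^ 2 * w⁻¹ := by field_simp; exact h3.symm
  have i2 : (ζ ^ 2 * w)⁻¹ = ζ * w⁻¹ := by field_simp; exact h3.symm
  rw [i1, i2]
  generalize thetaProd w q = A
  generalize thetaProd (ζ * w) q = B
  generalize thetaProd (ζ ^ 2 * w) q = C
  generalize g3Reg w q = x
  generalize g3Reg (ζ * w) q = y
  generalize g3Reg (ζ ^ 2 * w) q = z
  have hww : w * w⁻¹ = 1 := mul_inv_cancel₀ hw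
  field_simp
  linear_combination (A * B * C * (ζ + w * ζ ^ 2)) * hζ +
    (C * w ^ 2 * x * B + C * w ^ 2 * A * y + w ^ 2 * A * B * z * (ζ ^ 3 + 1)) * h3

lemma differentiable_g3RegSum_exp (ζ : ℂ) {q : ℂ} (hq : ‖q‖ < 1) :
    Differentiable ℂ fun z => g3RegSum ζ (Complex.exp z) q := by
  have h1 (c : ℂ) := differentiable_thetaProd_exp hq c
  have h2 (c : ℂ) := differentiable_g3Reg_exp hq c
  have t := h1 1
  have g := h2 1
  simp only [one_mul] at t g
  exact ((g.mul ((h1 ζ).mul (h1 (ζ ^ 2)))).add ((h2 ζ).mul (t.mul (h1 (ζ ^ 2))))).add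
    ((h2 (ζ ^ 2)).mul (t.mul (h1 ζ)))

/-- Two summands contain `thetaProd 1 q = 0`. In the remaining one (1 - ζ)(1 - ζ²) = 3, and the
other factors pair up into the square of the product over cube roots. -/
lemma g3RegSum_one {ζ : ℂ} (hζ : ζ ^ 2 + ζ + 1 = 0) {q : ℂ} (hq : ‖q‖ < 1) :
    qPochInf q q * g3RegSum ζ 1 q = 3 * qPochInf (q ^ 3) (q ^ 3) ^ 2 := by
  have h3 : ζ ^ 3 = 1 := by linear_combination (ζ - 1) * hζ
  have hζ0 : ζ ≠ 0 := by rintro rfl; simp at hζ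
  have e1 : q / ζ = ζ ^ 2 * q := by field_simp; rw [h3]; ring
  have e2 : q / ζ ^ 2 = ζ * q := by field_simp; rw [h3]; ring
  rw [g3RegSum, g3Reg_one hq, thetaProd_one hq, ← qPochInf_mul_cube hζ q hq]
  simp only [thetaProd, mul_one, e1, e2, qPochInf_eq_one_sub_mul ζ hq,
    qPochInf_eq_one_sub_mul (ζ ^ 2) hq]
  generalize qPochInf q q = A
  generalize qPochInf (ζ * q) q = B
  generalize qPochInf (ζ ^ 2 * q) q = C
  linear_combination (A ^ 2 * B ^ 2 * C ^ 2) * (h3 - hζ)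

/-- As a function of log w the sum has the periods 2πi and -log q; the sign makes the real part of
the second one positive. Liouville reduces to w = 1. -/
lemma g3RegSum_eq {ζ : ℂ} (hζ : ζ ^ 2 + ζ + 1 = 0) {w q : ℂ} (hw : w ≠ 0) (hq0 : q ≠ 0)
    (hq : ‖q‖ < 1) : qPochInf q q * g3RegSum ζ w q = 3 * qPochInf (q ^ 3) (q ^ 3) ^ 2 := by
  have hl : 0 < (-Complex.log q).re := by
    rw [Complex.neg_re, Complex.log_re]
    have := Real.log_neg (norm_pos_iff.2 hq0) hq
    linarith
  have h := (differentiable_g3RegSum_exp ζ hq).apply_eq_of_periodic Real.two_pi_pos hl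
    (fun z => by
      simp only
      congr 1
      push_cast
      exact Complex.exp_periodic z)
    (fun z => by
      simp only
      rw [← g3RegSum_mul hζ (Complex.exp_ne_zero _) hq0 hq]
      congr 1
      nth_rw 2 [← Complex.exp_log hq0]
      rw [← Complex.exp_add, neg_add_cancel_right]) (Complex.log w) 0
  rw [← g3RegSum_one hζ hq]
  simp only [Complex.exp_log hw, Complex.exp_zero] at h
  rw [h]

/-- The sum of `g₃` over `w, ζw, ζ²w` is an eta-theta quotient. -/
theorem universalG3_add_add {ζ : ℂ} (hζ : ζ ^ 2 + ζ + 1 = 0) {w q : ℂ} (hw : w ≠ 0)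
    (hq0 : q ≠ 0) (hq : ‖q‖ < 1) (h1 : ∀ i j : ℕ, ζ ^ i * w * q ^ j ≠ 1)
    (h2 : ∀ i j : ℕ, q / (ζ ^ i * w) * q ^ j ≠ 1) :
    (universalG3 w q + universalG3 (ζ * w) q + universalG3 (ζ ^ 2 * w) q) *
      (qPochInf q q * thetaProd (w ^ 3) (q ^ 3)) = 3 * qPochInf (q ^ 3) (q ^ 3) ^ 2 := by
  rw [← g3RegSum_eq hζ hw hq0 hq, ← thetaProd_cube hζ hw hq, g3RegSum]
  have a0 := g3Reg_eq hq (by simpa using h1 0) (by simpa using h2 0)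
  have a1 := g3Reg_eq hq (by simpa using h1 1) (by simpa using h2 1)
  have a2 := g3Reg_eq hq (h1 2) (h2 2)
  rw [a0, a1, a2]
  ring

/-! ### The Jacobi triple product -/

lemma expTwoPiI_add (x y : ℂ) : expTwoPiI (x + y) = expTwoPiI x * expTwoPiI y := by
  rw [expTwoPiI, mul_add, Complex.exp_add]; rfl

lemma expTwoPiI_neg (x : ℂ) : expTwoPiI (-x) = (expTwoPiI x)⁻¹ := by
  rw [expTwoPiI, mul_neg, Complex.exp_neg]; rfl

lemma expTwoPiI_sub (x y : ℂ) : expTwoPiI (x - y) = expTwoPiI x / expTwoPiI y := by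
  rw [sub_eq_add_neg, expTwoPiI_add, expTwoPiI_neg, div_eq_mul_inv]

lemma expTwoPiI_ne_zero (x : ℂ) : expTwoPiI x ≠ 0 := Complex.exp_ne_zero _

@[simp] lemma expTwoPiI_zero : expTwoPiI 0 = 1 := by simp [expTwoPiI]

lemma expTwoPiI_nat_mul (n : ℕ) (x : ℂ) : expTwoPiI (n * x) = expTwoPiI x ^ n := by
  rw [expTwoPiI, expTwoPiI, ← Complex.exp_nat_mul]; ring_nf

lemma expTwoPiI_int_mul (n : ℤ) (x : ℂ) : expTwoPiI (n * x) = expTwoPiI x ^ n := by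
  rw [expTwoPiI, expTwoPiI, ← Complex.exp_int_mul]; ring_nf

@[simp] lemma expTwoPiI_int (n : ℤ) : expTwoPiI n = 1 := by
  rw [expTwoPiI, mul_comm, Complex.exp_int_mul_two_pi_mul_I]

lemma expTwoPiI_half : expTwoPiI (1 / 2) = -1 := by
  rw [expTwoPiI, ← Complex.exp_pi_mul_I]; ring_nf

lemma norm_expTwoPiI (x : ℂ) : ‖expTwoPiI x‖ = Real.exp (-2 * Real.pi * x.im) := by
  rw [expTwoPiI, Complex.norm_exp]; simp

lemma norm_expTwoPiI_lt_one {τ : ℂ} (hτ : 0 < τ.im) : ‖expTwoPiI τ‖ < 1 := by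
  rw [norm_expTwoPiI, Real.exp_lt_one_iff]
  nlinarith [Real.pi_pos]

lemma expTwoPiI_eq_one_iff {x : ℂ} : expTwoPiI x = 1 ↔ ∃ n : ℤ, x = n := by
  rw [expTwoPiI, Complex.exp_eq_one_iff]
  have : (2 * Real.pi * Complex.I : ℂ) ≠ 0 := Complex.two_pi_I_ne_zero
  refine exists_congr fun n => ⟨fun h => mul_left_cancel₀ this (h.trans (mul_comm _ _)), ?_⟩
  rintro rfl
  ring

/-- The coefficient of `y^k` in `(y; q)_M`. -/
def qBinomCoeff (q : ℂ) (M k : ℕ) : ℂ :=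
  (-1) ^ k * q ^ k.choose 2 * (qPoch q q M / (qPoch q q k * qPoch q q (M - k)))

lemma one_sub_pow_succ_ne_zero {q : ℂ} (hq : ‖q‖ < 1) (n : ℕ) : 1 - q ^ (n + 1) ≠ 0 := by
  have := mul_pow_ne_one hq hq n
  rw [← pow_succ'] at this
  exact sub_ne_zero.2 this.symm

/-- This is the q-Pascal rule. It needs k < M: for k = M truncated subtraction gives `qBinomCoeff q
M (M + 1)` a wrong nonzero value. -/
lemma qBinomCoeff_succ {q : ℂ} (hq : ‖q‖ < 1) {M k : ℕ} (hk : k < M) :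
    qBinomCoeff q (M + 1) (k + 1) = qBinomCoeff q M (k + 1) - q ^ M * qBinomCoeff q M k := by
  obtain ⟨d, rfl⟩ := Nat.exists_eq_add_of_lt hk
  have e1 : k + d + 1 + 1 - (k + 1) = d + 1 := by omega
  have e2 : k + d + 1 - (k + 1) = d := by omega
  have e3 : k + d + 1 - k = d + 1 := by omega
  have e4 : (k + 1).choose 2 = k.choose 2 + k := by
    rw [Nat.choose_succ_succ' k 1, Nat.choose_one_right, add_comm]
  have e5 (n : ℕ) : qPoch q q (n + 1) = qPoch q q n * (1 - q ^ (n + 1)) := by rw [qPoch_succ]; ring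
  have hn := qPoch_ne_zero_of_norm_lt_one hq hq
  have := hn k
  have := hn d
  have := one_sub_pow_succ_ne_zero hq k
  have := one_sub_pow_succ_ne_zero hq d
  rw [qBinomCoeff, qBinomCoeff, qBinomCoeff, e1, e2, e3, e4, e5 (k + d + 1), e5 k, e5 d]
  generalize qPoch q q (k + d + 1) = A
  field_simp
  ring

/-- The finite `q`-binomial theorem. -/
lemma qPoch_eq_sum (y : ℂ) {q : ℂ} (hq : ‖q‖ < 1) (M : ℕ) :
    qPoch y q M = ∑ k ∈ Finset.range (M + 1), qBinomCoeff q M k * y ^ k := by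
  have hn := qPoch_ne_zero_of_norm_lt_one hq hq
  have c0 (M : ℕ) : qBinomCoeff q M 0 = 1 := by simp [qBinomCoeff, div_self (hn M)]
  have cM (M : ℕ) : qBinomCoeff q M M = (-1) ^ M * q ^ M.choose 2 := by
    simp [qBinomCoeff, div_self (hn M)]
  induction M with
  | zero => simp [c0]
  | succ M ih =>
    have e4 : (M + 1).choose 2 = M.choose 2 + M := by
      rw [Nat.choose_succ_succ' M 1, Nat.choose_one_right, add_comm]
    have h : ∑ k ∈ Finset.range M, qBinomCoeff q (M + 1) (k + 1) * y ^ (k + 1)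
        = ∑ k ∈ Finset.range M, qBinomCoeff q M (k + 1) * y ^ (k + 1)
          - y * q ^ M * ∑ k ∈ Finset.range M, qBinomCoeff q M k * y ^ k := by
      rw [Finset.mul_sum, ← Finset.sum_sub_distrib]
      refine Finset.sum_congr rfl fun k hk => ?_
      rw [qBinomCoeff_succ hq (Finset.mem_range.1 hk)]
      ring
    have i1 := Finset.sum_range_succ (fun k => qBinomCoeff q M k * y ^ k) M
    have i2 := Finset.sum_range_succ' (fun k => qBinomCoeff q M k * y ^ k) M
    rw [Finset.sum_range_succ, Finset.sum_range_succ', h, qPoch_succ, ih, c0, cM, e4]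
    simp only [c0, cM, pow_zero, mul_one] at i1 i2
    linear_combination y * q ^ M * i1 * (-1) + i2

/-- Each factor is 1 - xq^{-j} = -xq^{-j}(1 - x⁻¹q^j). The summand N/2 in the exponent records
(-1)^N. -/
lemma qPoch_shift (z τ : ℂ) (N : ℕ) :
    qPoch (expTwoPiI (z - N * τ)) (expTwoPiI τ) N
      = expTwoPiI (N / 2 + N * z - N * (N + 1) / 2 * τ)
        * qPoch (expTwoPiI (τ - z)) (expTwoPiI τ) N := by
  induction N with
  | zero => simp
  | succ N ih =>
    have e1 : expTwoPiI (z - (N + 1 : ℕ) * τ) * expTwoPiI τ = expTwoPiI (z - N * τ) := by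
      rw [← expTwoPiI_add]; push_cast; ring_nf
    have e2 : expTwoPiI (((N + 1 : ℕ) : ℂ) / 2 + (N + 1 : ℕ) * z
          - (N + 1 : ℕ) * ((N + 1 : ℕ) + 1) / 2 * τ)
        = expTwoPiI (1 / 2) * expTwoPiI (z - (N + 1 : ℕ) * τ)
          * expTwoPiI (N / 2 + N * z - N * (N + 1) / 2 * τ) := by
      rw [← expTwoPiI_add, ← expTwoPiI_add]; push_cast; ring_nf
    have e3 : expTwoPiI (z - (N + 1 : ℕ) * τ) * (expTwoPiI (τ - z) * expTwoPiI τ ^ N) = 1 := by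
      rw [← expTwoPiI_nat_mul, ← expTwoPiI_add, ← expTwoPiI_add, ← expTwoPiI_zero]
      push_cast; ring_nf
    rw [qPoch_succ', e1, ih, qPoch_succ, e2, expTwoPiI_half]
    linear_combination (-expTwoPiI (N / 2 + N * z - N * (N + 1) / 2 * τ) *
      qPoch (expTwoPiI (τ - z)) (expTwoPiI τ) N) * e3

lemma jacobiTheta₂_term_eq (z τ : ℂ) (m : ℤ) :
    jacobiTheta₂_term m (z + 1 / 2 - τ / 2) τ
      = expTwoPiI (m / 2 + m * z + m * (m - 1) / 2 * τ) := by
  rw [jacobiTheta₂_term, expTwoPiI]; ring_nf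

/-- The finite form of the triple product, as a sum over `ℤ` with finite support. -/
lemma qPoch_mul_qPoch_eq_tsum (z : ℂ) {τ : ℂ} (hτ : 0 < τ.im) (N : ℕ) :
    qPoch (expTwoPiI z) (expTwoPiI τ) N * qPoch (expTwoPiI (τ - z)) (expTwoPiI τ) N
      = ∑' m : ℤ, jacobiTheta₂_term m (z + 1 / 2 - τ / 2) τ *
        if m.natAbs ≤ N then qPoch (expTwoPiI τ) (expTwoPiI τ) (2 * N) /
          (qPoch (expTwoPiI τ) (expTwoPiI τ) (N + m).toNat
            * qPoch (expTwoPiI τ) (expTwoPiI τ) (N - m).toNat) else 0 := by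
  have hq := norm_expTwoPiI_lt_one hτ
  set q := expTwoPiI τ with hqdef
  set c := expTwoPiI (N / 2 + N * z - N * (N + 1) / 2 * τ) with hc
  -- The q-binomial theorem is applied with 2N factors to y = xq^{-N}: half of them lie below x and
  -- are reflected, the other half start at x.
  have h1 : qPoch (expTwoPiI (z - N * τ)) q (2 * N)
      = c * (qPoch (expTwoPiI z) q N * qPoch (expTwoPiI (τ - z)) q N) := by
    have e : qPoch (expTwoPiI (z - N * τ)) q (N + N)
        = qPoch (expTwoPiI (z - N * τ)) q N * qPoch (expTwoPiI z) q N := by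
      simp only [qPoch, Finset.prod_range_add]
      congr 1
      refine Finset.prod_congr rfl fun j _ => ?_
      rw [pow_add, ← mul_assoc, hqdef, ← expTwoPiI_nat_mul N, ← expTwoPiI_add]
      ring_nf
    rw [two_mul, e, qPoch_shift]
    ring
  have hc0 : c ≠ 0 := expTwoPiI_ne_zero _
  refine mul_left_cancel₀ hc0 ?_
  rw [← h1, qPoch_eq_sum _ hq, tsum_eq_sum (s := Finset.Icc (-N : ℤ) N), Finset.mul_sum]
  -- The index k of the binomial sum is m + N.
  · refine Finset.sum_bij (fun k _ => (k : ℤ) - N) (fun k hk => ?_) (fun k _ k' _ h => by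
      simpa using h) (fun m hm => ?_) (fun k hk => ?_)
    · rw [Finset.mem_range] at hk; rw [Finset.mem_Icc]; omega
    · rw [Finset.mem_Icc] at hm
      exact ⟨(m + N).toNat, by rw [Finset.mem_range]; omega, by omega⟩
    · rw [Finset.mem_range] at hk
      have e1 : ((N : ℤ) + (k - N)).toNat = k := by omega
      have e2 : ((N : ℤ) - (k - N)).toNat = 2 * N - k := by omega
      have e3 : ((k : ℤ) - N).natAbs ≤ N := by omega
      rw [if_pos e3, e1, e2, jacobiTheta₂_term_eq, qBinomCoeff, ← mul_assoc, hc,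
        ← expTwoPiI_add, ← expTwoPiI_half, hqdef, ← expTwoPiI_nat_mul, ← expTwoPiI_nat_mul,
        ← expTwoPiI_nat_mul, mul_right_comm, ← expTwoPiI_add, ← expTwoPiI_add,
        Nat.cast_choose_two]
      push_cast
      ring_nf
  · intro m hm
    rw [if_neg, mul_zero]
    rw [Finset.mem_Icc] at hm
    omega

/-- The Jacobi triple product identity. -/
theorem jacobiTheta₂_eq_thetaProd (z : ℂ) {τ : ℂ} (hτ : 0 < τ.im) :
    jacobiTheta₂ (z + 1 / 2 - τ / 2) τ
      = qPochInf (expTwoPiI τ) (expTwoPiI τ) * thetaProd (expTwoPiI z) (expTwoPiI τ) := by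
  have hq := norm_expTwoPiI_lt_one hτ
  have hinf := qPochInf_ne_zero_of_norm_lt_one hq hq
  have h1 : Tendsto (fun N => qPoch (expTwoPiI z) (expTwoPiI τ) N *
      qPoch (expTwoPiI (τ - z)) (expTwoPiI τ) N) atTop
      (𝓝 (thetaProd (expTwoPiI z) (expTwoPiI τ))) := by
    rw [thetaProd, ← expTwoPiI_sub]
    exact (tendsto_qPoch _ hq).mul (tendsto_qPoch _ hq)
  simp only [qPoch_mul_qPoch_eq_tsum z hτ] at h1
  obtain ⟨b, hb, hbn⟩ := exists_le_norm_qPoch hq (mul_pow_ne_one hq hq)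
  set q := expTwoPiI τ
  have h2 : Tendsto (fun N : ℕ => ∑' m : ℤ, jacobiTheta₂_term m (z + 1 / 2 - τ / 2) τ *
        if m.natAbs ≤ N then qPoch q q (2 * N) / (qPoch q q (N + m).toNat
            * qPoch q q (N - m).toNat) else 0) atTop
      (𝓝 (∑' m : ℤ, jacobiTheta₂_term m (z + 1 / 2 - τ / 2) τ *
        (qPochInf q q / (qPochInf q q * qPochInf q q)))) := by
    -- The Gaussian ratios are bounded uniformly in N and m, and each tends to 1/(q; q)_∞, so the
    -- theta series itself gives the majorant.
    refine tendsto_tsum_of_dominated_convergence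
      (bound := fun m => ‖jacobiTheta₂_term m (z + 1 / 2 - τ / 2) τ‖ *
        (Real.exp (‖q‖ / (1 - ‖q‖)) / (b * b)))
      (((summable_jacobiTheta₂_term_iff _ τ).2 hτ).norm.mul_right _) (fun m => ?_)
      (Eventually.of_forall fun N m => ?_)
    · refine Tendsto.const_mul _ ?_
      have l0 : Tendsto (fun N : ℕ => 2 * N) atTop atTop := by
        refine tendsto_atTop.2 fun M => ?_
        filter_upwards [eventually_ge_atTop M] with N hN using by omega
      have l1 : Tendsto (fun N : ℕ => ((N : ℤ) + m).toNat) atTop atTop := by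
        refine tendsto_atTop.2 fun M => ?_
        filter_upwards [eventually_ge_atTop (M + m.natAbs)] with N hN using by omega
      have l2 : Tendsto (fun N : ℕ => ((N : ℤ) - m).toNat) atTop atTop := by
        refine tendsto_atTop.2 fun M => ?_
        filter_upwards [eventually_ge_atTop (M + m.natAbs)] with N hN using by omega
      have ht := tendsto_qPoch q hq
      refine ((ht.comp l0).div ((ht.comp l1).mul (ht.comp l2)) (mul_ne_zero hinf hinf)).congr' ?_
      filter_upwards [eventually_ge_atTop m.natAbs] with N hN
      rw [if_pos hN]
      rfl
    · rw [norm_mul]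
      refine mul_le_mul_of_nonneg_left ?_ (norm_nonneg _)
      split_ifs
      · rw [norm_div, norm_mul]
        have := norm_qPoch_le q hq (2 * N)
        have := hbn ((N : ℤ) + m).toNat
        have := hbn ((N : ℤ) - m).toNat
        gcongr
      · rw [norm_zero]; positivity
  have h3 := tendsto_nhds_unique h1 h2
  rw [tsum_mul_right] at h3
  rw [h3, jacobiTheta₂]
  field_simp

lemma oddTheta_eq_jacobiTheta₂ (z τ : ℂ) :
    oddTheta z τ = -expTwoPiI (z / 2 + τ / 8) * jacobiTheta₂ (z + 1 / 2 + τ / 2) τ := by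
  rw [oddTheta, jacobiTheta₂, ← tsum_mul_left]
  refine tsum_congr fun n => ?_
  have h : (-1 : ℂ) ^ (n + 1) = -expTwoPiI (n / 2) := by
    rw [zpow_add_one₀ (by norm_num), ← expTwoPiI_half, ← expTwoPiI_int_mul, expTwoPiI_half]
    ring_nf
  rw [h, jacobiTheta₂_term, expTwoPiI, expTwoPiI, expTwoPiI, neg_mul, neg_mul, neg_mul,
    ← Complex.exp_add, ← Complex.exp_add, ← Complex.exp_add]
  ring_nf

/-- The product formula for the odd Jacobi theta function. -/
theorem oddTheta_eq_thetaProd (z : ℂ) {τ : ℂ} (hτ : 0 < τ.im) :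
    oddTheta z τ = expTwoPiI (τ / 8 - z / 2) * (qPochInf (expTwoPiI τ) (expTwoPiI τ) *
      thetaProd (expTwoPiI z) (expTwoPiI τ)) := by
  rw [← jacobiTheta₂_eq_thetaProd z hτ, oddTheta_eq_jacobiTheta₂]
  -- The theta series and the triple product use shifts that differ by one period τ;
  -- quasi-periodicity supplies the factor and the sign.
  have e : z + 1 / 2 + τ / 2 = z + 1 / 2 - τ / 2 + τ := by ring
  have e2 : Complex.exp (-Real.pi * Complex.I * (τ + 2 * (z + 1 / 2 - τ / 2)))
      = expTwoPiI (-z - 1 / 2) := by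
    rw [expTwoPiI]; ring_nf
  have e3 : expTwoPiI (-z - 1 / 2) = -expTwoPiI (-z) := by
    rw [expTwoPiI_sub, expTwoPiI_half, div_neg, div_one]
  rw [e, jacobiTheta₂_add_left', e2, e3, ← mul_assoc, neg_mul_neg, ← expTwoPiI_add]
  ring_nf

lemma eta_eq_qPochInf (τ : ℂ) :
    ModularForm.eta τ = expTwoPiI (τ / 24) * qPochInf (expTwoPiI τ) (expTwoPiI τ) := by
  rw [ModularForm.eta, qPochInf, expTwoPiI, Function.Periodic.qParam]
  congr 1
  · push_cast; ring_nf
  · refine tprod_congr fun n => ?_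
    rw [ModularForm.eta_q_eq_pow, expTwoPiI, pow_succ']

/-! ### The action of `SL₂(ℤ)` -/

lemma SL2_det (γ : SL(2, ℤ)) : (γ 0 0 : ℂ) * γ 1 1 - γ 0 1 * γ 1 0 = 1 := by
  have h := γ.det_coe
  rw [Matrix.det_fin_two] at h
  exact_mod_cast h

lemma coe_SL2_smul (γ : SL(2, ℤ)) (τ : ℍ) :
    ((γ • τ : ℍ) : ℂ) = ((γ 0 0 : ℂ) * τ + γ 0 1) / autDenom γ τ := by
  rw [UpperHalfPlane.coe_specialLinearGroup_apply]
  simp [autDenom]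

lemma autDenom_ne_zero (γ : SL(2, ℤ)) (τ : ℍ) : autDenom γ τ ≠ 0 := by
  have h := UpperHalfPlane.denom_ne_zero (γ : GL (Fin 2) ℝ) τ
  simpa [UpperHalfPlane.denom, autDenom] using h

lemma SL2_mul_apply (γ δ : SL(2, ℤ)) (i j : Fin 2) :
    (γ * δ) i j = γ i 0 * δ 0 j + γ i 1 * δ 1 j := by
  simp [Matrix.mul_apply, Fin.sum_univ_two]

lemma autDenom_mul (γ δ : SL(2, ℤ)) (τ : ℍ) :
    autDenom (γ * δ) τ = autDenom γ ((δ • τ : ℍ) : ℂ) * autDenom δ τ := by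
  have h := autDenom_ne_zero δ τ
  rw [coe_SL2_smul, autDenom, autDenom, SL2_mul_apply, SL2_mul_apply]
  field_simp
  rw [autDenom]
  push_cast
  ring

lemma coe_S_smul (τ : ℍ) : ((ModularGroup.S • τ : ℍ) : ℂ) = -1 / τ := by
  rw [coe_SL2_smul]; simp [autDenom, ModularGroup.S]

lemma coe_T_smul (τ : ℍ) : ((ModularGroup.T • τ : ℍ) : ℂ) = τ + 1 := by
  rw [coe_SL2_smul]; simp [autDenom, ModularGroup.T]

/-! ### The Jacobi form `ϑ / η³` of weight `-1` and index `1/2` -/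

/-- The quotient `ϑ(z; τ) / η(τ)³`. -/
def kleinTheta (z τ : ℂ) : ℂ := oddTheta z τ / ModularForm.eta τ ^ 3

lemma expTwoPiI_add_one (x : ℂ) : expTwoPiI (x + 1) = expTwoPiI x := by
  rw [expTwoPiI_add, ← Int.cast_one, expTwoPiI_int, mul_one]

lemma kleinTheta_add_one_right (z : ℂ) {τ : ℂ} (hτ : 0 < τ.im) :
    kleinTheta z (τ + 1) = kleinTheta z τ := by
  have hτ' : 0 < (τ + 1).im := by simpa using hτ
  rw [kleinTheta, kleinTheta, oddTheta_eq_thetaProd z hτ, oddTheta_eq_thetaProd z hτ',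
    eta_eq_qPochInf, eta_eq_qPochInf, expTwoPiI_add_one, mul_pow, mul_pow,
    ← expTwoPiI_nat_mul, ← expTwoPiI_nat_mul]
  have e1 : (τ + 1) / 8 - z / 2 = 1 / 8 + (τ / 8 - z / 2) := by ring
  have e2 : ((3 : ℕ) : ℂ) * ((τ + 1) / 24) = 1 / 8 + (3 : ℕ) * (τ / 24) := by push_cast; ring
  rw [e1, e2, expTwoPiI_add, expTwoPiI_add (1 / 8), mul_assoc, mul_assoc,
    mul_div_mul_left _ _ (expTwoPiI_ne_zero _)]

/-- The laws of η and of `jacobiTheta₂` under τ ↦ -1/τ use different square roots. As arg(-iτ) lies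
in (-π/2, π/2), adding arg i = π/2 does not cross the branch cut. -/
lemma sqrt_eq_cpow_mul_sqrt_I {τ : ℂ} (hτ : 0 < τ.im) :
    Complex.sqrt τ = (-Complex.I * τ) ^ (1 / 2 : ℂ) * Complex.sqrt Complex.I := by
  have h0 : τ ≠ 0 := by rintro rfl; simp at hτ
  have h1 : -Complex.I * τ ≠ 0 := mul_ne_zero (neg_ne_zero.2 Complex.I_ne_zero) h0
  have h2 : 0 < (-Complex.I * τ).re := by simpa using hτ
  have h3 := Complex.abs_arg_lt_pi_div_two_iff.2 (Or.inl h2)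
  rw [abs_lt] at h3
  have h4 := Complex.log_mul h1 Complex.I_ne_zero (by
    rw [Complex.arg_I]; constructor <;> linarith [h3.1, h3.2, Real.pi_pos])
  have h5 : -Complex.I * τ * Complex.I = τ := by linear_combination -τ * Complex.I_sq
  rw [h5] at h4
  rw [Complex.sqrt, Complex.sqrt, Complex.cpow_def_of_ne_zero h0, Complex.cpow_def_of_ne_zero h1,
    Complex.cpow_def_of_ne_zero Complex.I_ne_zero, h4, ← Complex.exp_add]
  ring_nf

lemma eta_neg_one_div {τ : ℂ} (hτ : 0 < τ.im) :
    ModularForm.eta (-1 / τ) = (-Complex.I * τ) ^ (1 / 2 : ℂ) * ModularForm.eta τ := by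
  have h := ModularForm.eta_comp_eq_csqrt_I_inv (x := τ) hτ
  simp only [Function.comp_apply, Pi.smul_apply, Pi.mul_apply, smul_eq_mul] at h
  have hI : Complex.sqrt Complex.I ≠ 0 := by simp [Complex.sqrt]
  rw [h, sqrt_eq_cpow_mul_sqrt_I hτ]
  field_simp

lemma oddTheta_neg_one_div (z : ℂ) {τ : ℂ} (hτ : 0 < τ.im) :
    oddTheta (z / τ) (-1 / τ)
      = -Complex.I * (-Complex.I * τ) ^ (1 / 2 : ℂ) * expTwoPiI (z ^ 2 / (2 * τ)) *
        oddTheta z τ := by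
  have h0 : τ ≠ 0 := by rintro rfl; simp at hτ
  have hc : (-Complex.I * τ) ^ (1 / 2 : ℂ) ≠ 0 := by
    simp [Complex.cpow_eq_zero_iff, h0]
  -- Divided by τ, this argument is z/τ + 1/2 + (-1/τ)/2, the shift required at -1/τ. At τ it is off
  -- by the period 1 only.
  have h := jacobiTheta₂_functional_equation (z + τ / 2 - 1 / 2) τ
  have e1 : z + 1 / 2 + τ / 2 = z + τ / 2 - 1 / 2 + 1 := by ring
  have e2 : z / τ + 1 / 2 + -1 / τ / 2 = (z + τ / 2 - 1 / 2) / τ := by field_simp; ring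
  have e3 : Complex.exp (-Real.pi * Complex.I * (z + τ / 2 - 1 / 2) ^ 2 / τ)
      = expTwoPiI (-((z + τ / 2 - 1 / 2) ^ 2 / (2 * τ))) := by
    rw [expTwoPiI]; congr 1; field_simp
  have e4 : -Complex.I = expTwoPiI (-(1 / 4)) := by
    rw [expTwoPiI, ← Complex.exp_neg_pi_div_two_mul_I]; ring_nf
  rw [oddTheta_eq_jacobiTheta₂, oddTheta_eq_jacobiTheta₂, e1, e2, jacobiTheta₂_add_left, h, e3]
  nth_rw 1 [e4]
  generalize jacobiTheta₂ ((z + τ / 2 - 1 / 2) / τ) (-1 / τ) = J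
  have e5 : expTwoPiI (z / τ / 2 + -1 / τ / 8) = expTwoPiI (-(1 / 4)) *
      expTwoPiI (z ^ 2 / (2 * τ)) * expTwoPiI (z / 2 + τ / 8) *
      expTwoPiI (-((z + τ / 2 - 1 / 2) ^ 2 / (2 * τ))) := by
    rw [← expTwoPiI_add, ← expTwoPiI_add, ← expTwoPiI_add]
    congr 1; field_simp; ring
  rw [e5]
  generalize (-Complex.I * τ) ^ (1 / 2 : ℂ) = c at *
  field_simp

/-- The factor -i(-iτ)^{1/2} of ϑ over the factor (-iτ)^{3/2} of η³ is exactly 1/τ, without a root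
of unity or a choice of branch. -/
lemma kleinTheta_neg_one_div (z : ℂ) {τ : ℂ} (hτ : 0 < τ.im) :
    kleinTheta (z / τ) (-1 / τ) = τ⁻¹ * expTwoPiI (z ^ 2 / (2 * τ)) * kleinTheta z τ := by
  have h0 : τ ≠ 0 := by rintro rfl; simp at hτ
  have hc : ((-Complex.I * τ) ^ (1 / 2 : ℂ)) ^ 2 = -Complex.I * τ := by
    rw [← Complex.cpow_nat_mul]; norm_num
  have hc0 : (-Complex.I * τ) ^ (1 / 2 : ℂ) ≠ 0 := by
    simp [Complex.cpow_eq_zero_iff, h0]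
  have he := ModularForm.eta_ne_zero (z := τ) hτ
  rw [kleinTheta, kleinTheta, oddTheta_neg_one_div z hτ, eta_neg_one_div hτ]
  generalize (-Complex.I * τ) ^ (1 / 2 : ℂ) = c at *
  field_simp
  linear_combination -(expTwoPiI (z ^ 2 / (2 * τ)) * oddTheta z τ) * hc

lemma closure_S_T_induction {p : SL(2, ℤ) → Prop} (hS : p ModularGroup.S) (hT : p ModularGroup.T)
    (h1 : p 1) (hmul : ∀ γ δ, p γ → p δ → p (γ * δ)) (hinv : ∀ γ, p γ → p γ⁻¹)
    (γ : SL(2, ℤ)) : p γ := by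
  have hγ : γ ∈ Subgroup.closure {ModularGroup.S, ModularGroup.T} := by
    simp [SpecialLinearGroup.SL2Z_generators]
  refine Subgroup.closure_induction (p := fun γ _ => p γ) ?_ h1 (fun γ δ _ _ => hmul γ δ)
    (fun γ _ => hinv γ) hγ
  rintro _ (rfl | rfl)
  exacts [hS, hT]

/-- `ϑ / η³` is invariant under `SL₂(ℤ)` in weight `-1` and index `1/2`. -/
theorem kleinTheta_smul (γ : SL(2, ℤ)) (z : ℂ) (τ : ℍ) :
    kleinTheta (z / autDenom γ τ) ((γ • τ : ℍ) : ℂ)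
      = (autDenom γ τ)⁻¹ * expTwoPiI ((γ 1 0 : ℂ) * z ^ 2 / (2 * autDenom γ τ))
        * kleinTheta z τ := by
  induction γ using closure_S_T_induction generalizing z τ with
  | hS =>
    have e : autDenom ModularGroup.S τ = τ := by simp [autDenom, ModularGroup.S]
    rw [coe_S_smul, e, kleinTheta_neg_one_div z τ.2]
    simp [ModularGroup.S]
  | hT =>
    have e : autDenom ModularGroup.T τ = 1 := by simp [autDenom, ModularGroup.T]
    rw [coe_T_smul, e, div_one, kleinTheta_add_one_right z τ.2]
    simp [ModularGroup.T]
  | h1 => simp [autDenom]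
  | hmul γ δ hγ hδ =>
    have n1 := autDenom_ne_zero γ (δ • τ)
    have n2 := autDenom_ne_zero δ τ
    have h := hγ (z / autDenom δ τ) (δ • τ)
    -- The exponent cz²/(cτ + d) is an additive cocycle; this is where det δ = 1 enters.
    have e : ((γ * δ) 1 0 : ℂ) * z ^ 2 / (2 * (autDenom γ ((δ • τ : ℍ) : ℂ) * autDenom δ τ))
        = (γ 1 0 : ℂ) * (z / autDenom δ τ) ^ 2 / (2 * autDenom γ ((δ • τ : ℍ) : ℂ))
          + (δ 1 0 : ℂ) * z ^ 2 / (2 * autDenom δ τ) := by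
      have hm := autDenom_mul γ δ τ
      have d := SL2_det δ
      field_simp
      rw [← hm]
      simp only [autDenom, SL2_mul_apply]
      push_cast
      linear_combination z ^ 2 * (γ 1 0 : ℂ) * d
    rw [hδ] at h
    rw [mul_smul, autDenom_mul, mul_comm (autDenom γ _), ← div_div, h,
      mul_comm (autDenom δ _) (autDenom γ _), e, expTwoPiI_add, mul_inv]
    ring
  | hinv γ hγ =>
    have n1 := autDenom_ne_zero γ (γ⁻¹ • τ)
    have n2 := autDenom_ne_zero γ⁻¹ τ
    have hm := autDenom_mul γ γ⁻¹ τ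
    have h := hγ (z / autDenom γ⁻¹ τ) (γ⁻¹ • τ)
    have e1 : autDenom (γ * γ⁻¹) τ = 1 := by rw [mul_inv_cancel]; simp [autDenom]
    rw [e1] at hm
    have e2 : autDenom γ ((γ⁻¹ • τ : ℍ) : ℂ) = (autDenom γ⁻¹ τ)⁻¹ :=
      eq_inv_of_mul_eq_one_left hm.symm
    have e3 : (γ⁻¹ 1 0 : ℂ) = -γ 1 0 := by
      simp [Matrix.SpecialLinearGroup.SL2_inv_expl]
    rw [smul_inv_smul, e2, inv_inv, div_inv_eq_mul, div_mul_cancel₀ _ n2] at h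
    rw [h, e3, ← mul_assoc, mul_right_comm (autDenom γ⁻¹ τ)⁻¹, ← mul_assoc,
      inv_mul_cancel₀ n2, one_mul, ← expTwoPiI_add]
    have e4 : (γ 1 0 : ℂ) * (z / autDenom γ⁻¹ τ) ^ 2 / (2 * (autDenom γ⁻¹ τ)⁻¹)
        + -γ 1 0 * z ^ 2 / (2 * autDenom γ⁻¹ τ) = 0 := by
      field_simp; ring
    rw [e4, expTwoPiI_zero, one_mul]

lemma kleinTheta_add_one (z : ℂ) {τ : ℂ} (hτ : 0 < τ.im) :
    kleinTheta (z + 1) τ = -kleinTheta z τ := by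
  have e : τ / 8 - (z + 1) / 2 = τ / 8 - z / 2 - 1 / 2 := by ring
  rw [kleinTheta, kleinTheta, oddTheta_eq_thetaProd _ hτ, oddTheta_eq_thetaProd _ hτ,
    expTwoPiI_add_one, e, expTwoPiI_sub _ (1 / 2), expTwoPiI_half]
  ring

lemma kleinTheta_add_self (z : ℂ) {τ : ℂ} (hτ : 0 < τ.im) :
    kleinTheta (z + τ) τ = -expTwoPiI (-(τ / 2) - z) * kleinTheta z τ := by
  have e : τ / 8 - (z + τ) / 2 = -(τ / 2) - z + (τ / 8 - z / 2) + z := by ring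
  have hz := expTwoPiI_ne_zero z
  rw [kleinTheta, kleinTheta, oddTheta_eq_thetaProd _ hτ, oddTheta_eq_thetaProd _ hτ,
    expTwoPiI_add z τ, thetaProd_mul hz (expTwoPiI_ne_zero τ) (norm_expTwoPiI_lt_one hτ), e,
    expTwoPiI_add _ z, expTwoPiI_add _ (τ / 8 - z / 2)]
  field_simp

lemma kleinTheta_add_int (z : ℂ) {τ : ℂ} (hτ : 0 < τ.im) (m : ℤ) :
    kleinTheta (z + m) τ = (-1) ^ m * kleinTheta z τ := by
  induction m using Int.induction_on with
  | zero => simp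
  | succ m ih =>
    rw [zpow_add_one₀ (by norm_num), mul_neg_one, neg_mul, ← ih, ← kleinTheta_add_one _ hτ]
    push_cast; ring_nf
  | pred m ih =>
    have h := kleinTheta_add_one (z + ((-m - 1 : ℤ) : ℂ)) hτ
    have e : z + ((-m - 1 : ℤ) : ℂ) + 1 = z + ((-m : ℤ) : ℂ) := by push_cast; ring
    rw [e, ih] at h
    rw [zpow_sub_one₀ (by norm_num), ← neg_eq_iff_eq_neg.2 h]
    norm_num

lemma kleinTheta_add_int_mul (z : ℂ) {τ : ℂ} (hτ : 0 < τ.im) (l : ℤ) :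
    kleinTheta (z + l * τ) τ
      = (-1) ^ l * expTwoPiI (-(l ^ 2 * τ / 2) - l * z) * kleinTheta z τ := by
  induction l using Int.induction_on with
  | zero => simp
  | succ l ih =>
    have e : z + ((l + 1 : ℤ) : ℂ) * τ = z + ((l : ℤ) : ℂ) * τ + τ := by push_cast; ring
    have e2 : -((((l + 1 : ℤ) : ℂ)) ^ 2 * τ / 2) - ((l + 1 : ℤ) : ℂ) * z
        = -(τ / 2) - (z + ((l : ℤ) : ℂ) * τ) + (-(((l : ℤ) : ℂ) ^ 2 * τ / 2) - ((l : ℤ) : ℂ) * z) := by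
      push_cast; ring
    rw [e, kleinTheta_add_self _ hτ, ih, zpow_add_one₀ (by norm_num), e2,
      expTwoPiI_add (-(τ / 2) - _)]
    ring
  | pred l ih =>
    have h := kleinTheta_add_self (z + ((-l - 1 : ℤ) : ℂ) * τ) hτ
    have e : z + ((-l - 1 : ℤ) : ℂ) * τ + τ = z + ((-l : ℤ) : ℂ) * τ := by push_cast; ring
    have e2 : -((((-l : ℤ) : ℂ)) ^ 2 * τ / 2) - ((-l : ℤ) : ℂ) * z
        = -(τ / 2) - (z + ((-l - 1 : ℤ) : ℂ) * τ)
          + (-(((-l - 1 : ℤ) : ℂ) ^ 2 * τ / 2) - ((-l - 1 : ℤ) : ℂ) * z) := by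
      push_cast; ring
    rw [e, ih, e2, expTwoPiI_add (-(τ / 2) - _)] at h
    have n := expTwoPiI_ne_zero (-(τ / 2) - (z + ((-l - 1 : ℤ) : ℂ) * τ))
    refine mul_left_cancel₀ (neg_ne_zero.2 n) ?_
    rw [← h, zpow_sub_one₀ (by norm_num)]
    norm_num
    ring

/-- The elliptic transformation law of `ϑ / η³`. -/
theorem kleinTheta_add_lattice (z : ℂ) {τ : ℂ} (hτ : 0 < τ.im) (l m : ℤ) :
    kleinTheta (z + l * τ + m) τ
      = (-1) ^ (l + m) * expTwoPiI (-(l ^ 2 * τ / 2) - l * z) * kleinTheta z τ := by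
  rw [kleinTheta_add_int _ hτ, kleinTheta_add_int_mul _ hτ, zpow_add₀ (by norm_num)]
  ring

/-- Off the lattice no factor of the convergent triple product vanishes; on it, the elliptic law
reduces to z = 0. -/
lemma kleinTheta_eq_zero_iff (z : ℂ) {τ : ℂ} (hτ : 0 < τ.im) :
    kleinTheta z τ = 0 ↔ ∃ l m : ℤ, z = l * τ + m := by
  have hq := norm_expTwoPiI_lt_one hτ
  constructor
  · intro h
    by_contra! hne
    have he := ModularForm.eta_ne_zero (z := τ) hτ
    refine absurd h (div_ne_zero ?_ (pow_ne_zero _ he))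
    rw [oddTheta_eq_thetaProd z hτ, thetaProd]
    refine mul_ne_zero (expTwoPiI_ne_zero _) (mul_ne_zero
      (qPochInf_ne_zero_of_norm_lt_one hq hq) (mul_ne_zero (qPochInf_ne_zero hq fun j hj => ?_)
        (qPochInf_ne_zero hq fun j hj => ?_)))
    · rw [← expTwoPiI_nat_mul, ← expTwoPiI_add, expTwoPiI_eq_one_iff] at hj
      obtain ⟨m, hm⟩ := hj
      refine hne (-j) m ?_
      push_cast
      linear_combination hm
    · rw [← expTwoPiI_nat_mul, ← expTwoPiI_sub, ← expTwoPiI_add, expTwoPiI_eq_one_iff] at hj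
      obtain ⟨m, hm⟩ := hj
      refine hne (j + 1) (-m) ?_
      push_cast
      linear_combination -hm
  · rintro ⟨l, m, rfl⟩
    have h := kleinTheta_add_lattice 0 hτ l m
    have h0 : kleinTheta 0 τ = 0 := by
      rw [kleinTheta, oddTheta_eq_thetaProd 0 hτ, expTwoPiI_zero, thetaProd_one hq]
      simp
    rw [zero_add, h0, mul_zero] at h
    exact h

lemma differentiableAt_oddTheta (z : ℂ) {τ : ℂ} (hτ : 0 < τ.im) :
    DifferentiableAt ℂ (fun x : ℂ × ℂ => oddTheta x.1 x.2) (z, τ) := by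
  have h := (hasFDerivAt_jacobiTheta₂ (z + 1 / 2 + τ / 2) hτ).differentiableAt
  have h2 : DifferentiableAt ℂ (fun x : ℂ × ℂ => (x.1 + 1 / 2 + x.2 / 2, x.2)) (z, τ) := by
    fun_prop
  have h3 := DifferentiableAt.comp (z, τ) h h2
  simp only [oddTheta_eq_jacobiTheta₂]
  refine DifferentiableAt.mul ?_ h3
  unfold expTwoPiI
  fun_prop

lemma differentiableAt_kleinTheta (z : ℂ) {τ : ℂ} (hτ : 0 < τ.im) :
    DifferentiableAt ℂ (fun x : ℂ × ℂ => kleinTheta x.1 x.2) (z, τ) := by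
  have he : DifferentiableAt ℂ (fun x : ℂ × ℂ => ModularForm.eta x.2) (z, τ) :=
    DifferentiableAt.comp (z, τ) (f := Prod.snd) (g := ModularForm.eta)
      (ModularForm.differentiableAt_eta_of_mem_upperHalfPlaneSet (z := τ) hτ)
      differentiableAt_snd
  simp only [kleinTheta, div_eq_mul_inv]
  exact (differentiableAt_oddTheta z hτ).mul ((he.fun_pow 3).fun_inv
    (pow_ne_zero _ (ModularForm.eta_ne_zero (z := τ) hτ)))

/-! ### Multiplier of the eta function -/

lemma autDenom_inv (γ : SL(2, ℤ)) (τ : ℍ) :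
    autDenom γ ((γ⁻¹ • τ : ℍ) : ℂ) = (autDenom γ⁻¹ τ)⁻¹ := by
  have hm := autDenom_mul γ γ⁻¹ τ
  have e1 : autDenom (γ * γ⁻¹) τ = 1 := by rw [mul_inv_cancel]; simp [autDenom]
  rw [e1] at hm
  exact eq_inv_of_mul_eq_one_left hm.symm

/-- The 24th power kills the root e^{2πi/24} from τ ↦ τ + 1 and, as (-i)¹² = 1, also the one from τ
↦ -1/τ. -/
lemma eta_smul_pow (γ : SL(2, ℤ)) (τ : ℍ) :
    ModularForm.eta ((γ • τ : ℍ) : ℂ) ^ 24 = autDenom γ τ ^ 12 * ModularForm.eta τ ^ 24 := by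
  induction γ using closure_S_T_induction generalizing τ with
  | hS =>
    have hc : ((-Complex.I * τ) ^ (1 / 2 : ℂ)) ^ 2 = -Complex.I * τ := by
      rw [← Complex.cpow_nat_mul]; norm_num
    have e : autDenom ModularGroup.S τ = τ := by simp [autDenom, ModularGroup.S]
    have h4 : (-Complex.I) ^ 12 = 1 := by
      rw [Even.neg_pow (by decide), show 12 = 4 * 3 by norm_num, pow_mul, Complex.I_pow_four,
        one_pow]
    rw [coe_S_smul, e, eta_neg_one_div τ.2, mul_pow, show 24 = 2 * 12 by norm_num,
      pow_mul ((-Complex.I * τ) ^ (1 / 2 : ℂ)), hc, mul_pow, h4, one_mul]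
  | hT =>
    have e : autDenom ModularGroup.T τ = 1 := by simp [autDenom, ModularGroup.T]
    rw [coe_T_smul, e, eta_eq_qPochInf, eta_eq_qPochInf, expTwoPiI_add_one, mul_pow, mul_pow,
      ← expTwoPiI_nat_mul, ← expTwoPiI_nat_mul]
    have e1 : ((24 : ℕ) : ℂ) * ((τ + 1) / 24) = (24 : ℕ) * (τ / 24) + 1 := by push_cast; ring
    rw [e1, expTwoPiI_add_one, one_pow, one_mul]
  | h1 => simp [autDenom]
  | hmul γ δ hγ hδ => rw [mul_smul, hγ, hδ, autDenom_mul, mul_pow, mul_assoc]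
  | hinv γ hγ =>
    have h := hγ (γ⁻¹ • τ)
    rw [smul_inv_smul, autDenom_inv] at h
    have n := autDenom_ne_zero γ⁻¹ τ
    rw [h, inv_pow, mul_inv_cancel_left₀ (pow_ne_zero _ n)]

lemma autDenom_mem_slitPlane {γ : SL(2, ℤ)} (h : γ 1 0 ≠ 0) (τ : ℍ) :
    autDenom γ τ ∈ Complex.slitPlane := by
  right
  simpa [autDenom] using ⟨h, τ.im_ne_zero⟩

/-- For c ≠ 0 the number cτ + d is never real, so it avoids the branch cut; for c = 0 it is
constant. -/
lemma continuous_autDenom_cpow (γ : SL(2, ℤ)) (s : ℂ) :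
    Continuous fun τ : ℍ => autDenom γ τ ^ s := by
  by_cases h : γ 1 0 = 0
  · simp only [autDenom, h]
    simpa using continuous_const
  · refine Continuous.cpow ?_ continuous_const (autDenom_mem_slitPlane h)
    unfold autDenom
    fun_prop

/-- The eta function transforms under `SL₂(ℤ)` in weight `1/2` with multipliers that are
24th roots of unity. -/
lemma exists_eta_smul (γ : SL(2, ℤ)) : ∃ ε : ℂ, ε ^ 24 = 1 ∧ ∀ τ : ℍ,
    ModularForm.eta ((γ • τ : ℍ) : ℂ) * autDenom γ τ ^ (-(1 / 2) : ℂ)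
      = ε * ModularForm.eta τ := by
  have h0 (τ : ℍ) : ModularForm.eta τ ≠ 0 := ModularForm.eta_ne_zero τ.2
  set ρ : ℍ → ℂ := fun τ => ModularForm.eta ((γ • τ : ℍ) : ℂ) *
    autDenom γ τ ^ (-(1 / 2) : ℂ) / ModularForm.eta τ with hρ
  have hη : Continuous fun τ : ℍ => ModularForm.eta τ :=
    continuous_iff_continuousAt.2 fun τ =>
      (ModularForm.differentiableAt_eta_of_mem_upperHalfPlaneSet τ.2).continuousAt.comp
        UpperHalfPlane.continuous_coe.continuousAt
  have hγ : Continuous fun τ : ℍ => ModularForm.eta ((γ • τ : ℍ) : ℂ) := by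
    have h1 : Continuous fun τ : ℍ => ((γ • τ : ℍ) : ℂ) := by
      simp only [coe_SL2_smul]
      refine Continuous.div (by fun_prop) ?_ (autDenom_ne_zero γ)
      unfold autDenom
      fun_prop
    exact continuous_iff_continuousAt.2 fun τ =>
      ContinuousAt.comp (f := fun τ : ℍ => ((γ • τ : ℍ) : ℂ)) (g := ModularForm.eta)
        (ModularForm.differentiableAt_eta_of_mem_upperHalfPlaneSet (γ • τ).2).continuousAt
        h1.continuousAt
  have hc : Continuous ρ :=
    (hγ.mul (continuous_autDenom_cpow γ _)).div hη h0
  have hpow (τ : ℍ) : ρ τ ^ 24 = 1 := by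
    have e : (autDenom γ τ ^ (-(1 / 2) : ℂ)) ^ 24 = (autDenom γ τ ^ 12)⁻¹ := by
      rw [← Complex.cpow_nat_mul, ← Complex.cpow_natCast, ← Complex.cpow_neg]
      norm_num
    have n := autDenom_ne_zero γ τ
    have := h0 τ
    rw [hρ]
    simp only [div_pow, mul_pow]
    rw [e, eta_smul_pow]
    field_simp
  have hfin : {x : ℂ | x ^ 24 = 1}.Finite := by
    have := (Polynomial.nthRoots 24 (1 : ℂ)).toFinset.finite_toSet
    refine this.subset fun x hx => ?_
    simpa [Polynomial.mem_nthRoots] using hx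
  refine ⟨ρ UpperHalfPlane.I, hpow _, fun τ => ?_⟩
  -- The ratio ρ is continuous on the connected half plane with values in the finite set of 24th
  -- roots of unity, hence constant. No cocycle of square roots is needed.
  have := isPreconnected_univ.constant_of_mapsTo hfin.isDiscrete hc.continuousOn
    (fun τ _ => hpow τ) (Set.mem_univ τ) (Set.mem_univ UpperHalfPlane.I)
  rw [← this, hρ]
  exact (div_mul_cancel₀ _ (h0 τ)).symm

/-! ### Klein forms -/

/-- The Klein form with characteristic `(R, S)`, as a function on the upper half plane. -/
def kleinForm (R S τ : ℂ) : ℂ :=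
  expTwoPiI (R * (R * τ + S) / 2) * kleinTheta (R * τ + S) τ

/-- The exponential prefactor in `kleinForm` absorbs the index factor of `kleinTheta`, so γ only
moves the characteristic, as the row vector (R, S)γ. -/
lemma kleinForm_smul (R S : ℂ) (γ : SL(2, ℤ)) (τ : ℍ) :
    kleinForm R S ((γ • τ : ℍ) : ℂ)
      = (autDenom γ τ)⁻¹ * kleinForm (R * γ 0 0 + S * γ 1 0) (R * γ 0 1 + S * γ 1 1) τ := by
  have n := autDenom_ne_zero γ τ
  have d := SL2_det γ
  have e : R * ((γ • τ : ℍ) : ℂ) + S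
      = ((R * γ 0 0 + S * γ 1 0) * τ + (R * γ 0 1 + S * γ 1 1)) / autDenom γ τ := by
    rw [coe_SL2_smul]
    field_simp
    rw [autDenom]
    ring
  have e2 : R * (((R * γ 0 0 + S * γ 1 0) * τ + (R * γ 0 1 + S * γ 1 1)) / autDenom γ τ) / 2
      + (γ 1 0 : ℂ) * ((R * γ 0 0 + S * γ 1 0) * τ + (R * γ 0 1 + S * γ 1 1)) ^ 2
        / (2 * autDenom γ τ)
      = (R * γ 0 0 + S * γ 1 0) *
        ((R * γ 0 0 + S * γ 1 0) * τ + (R * γ 0 1 + S * γ 1 1)) / 2 := by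
    field_simp
    rw [autDenom]
    linear_combination (-R * ((R * γ 0 0 + S * γ 1 0) * τ + (R * γ 0 1 + S * γ 1 1))) * d
  rw [kleinForm, kleinForm, e, kleinTheta_smul, ← e2, expTwoPiI_add]
  ring

lemma kleinForm_add (R S : ℂ) {τ : ℂ} (hτ : 0 < τ.im) (l m : ℤ) :
    kleinForm (R + l) (S + m) τ
      = (-1) ^ (l + m) * expTwoPiI ((R * m - S * l + l * m) / 2) * kleinForm R S τ := by
  have e : (R + l) * τ + (S + m) = R * τ + S + l * τ + m := by ring
  have e2 : (R + l) * (R * τ + S + l * τ + m) / 2 = (R * m - S * l + l * m) / 2 +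
    R * (R * τ + S) / 2 + -(-(l ^ 2 * τ / 2) - l * (R * τ + S)) := by ring
  rw [kleinForm, kleinForm, e, kleinTheta_add_lattice _ hτ, e2, expTwoPiI_add, expTwoPiI_add,
    expTwoPiI_neg]
  have := mul_inv_cancel₀ (expTwoPiI_ne_zero (-(l ^ 2 * τ / 2) - l * (R * τ + S)))
  linear_combination (expTwoPiI ((R * m - S * l + l * m) / 2) *
    expTwoPiI (R * (R * τ + S) / 2) * (-1) ^ (l + m) * kleinTheta (R * τ + S) τ) * this

lemma Gamma_mem_iff_dvd {N : ℕ} {γ : SL(2, ℤ)} : γ ∈ CongruenceSubgroup.Gamma N ↔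
    (N : ℤ) ∣ γ 0 0 - 1 ∧ (N : ℤ) ∣ γ 0 1 ∧ (N : ℤ) ∣ γ 1 0 ∧ (N : ℤ) ∣ γ 1 1 - 1 := by
  rw [CongruenceSubgroup.Gamma_mem]
  simp only [← ZMod.intCast_zmod_eq_zero_iff_dvd, Int.cast_sub, Int.cast_one, sub_eq_zero]

lemma Gamma_mono {M N : ℕ} (h : M ∣ N) {γ : SL(2, ℤ)} (hγ : γ ∈ CongruenceSubgroup.Gamma N) :
    γ ∈ CongruenceSubgroup.Gamma M := by
  rw [Gamma_mem_iff_dvd] at hγ ⊢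
  have h' : (M : ℤ) ∣ N := Int.natCast_dvd_natCast.2 h
  exact ⟨h'.trans hγ.1, h'.trans hγ.2.1, h'.trans hγ.2.2.1, h'.trans hγ.2.2.2⟩

/-- A Klein form with `n`-torsion characteristic is modular of weight `-1` on `Γ(2n²)`. -/
lemma kleinForm_smul_of_mem_Gamma {R S : ℂ} {n : ℕ} {r s : ℤ} (hR : n * R = r) (hS : n * S = s)
    {γ : SL(2, ℤ)} (hγ : γ ∈ CongruenceSubgroup.Gamma (2 * n ^ 2)) (τ : ℍ) :
    kleinForm R S ((γ • τ : ℍ) : ℂ) = (autDenom γ τ)⁻¹ * kleinForm R S τ := by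
  obtain ⟨⟨a, ha⟩, ⟨b, hb⟩, ⟨c, hc⟩, ⟨d, hd⟩⟩ := Gamma_mem_iff_dvd.1 hγ
  have ha' : (γ 0 0 : ℂ) = 1 + 2 * n ^ 2 * a := by
    have : γ 0 0 = 1 + 2 * n ^ 2 * a := by push_cast at ha; linarith
    rw [this]; push_cast; ring
  have hb' : (γ 0 1 : ℂ) = 2 * n ^ 2 * b := by rw [hb]; push_cast; ring
  have hc' : (γ 1 0 : ℂ) = 2 * n ^ 2 * c := by rw [hc]; push_cast; ring
  have hd' : (γ 1 1 : ℂ) = 1 + 2 * n ^ 2 * d := by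
    have : γ 1 1 = 1 + 2 * n ^ 2 * d := by push_cast at hd; linarith
    rw [this]; push_cast; ring
  set l' : ℤ := r * a + s * c with hl'
  set m' : ℤ := r * b + s * d with hm'
  -- Level 2n² shifts the characteristic by multiples of 2n: one n clears the denominators of R and
  -- S, and the other n with the 2 makes the sign and the root of unity in `kleinForm_add` trivial.
  have e1 : R * γ 0 0 + S * γ 1 0 = R + ((2 * n * l' : ℤ) : ℂ) := by
    rw [ha', hc', hl']; push_cast; rw [← hR, ← hS]; ring
  have e2 : R * γ 0 1 + S * γ 1 1 = S + ((2 * n * m' : ℤ) : ℂ) := by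
    rw [hb', hd', hm']; push_cast; rw [← hR, ← hS]; ring
  have e3 : (R * ((2 * n * m' : ℤ) : ℂ) - S * ((2 * n * l' : ℤ) : ℂ)
      + ((2 * n * l' : ℤ) : ℂ) * ((2 * n * m' : ℤ) : ℂ)) / 2
      = ((r * m' - s * l' + 2 * n ^ 2 * l' * m' : ℤ) : ℂ) := by
    push_cast; rw [← hR, ← hS]; ring
  have e4 : (-1 : ℂ) ^ (2 * n * l' + 2 * n * m' : ℤ) = 1 :=
    Even.neg_one_zpow ⟨n * l' + n * m', by ring⟩
  rw [kleinForm_smul, e1, e2, kleinForm_add _ _ τ.2, e3, e4, expTwoPiI_int]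
  ring

/-! ### Functions with trivial multiplier on a principal congruence subgroup -/

/-- `g` transforms with weight `k` and trivial multiplier under some `Γ(N)`. -/
def IsCongruenceInvariant (k : ℤ) (g : ℂ → ℂ) : Prop :=
  ∃ N : ℕ, 0 < N ∧ ∀ γ ∈ CongruenceSubgroup.Gamma N, ∀ τ : ℍ,
    g ((γ • τ : ℍ) : ℂ) = autDenom γ τ ^ k * g τ

namespace IsCongruenceInvariant

variable {k l : ℤ} {g h : ℂ → ℂ}

lemma congr (hg : IsCongruenceInvariant k g) (e : ∀ τ : ℍ, h τ = g τ) :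
    IsCongruenceInvariant k h := by
  obtain ⟨N, hN, H⟩ := hg
  exact ⟨N, hN, fun γ hγ τ => by rw [e, e, H γ hγ]⟩

lemma mul (hg : IsCongruenceInvariant k g) (hh : IsCongruenceInvariant l h) :
    IsCongruenceInvariant (k + l) fun τ => g τ * h τ := by
  obtain ⟨M, hM, HM⟩ := hg
  obtain ⟨N, hN, HN⟩ := hh
  refine ⟨M * N, Nat.mul_pos hM hN, fun γ hγ τ => ?_⟩
  simp only
  rw [HM γ (Gamma_mono (dvd_mul_right M N) hγ), HN γ (Gamma_mono (dvd_mul_left N M) hγ),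
    zpow_add₀ (autDenom_ne_zero γ τ)]
  ring

lemma pow (hg : IsCongruenceInvariant k g) (n : ℕ) :
    IsCongruenceInvariant (k * n) fun τ => g τ ^ n := by
  obtain ⟨N, hN, H⟩ := hg
  refine ⟨N, hN, fun γ hγ τ => ?_⟩
  simp only
  rw [H γ hγ, mul_pow, zpow_mul, zpow_natCast]

lemma const_mul (hg : IsCongruenceInvariant k g) (c : ℂ) :
    IsCongruenceInvariant k fun τ => c * g τ := by
  obtain ⟨N, hN, H⟩ := hg
  exact ⟨N, hN, fun γ hγ τ => by simp only [H γ hγ]; ring⟩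

end IsCongruenceInvariant

/-! ### Rescaling the variable -/

/-- The matrix `δ` is the conjugate of `γ` by the diagonal matrix with entries `k, 1`. -/
def IsDiagConj (k : ℤ) (γ δ : SL(2, ℤ)) : Prop :=
  δ 0 0 = γ 0 0 ∧ δ 0 1 = k * γ 0 1 ∧ γ 1 0 = k * δ 1 0 ∧ δ 1 1 = γ 1 1

lemma IsDiagConj.autDenom {k : ℤ} {γ δ : SL(2, ℤ)} (h : IsDiagConj k γ δ) {z : ℂ} :
    autDenom δ (k * z) = autDenom γ z := by
  rw [_root_.autDenom, _root_.autDenom, h.2.2.1, h.2.2.2]; push_cast; ring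

lemma IsDiagConj.coe_smul {k : ℤ} {γ δ : SL(2, ℤ)} (h : IsDiagConj k γ δ) {τ τ' : ℍ}
    (hτ : (τ' : ℂ) = k * τ) : ((δ • τ' : ℍ) : ℂ) = k * ((γ • τ : ℍ) : ℂ) := by
  rw [coe_SL2_smul, coe_SL2_smul, hτ, h.autDenom, h.1, h.2.1]; push_cast; ring

lemma exists_isDiagConj_of_dvd {k : ℤ} {γ : SL(2, ℤ)} (hk : k ∣ γ 1 0) :
    ∃ δ, IsDiagConj k γ δ := by
  obtain ⟨c, hc⟩ := hk
  have d := γ.det_coe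
  rw [Matrix.det_fin_two] at d
  refine ⟨⟨!![γ 0 0, k * γ 0 1; c, γ 1 1], ?_⟩, ?_⟩
  · rw [Matrix.det_fin_two_of]
    rw [hc] at d
    linarith
  · simp [IsDiagConj, hc]

lemma exists_isDiagConj_of_dvd' {k : ℤ} {δ : SL(2, ℤ)} (hk : k ∣ δ 0 1) :
    ∃ γ, IsDiagConj k γ δ := by
  obtain ⟨b, hb⟩ := hk
  have d := δ.det_coe
  rw [Matrix.det_fin_two] at d
  refine ⟨⟨!![δ 0 0, b; k * δ 1 0, δ 1 1], ?_⟩, ?_⟩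
  · rw [Matrix.det_fin_two_of]
    rw [hb] at d
    linarith
  · simp [IsDiagConj, hb]

lemma IsDiagConj.mem_Gamma {k : ℕ} {γ δ : SL(2, ℤ)} (h : IsDiagConj k γ δ) (hk : 0 < k) {N : ℕ}
    (hγ : γ ∈ CongruenceSubgroup.Gamma (k * N)) : δ ∈ CongruenceSubgroup.Gamma N := by
  rw [Gamma_mem_iff_dvd] at hγ ⊢
  have hN : (N : ℤ) ∣ (k * N : ℕ) := by push_cast; exact dvd_mul_left _ _
  refine ⟨h.1 ▸ hN.trans hγ.1, h.2.1 ▸ (hN.trans hγ.2.1).mul_left _, ?_,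
    h.2.2.2 ▸ hN.trans hγ.2.2.2⟩
  have := hγ.2.2.1
  rw [h.2.2.1] at this
  push_cast at this
  exact (mul_dvd_mul_iff_left (by exact_mod_cast hk.ne')).1 this

lemma IsDiagConj.mem_Gamma' {k : ℕ} {γ δ : SL(2, ℤ)} (h : IsDiagConj k γ δ) (hk : 0 < k) {N : ℕ}
    (hδ : δ ∈ CongruenceSubgroup.Gamma (k * N)) : γ ∈ CongruenceSubgroup.Gamma N := by
  rw [Gamma_mem_iff_dvd] at hδ ⊢
  have hN : (N : ℤ) ∣ (k * N : ℕ) := by push_cast; exact dvd_mul_left _ _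
  refine ⟨h.1 ▸ hN.trans hδ.1, ?_, h.2.2.1 ▸ (hN.trans hδ.2.2.1).mul_left _,
    h.2.2.2 ▸ hN.trans hδ.2.2.2⟩
  have := hδ.2.1
  rw [h.2.1] at this
  push_cast at this
  exact (mul_dvd_mul_iff_left (by exact_mod_cast hk.ne')).1 this

lemma exists_coe_eq_mul (τ : ℍ) {k : ℝ} (hk : 0 < k) : ∃ τ' : ℍ, (τ' : ℂ) = k * τ :=
  ⟨⟨k * τ, by simpa using mul_pos hk τ.2⟩, rfl⟩

/-- For γ in Γ(nN) the conjugate δ by diag(n, 1) lies in Γ(N), acts on nτ as γ acts on τ, and has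
the same denominator. -/
lemma IsCongruenceInvariant.comp_mul {k : ℤ} {g : ℂ → ℂ} (hg : IsCongruenceInvariant k g) {n : ℕ}
    (hn : 0 < n) : IsCongruenceInvariant k fun τ => g (n * τ) := by
  obtain ⟨N, hN, H⟩ := hg
  refine ⟨n * N, Nat.mul_pos hn hN, fun γ hγ τ => ?_⟩
  have hd : (n : ℤ) ∣ γ 1 0 :=
    (Gamma_mem_iff_dvd.1 (Gamma_mono (dvd_mul_right n N) hγ)).2.2.1
  obtain ⟨δ, hδ⟩ := exists_isDiagConj_of_dvd hd
  obtain ⟨τ', hτ'⟩ := exists_coe_eq_mul τ (k := n) (by exact_mod_cast hn)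
  have hτ'' : (τ' : ℂ) = (n : ℤ) * τ := by rw [hτ']; push_cast; rfl
  have h := H δ (hδ.mem_Gamma hn hγ) τ'
  rw [hδ.coe_smul hτ'', hτ'', hδ.autDenom] at h
  simpa using h

lemma IsCongruenceInvariant.comp_div {k : ℤ} {g : ℂ → ℂ} (hg : IsCongruenceInvariant k g) {n : ℕ}
    (hn : 0 < n) : IsCongruenceInvariant k fun τ => g (τ / n) := by
  have hn0 : (n : ℂ) ≠ 0 := by exact_mod_cast hn.ne'
  obtain ⟨N, hN, H⟩ := hg
  refine ⟨n * N, Nat.mul_pos hn hN, fun δ hδ τ => ?_⟩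
  have hd : (n : ℤ) ∣ δ 0 1 :=
    (Gamma_mem_iff_dvd.1 (Gamma_mono (dvd_mul_right n N) hδ)).2.1
  obtain ⟨γ, hγ⟩ := exists_isDiagConj_of_dvd' hd
  obtain ⟨τ', hτ'⟩ := exists_coe_eq_mul τ (k := (n : ℝ)⁻¹) (by positivity)
  have hτ'' : (τ : ℂ) = (n : ℤ) * τ' := by rw [hτ']; push_cast; field_simp
  have h := H γ (hγ.mem_Gamma' hn hδ) τ'
  have e : ((δ • τ : ℍ) : ℂ) / n = ((γ • τ' : ℍ) : ℂ) := by
    rw [hγ.coe_smul hτ'']; push_cast; field_simp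
  have e2 : (τ : ℂ) / n = τ' := by rw [hτ'']; push_cast; field_simp
  simp only
  rw [e, h, e2, ← hγ.autDenom, ← hτ'']

lemma isCongruenceInvariant_kleinForm {R S : ℂ} {n : ℕ} (hn : 0 < n) {r s : ℤ} (hR : n * R = r)
    (hS : n * S = s) : IsCongruenceInvariant (-1) (kleinForm R S) :=
  ⟨2 * n ^ 2, by positivity, fun γ hγ τ => by
    rw [kleinForm_smul_of_mem_Gamma hR hS hγ, zpow_neg_one]⟩

/-! ### Torsion values of theta as eta quotients -/

lemma zeta3_sq_add : zeta3 ^ 2 + zeta3 + 1 = 0 := by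
  have h : zeta3 ^ 3 = 1 := by
    have e : ((3 : ℕ) : ℂ) * (1 / 3) = ((1 : ℤ) : ℂ) := by norm_num
    rw [zeta3, ← expTwoPiI_nat_mul, e, expTwoPiI_int]
  have h1 : zeta3 ≠ 1 := fun h => by
    obtain ⟨n, hn⟩ := expTwoPiI_eq_one_iff.1 h
    have : (3 : ℂ) * n = 1 := by rw [← hn]; norm_num
    have : 3 * n = 1 := by exact_mod_cast this
    omega
  exact mul_left_cancel₀ (sub_ne_zero.2 h1) (by linear_combination h)

lemma expTwoPiI_quarter : expTwoPiI (1 / 4) = Complex.I := by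
  rw [expTwoPiI]
  refine Eq.trans ?_ Complex.exp_pi_div_two_mul_I
  ring_nf

/-- At x = ζ₃ the factors of the triple product are two of the three in `qPochInf_mul_cube`, and
η(τ) supplies the third. The values at 1/2 and 1/4 collapse similarly through (a; q)_∞ (-a; q)_∞. -/
lemma exists_kleinTheta_third : ∃ c : ℂ, c ≠ 0 ∧ ∀ τ : ℍ,
    kleinTheta (1 / 3) τ = c * (ModularForm.eta (3 * τ) / ModularForm.eta τ ^ 3) := by
  have hz := zeta3_sq_add
  have h3 : zeta3 ^ 3 = 1 := by linear_combination (zeta3 - 1) * hz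
  have hz0 : zeta3 ≠ 0 := expTwoPiI_ne_zero _
  have hz1 : 1 - zeta3 ≠ 0 := fun h => by
    have : zeta3 = 1 := (sub_eq_zero.1 h).symm
    rw [this] at hz; norm_num at hz
  refine ⟨expTwoPiI (-(1 / 6)) * (1 - zeta3), mul_ne_zero (expTwoPiI_ne_zero _) hz1, fun τ => ?_⟩
  have hq := norm_expTwoPiI_lt_one τ.2
  have e1 : (τ : ℂ) / 8 - 1 / 3 / 2 = -(1 / 6) + 3 * τ / 24 := by ring
  have e2 : expTwoPiI (3 * τ) = expTwoPiI τ ^ 3 := by rw [← expTwoPiI_nat_mul]; norm_num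
  have e3 (q : ℂ) : q / zeta3 = zeta3 ^ 2 * q := by field_simp; rw [h3]; ring
  rw [kleinTheta, oddTheta_eq_thetaProd _ τ.2, eta_eq_qPochInf (3 * τ), e1, e2, expTwoPiI_add,
    ← qPochInf_mul_cube hz _ hq, ← zeta3, thetaProd, qPochInf_eq_one_sub_mul zeta3 hq, e3]
  ring

lemma exists_kleinTheta_half : ∃ c : ℂ, c ≠ 0 ∧ ∀ τ : ℍ,
    kleinTheta (1 / 2) τ = c * (ModularForm.eta (2 * τ) ^ 2 / ModularForm.eta τ ^ 4) := by
  refine ⟨expTwoPiI (-(1 / 4)) * 2, mul_ne_zero (expTwoPiI_ne_zero _) two_ne_zero, fun τ => ?_⟩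
  have hq := norm_expTwoPiI_lt_one τ.2
  have hη := ModularForm.eta_ne_zero (z := τ) τ.2
  have e1 : (τ : ℂ) / 8 - 1 / 2 / 2 + τ / 24 = -(1 / 4) + (2 : ℕ) * (2 * τ / 24) := by
    push_cast; ring
  have e2 : expTwoPiI (2 * τ) = expTwoPiI τ ^ 2 := by rw [← expTwoPiI_nat_mul]; norm_num
  have e4 : oddTheta (1 / 2) τ * ModularForm.eta τ
      = expTwoPiI (-(1 / 4)) * 2 * ModularForm.eta (2 * τ) ^ 2 := by
    rw [oddTheta_eq_thetaProd _ τ.2, eta_eq_qPochInf, eta_eq_qPochInf (2 * τ), e2, mul_pow,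
      ← expTwoPiI_nat_mul, ← qPochInf_mul_neg _ hq, expTwoPiI_half, thetaProd,
      qPochInf_eq_one_sub_mul (-1) hq, div_neg, div_one, neg_one_mul]
    have e3 := expTwoPiI_add ((τ : ℂ) / 8 - 1 / 2 / 2) (τ / 24)
    rw [e1, expTwoPiI_add] at e3
    generalize qPochInf (expTwoPiI τ) (expTwoPiI τ) = A
    generalize qPochInf (-expTwoPiI τ) (expTwoPiI τ) = B
    linear_combination (-(A ^ 2 * B ^ 2 * 2)) * e3
  rw [kleinTheta, eq_div_of_mul_eq hη e4]
  field_simp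

lemma exists_kleinTheta_quarter : ∃ c : ℂ, c ≠ 0 ∧ ∀ τ : ℍ,
    kleinTheta (1 / 4) τ = c *
      (ModularForm.eta (4 * τ) / (ModularForm.eta (2 * τ) * ModularForm.eta τ ^ 2)) := by
  have hI : 1 - Complex.I ≠ 0 := fun h => by simpa using congrArg Complex.re h
  refine ⟨expTwoPiI (-(1 / 8)) * (1 - Complex.I), mul_ne_zero (expTwoPiI_ne_zero _) hI,
    fun τ => ?_⟩
  have hq := norm_expTwoPiI_lt_one τ.2
  have hη := ModularForm.eta_ne_zero (z := τ) τ.2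
  have hη2 : ModularForm.eta (2 * τ) ≠ 0 := by
    obtain ⟨τ', hτ'⟩ := exists_coe_eq_mul τ two_pos
    have := ModularForm.eta_ne_zero (z := τ') τ'.2
    rwa [hτ', Complex.ofReal_ofNat] at this
  have e1 : (τ : ℂ) / 8 - 1 / 4 / 2 + 2 * τ / 24 = -(1 / 8) + (4 * τ / 24) + τ / 24 := by ring
  have e2 : expTwoPiI (2 * τ) = expTwoPiI τ ^ 2 := by rw [← expTwoPiI_nat_mul]; norm_num
  have e5 : expTwoPiI (4 * τ) = (expTwoPiI τ ^ 2) ^ 2 := by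
    rw [← pow_mul, ← expTwoPiI_nat_mul]; norm_num
  have e6 := qPochInf_mul_neg (Complex.I * expTwoPiI τ) hq
  rw [mul_pow, Complex.I_sq, neg_one_mul] at e6
  have e4 : oddTheta (1 / 4) τ * ModularForm.eta (2 * τ)
      = expTwoPiI (-(1 / 8)) * (1 - Complex.I) * ModularForm.eta (4 * τ) * ModularForm.eta τ := by
    rw [oddTheta_eq_thetaProd _ τ.2, eta_eq_qPochInf (2 * τ), eta_eq_qPochInf (4 * τ),
      eta_eq_qPochInf τ, e2, e5, ← qPochInf_mul_neg _ (norm_pow_lt_one hq two_ne_zero),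
      expTwoPiI_quarter, thetaProd, qPochInf_eq_one_sub_mul Complex.I hq, Complex.div_I, ← e6,
      mul_comm (expTwoPiI τ) Complex.I]
    have e3 := expTwoPiI_add ((τ : ℂ) / 8 - 1 / 4 / 2) (2 * τ / 24)
    rw [e1, expTwoPiI_add, expTwoPiI_add] at e3
    generalize qPochInf (expTwoPiI τ) (expTwoPiI τ) = A
    generalize qPochInf (Complex.I * expTwoPiI τ) (expTwoPiI τ) = B
    generalize qPochInf (-(Complex.I * expTwoPiI τ)) (expTwoPiI τ) = C
    generalize qPochInf (expTwoPiI τ ^ 2) (expTwoPiI τ ^ 2) = D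
    linear_combination (-(A * B * C * D * (1 - Complex.I))) * e3
  rw [kleinTheta, eq_div_of_mul_eq hη2 e4]
  field_simp

/-- The characteristic (-1/2, -1/2) is the half period at which the argument of `jacobiTheta₂`
becomes 0. Since it is not a lattice point, θ has no zeros. -/
lemma jacobiTheta_eq_kleinForm {τ : ℂ} (hτ : 0 < τ.im) :
    jacobiTheta τ = -expTwoPiI (1 / 8) *
      (kleinForm (-(1 / 2)) (-(1 / 2)) τ * ModularForm.eta τ ^ 3) := by
  have hη := ModularForm.eta_ne_zero (z := τ) hτ
  have e1 : -(1 / 2) * τ + -(1 / 2) + 1 / 2 + τ / 2 = 0 := by ring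
  have e2 : 1 / 8 + -(1 / 2) * (-(1 / 2) * τ + -(1 / 2)) / 2
      + ((-(1 / 2) * τ + -(1 / 2)) / 2 + τ / 8) = 0 := by ring
  have e3 := expTwoPiI_zero
  rw [← e2, expTwoPiI_add, expTwoPiI_add] at e3
  rw [jacobiTheta_eq_jacobiTheta₂, kleinForm, kleinTheta, mul_assoc _ (_ / _),
    div_mul_cancel₀ _ (pow_ne_zero 3 hη), oddTheta_eq_jacobiTheta₂, e1]
  linear_combination (-jacobiTheta₂ 0 τ) * e3

lemma jacobiTheta_ne_zero {τ : ℂ} (hτ : 0 < τ.im) : jacobiTheta τ ≠ 0 := by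
  have hη := ModularForm.eta_ne_zero (z := τ) hτ
  rw [jacobiTheta_eq_kleinForm hτ, kleinForm]
  refine mul_ne_zero (neg_ne_zero.2 (expTwoPiI_ne_zero _)) (mul_ne_zero (mul_ne_zero
    (expTwoPiI_ne_zero _) ?_) (pow_ne_zero 3 hη))
  rw [Ne, kleinTheta_eq_zero_iff _ hτ]
  rintro ⟨l, m, h⟩
  have h' := congrArg Complex.im h
  simp only [Complex.add_im, Complex.mul_im, Complex.neg_im, Complex.neg_re] at h'
  norm_num at h'
  have h2 : (2 * l + 1 : ℝ) * τ.im = 0 := by linarith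
  have h3 : (2 * l + 1 : ℝ) = 0 := (mul_eq_zero.1 h2).resolve_right hτ.ne'
  have h4 : 2 * l + 1 = 0 := by exact_mod_cast h3
  omega

/-- The product of `η(τ)` and `θ(τ) = ∑ q^{n²}` is modular of weight one with trivial multiplier on
a principal congruence subgroup. -/
theorem isCongruenceInvariant_eta_mul_jacobiTheta :
    IsCongruenceInvariant 1 fun τ => ModularForm.eta τ * jacobiTheta (2 * τ) := by
  have hη (τ : ℍ) {k : ℝ} (hk : 0 < k) : ModularForm.eta (k * τ) ≠ 0 := by
    obtain ⟨τ', hτ'⟩ := exists_coe_eq_mul τ hk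
    rw [← hτ']
    exact ModularForm.eta_ne_zero τ'.2
  have h1 (τ : ℍ) := ModularForm.eta_ne_zero τ.2
  have h2 (τ : ℍ) : ModularForm.eta (2 * τ) ≠ 0 := by simpa using hη τ (k := 2) two_pos
  have hhalf (τ : ℍ) : ModularForm.eta (τ / 2) ≠ 0 := by
    simpa [div_eq_inv_mul] using hη τ (k := 2⁻¹) (by norm_num)
  have hthird (τ : ℍ) : ModularForm.eta (τ / 3) ≠ 0 := by
    simpa [div_eq_inv_mul] using hη τ (k := 3⁻¹) (by norm_num)
  have key {n : ℕ} (hn : 0 < n) {c : ℂ} (hc : c ≠ 0) {g : ℂ → ℂ}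
      (h : ∀ τ : ℍ, kleinTheta (1 / n) τ = c * g τ) : IsCongruenceInvariant (-1) g := by
    have hn0 : (n : ℂ) ≠ 0 := by exact_mod_cast hn.ne'
    have := (isCongruenceInvariant_kleinForm (R := 0) (S := 1 / n) hn (r := 0) (s := 1)
      (by simp) (by simp [hn0])).const_mul c⁻¹
    refine this.congr fun τ => ?_
    simp only [kleinForm]
    rw [zero_mul, zero_mul, zero_div, expTwoPiI_zero, one_mul, zero_add, h, inv_mul_cancel_left₀ hc]
  have hA : IsCongruenceInvariant (-1) fun τ =>
      ModularForm.eta (3 * τ) / ModularForm.eta τ ^ 3 := by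
    obtain ⟨c, hc, h⟩ := exists_kleinTheta_third
    exact key (n := 3) (by norm_num) hc (by exact_mod_cast h)
  have hB : IsCongruenceInvariant (-1) fun τ =>
      ModularForm.eta (2 * τ) ^ 2 / ModularForm.eta τ ^ 4 := by
    obtain ⟨c, hc, h⟩ := exists_kleinTheta_half
    exact key (n := 2) (by norm_num) hc (by exact_mod_cast h)
  have hC : IsCongruenceInvariant (-1) fun τ =>
      ModularForm.eta (4 * τ) / (ModularForm.eta (2 * τ) * ModularForm.eta τ ^ 2) := by
    obtain ⟨c, hc, h⟩ := exists_kleinTheta_quarter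
    exact key (n := 4) (by norm_num) hc (by exact_mod_cast h)
  have h24 : IsCongruenceInvariant 12 fun τ => ModularForm.eta τ ^ 24 :=
    ⟨1, one_pos, fun γ _ τ => by
      simp only [eta_smul_pow]; norm_cast⟩
  -- Descent: η(τ)⁸ = (η(τ)/η(τ/3)³)⁸ η(τ/3)²⁴. The same device with η(τ)²/η(τ/2)⁴ then yields η⁴
  -- and η², and the value at 1/4 yields η(2τ)/η(τ).
  have h8 : IsCongruenceInvariant 4 fun τ => ModularForm.eta τ ^ 8 := by
    refine (((hA.comp_div (n := 3) (by norm_num)).pow 8).mul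
      (h24.comp_div (n := 3) (by norm_num))).congr fun τ => ?_
    have := hthird τ
    have e : 3 * ((τ : ℂ) / 3) = τ := by field_simp
    push_cast
    rw [e]
    field_simp
  have h4 : IsCongruenceInvariant 2 fun τ => ModularForm.eta τ ^ 4 := by
    refine (((hB.comp_div (n := 2) (by norm_num)).pow 2).mul
      (h8.comp_div (n := 2) (by norm_num))).congr fun τ => ?_
    have := hhalf τ
    have e : 2 * ((τ : ℂ) / 2) = τ := by field_simp
    push_cast
    rw [e]
    field_simp
  have hsq : IsCongruenceInvariant 1 fun τ => ModularForm.eta τ ^ 2 := by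
    refine ((hB.comp_div (n := 2) (by norm_num)).mul
      (h4.comp_div (n := 2) (by norm_num))).congr fun τ => ?_
    have := hhalf τ
    have e : 2 * ((τ : ℂ) / 2) = τ := by field_simp
    push_cast
    rw [e]
    field_simp
  have hquot : IsCongruenceInvariant 0 fun τ => ModularForm.eta (2 * τ) / ModularForm.eta τ := by
    refine ((hC.comp_div (n := 2) (by norm_num)).mul
      (hsq.comp_div (n := 2) (by norm_num))).congr fun τ => ?_
    have := hhalf τ
    have := h1 τ
    have e : 2 * ((τ : ℂ) / 2) = τ := by field_simp
    have e' : 4 * ((τ : ℂ) / 2) = 2 * τ := by ring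
    push_cast
    rw [e, e']
    field_simp
  have hK : IsCongruenceInvariant (-1) fun τ => kleinForm (-(1 / 2)) (-(1 / 2)) (2 * τ) := by
    have := (isCongruenceInvariant_kleinForm (R := -(1 / 2)) (S := -(1 / 2)) (n := 2) (r := -1)
      (s := -1) two_pos (by norm_num) (by norm_num)).comp_mul (n := 2) two_pos
    exact_mod_cast this
  -- Up to a constant, ηθ is the Klein form at 2τ times (η(2τ)/η(τ))³ η(τ)⁴, of weight -1 + 0 + 2.
  refine (((hK.mul (hquot.pow 3)).mul h4).const_mul (-expTwoPiI (1 / 8))).congr fun τ => ?_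
  have := h1 τ
  have h2im : 0 < (2 * (τ : ℂ)).im := by simpa using τ.2
  rw [jacobiTheta_eq_kleinForm h2im]
  field_simp

/-! ### Osgood's lemma -/

/-- The square `[0, 2π] × [0, 2π]`. -/
abbrev AngleSquare : Type := Set.Icc (0 : ℝ) (2 * Real.pi) × Set.Icc (0 : ℝ) (2 * Real.pi)

open Complex Set in
/-- Integration over a square of side `2π`, as a continuous linear functional. -/
lemma exists_clm_integral_square :
    ∃ L : C(AngleSquare, ℂ) →L[ℂ] ℂ, ∀ g,
      L g = ∫ θ in (0 : ℝ)..2 * Real.pi, ∫ φ in (0 : ℝ)..2 * Real.pi,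
        g (projIcc 0 (2 * Real.pi) Real.two_pi_pos.le θ,
          projIcc 0 (2 * Real.pi) Real.two_pi_pos.le φ) := by
  set P := projIcc 0 (2 * Real.pi) Real.two_pi_pos.le with hP
  have hPc : Continuous P := continuous_projIcc
  have hc (g : C(AngleSquare, ℂ)) :
      Continuous fun x : ℝ × ℝ => g (P x.1, P x.2) := by fun_prop
  have hc1 (g : C(AngleSquare, ℂ)) (θ : ℝ) :
      Continuous fun φ : ℝ => g (P θ, P φ) := by fun_prop
  have hc2 (g : C(AngleSquare, ℂ)) :
      Continuous fun θ : ℝ => ∫ φ in (0 : ℝ)..2 * Real.pi, g (P θ, P φ) :=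
    intervalIntegral.continuous_parametric_intervalIntegral_of_continuous' (hc g) _ _
  refine ⟨LinearMap.mkContinuous
    { toFun := fun g => ∫ θ in (0 : ℝ)..2 * Real.pi, ∫ φ in (0 : ℝ)..2 * Real.pi, g (P θ, P φ)
      map_add' := fun g h => ?_
      map_smul' := fun c g => ?_ } ((2 * Real.pi) * (2 * Real.pi)) fun g => ?_, fun g => rfl⟩
  · simp only [ContinuousMap.add_apply]
    rw [← intervalIntegral.integral_add ((hc2 g).intervalIntegrable _ _)
      ((hc2 h).intervalIntegrable _ _)]
    congr 1
    ext θ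
    exact intervalIntegral.integral_add ((hc1 g θ).intervalIntegrable _ _)
      ((hc1 h θ).intervalIntegrable _ _)
  · simp only [ContinuousMap.smul_apply, intervalIntegral.integral_smul, RingHom.id_apply]
  · have hpi := Real.two_pi_pos
    have h1 (θ : ℝ) : ‖∫ φ in (0 : ℝ)..2 * Real.pi, g (P θ, P φ)‖ ≤ ‖g‖ * |2 * Real.pi - 0| :=
      intervalIntegral.norm_integral_le_of_norm_le_const fun φ _ => g.norm_coe_le_norm _
    have h2 := intervalIntegral.norm_integral_le_of_norm_le_const (a := 0) (b := 2 * Real.pi)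
      (f := fun θ => ∫ φ in (0 : ℝ)..2 * Real.pi, g (P θ, P φ)) fun θ _ => h1 θ
    rw [sub_zero, abs_of_pos hpi] at h2
    refine h2.trans_eq ?_
    ring

open Complex Set Metric in
/-- Osgood's lemma for functions of two variables: a function that is complex differentiable near
a point is analytic there. -/
theorem analyticAt_of_eventually_differentiableAt {f : ℂ × ℂ → ℂ} {p : ℂ × ℂ}
    (h : ∀ᶠ x in 𝓝 p, DifferentiableAt ℂ f x) : AnalyticAt ℂ f p := by
  obtain ⟨R, hR, hRf⟩ := Metric.nhds_basis_closedBall.eventually_iff.1 h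
  have hmem {z τ : ℂ} (hz : z ∈ closedBall p.1 R) (hτ : τ ∈ closedBall p.2 R) :
      (z, τ) ∈ closedBall p R := by
    rw [mem_closedBall, Prod.dist_eq]; exact max_le hz hτ
  obtain ⟨L, hL⟩ := exists_clm_integral_square
  let A : C(AngleSquare, ℂ) := ⟨fun x => circleMap p.1 R x.1, by fun_prop⟩
  let B : C(AngleSquare, ℂ) := ⟨fun x => circleMap p.2 R x.2, by fun_prop⟩
  have hcA (θ : ℝ) : circleMap p.1 R θ ∈ closedBall p.1 R := circleMap_mem_closedBall _ hR.le _
  have hcB (θ : ℝ) : circleMap p.2 R θ ∈ closedBall p.2 R := circleMap_mem_closedBall _ hR.le _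
  let F : C(AngleSquare, ℂ) := ⟨fun x => f (circleMap p.1 R x.1, circleMap p.2 R x.2), by
    refine continuous_iff_continuousAt.2 fun x => ContinuousAt.comp
      (g := f) (f := fun x : AngleSquare => (circleMap p.1 R x.1, circleMap p.2 R x.2)) ?_ (by fun_prop)
    exact (hRf (hmem (hcA _) (hcB _))).continuousAt⟩
  let M : C(AngleSquare, ℂ) := ⟨fun x => deriv (circleMap p.1 R) x.1 * deriv (circleMap p.2 R) x.2, by
    simp only [deriv_circleMap]
    fun_prop⟩
  -- The double Cauchy integral, with its kernel formed in the Banach algebra of continuous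
  -- functions on the square. There inversion is analytic, so G is a composite of analytic maps and
  -- no power series has to be summed.
  let G : ℂ × ℂ → ℂ := fun x => L (Ring.inverse (A - algebraMap ℂ C(AngleSquare, ℂ) x.1) *
    Ring.inverse (B - algebraMap ℂ C(AngleSquare, ℂ) x.2) * (F * M))
  have hA {z : ℂ} (hz : z ∈ ball p.1 R) (x : AngleSquare) : circleMap p.1 R x.1 - z ≠ 0 :=
    sub_ne_zero.2 fun e => by
      have := circleMap_mem_sphere p.1 hR.le x.1
      rw [e, mem_sphere] at this
      exact (mem_ball.1 hz).ne this
  have hB {z : ℂ} (hz : z ∈ ball p.2 R) (x : AngleSquare) : circleMap p.2 R x.2 - z ≠ 0 :=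
    sub_ne_zero.2 fun e => by
      have := circleMap_mem_sphere p.2 hR.le x.2
      rw [e, mem_sphere] at this
      exact (mem_ball.1 hz).ne this
  have hinv {u : C(AngleSquare, ℂ)} (hu : ∀ x, u x ≠ 0) (x : AngleSquare) : Ring.inverse u x = (u x)⁻¹ := by
    have h1 : IsUnit u := ContinuousMap.isUnit_iff_forall_ne_zero u |>.2 hu
    refine eq_inv_of_mul_eq_one_left ?_
    have := congrArg (fun v : C(AngleSquare, ℂ) => v x) (Ring.inverse_mul_cancel u h1)
    simpa using this
  have hfG {z τ : ℂ} (hz : z ∈ ball p.1 R) (hτ : τ ∈ ball p.2 R) :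
      (2 * Real.pi * I) * (2 * Real.pi * I) * f (z, τ) = G (z, τ) := by
    have h1 := DifferentiableOn.circleIntegral_sub_inv_smul (R := R) (c := p.1) (w := z)
      (f := fun ζ => f (ζ, τ)) (fun ζ hζ => by
        have := (hRf (hmem hζ (ball_subset_closedBall hτ)))
        exact (this.comp ζ (f := fun ζ => (ζ, τ)) (by fun_prop)).differentiableWithinAt) hz
    have h2 (ζ : ℂ) (hζ : ζ ∈ closedBall p.1 R) :=
      DifferentiableOn.circleIntegral_sub_inv_smul (R := R) (c := p.2) (w := τ)
      (f := fun σ => f (ζ, σ)) (fun σ hσ => by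
        have := (hRf (hmem hζ hσ))
        exact (this.comp σ (f := fun σ => (ζ, σ)) (by fun_prop)).differentiableWithinAt) hτ
    simp only [smul_eq_mul, circleIntegral] at h1 h2
    rw [mul_assoc, ← h1, ← intervalIntegral.integral_const_mul]
    simp only [G]
    rw [hL]
    refine intervalIntegral.integral_congr fun θ hθ => ?_
    rw [uIcc_of_le Real.two_pi_pos.le] at hθ
    rw [show 2 * (Real.pi : ℂ) * I * (deriv (circleMap p.1 R) θ *
        ((circleMap p.1 R θ - z)⁻¹ * f (circleMap p.1 R θ, τ)))
        = deriv (circleMap p.1 R) θ * (circleMap p.1 R θ - z)⁻¹ *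
          (2 * Real.pi * I * f (circleMap p.1 R θ, τ)) by ring, ← h2 _ (hcA θ),
      ← intervalIntegral.integral_const_mul]
    refine intervalIntegral.integral_congr fun φ hφ => ?_
    rw [uIcc_of_le Real.two_pi_pos.le] at hφ
    rw [projIcc_of_mem _ hθ, projIcc_of_mem _ hφ, ContinuousMap.mul_apply, ContinuousMap.mul_apply,
      hinv (fun x => by simpa [A] using hA hz x), hinv (fun x => by simpa [B] using hB hτ x)]
    simp [A, B, F, M]
    ring
  have hG : AnalyticAt ℂ G p := by
    have hp1 : p.1 ∈ ball p.1 R := mem_ball_self hR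
    have hp2 : p.2 ∈ ball p.2 R := mem_ball_self hR
    have u1 : IsUnit (A - algebraMap ℂ C(AngleSquare, ℂ) p.1) :=
      (ContinuousMap.isUnit_iff_forall_ne_zero _).2 fun x => by simpa [A] using hA hp1 x
    have u2 : IsUnit (B - algebraMap ℂ C(AngleSquare, ℂ) p.2) :=
      (ContinuousMap.isUnit_iff_forall_ne_zero _).2 fun x => by simpa [B] using hB hp2 x
    have a1 : AnalyticAt ℂ (fun x : ℂ × ℂ => A - algebraMap ℂ C(AngleSquare, ℂ) x.1) p :=
      analyticAt_const.sub (((Algebra.linearMap ℂ C(AngleSquare, ℂ)).toContinuousLinearMap.comp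
        (ContinuousLinearMap.fst ℂ ℂ ℂ)).analyticAt p)
    have a2 : AnalyticAt ℂ (fun x : ℂ × ℂ => B - algebraMap ℂ C(AngleSquare, ℂ) x.2) p :=
      analyticAt_const.sub (((Algebra.linearMap ℂ C(AngleSquare, ℂ)).toContinuousLinearMap.comp
        (ContinuousLinearMap.snd ℂ ℂ ℂ)).analyticAt p)
    have i1 := AnalyticAt.comp (g := Ring.inverse)
      (f := fun x : ℂ × ℂ => A - algebraMap ℂ C(AngleSquare, ℂ) x.1) (x := p)
      (analyticAt_inverse (𝕜 := ℂ) u1.unit) a1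
    have i2 := AnalyticAt.comp (g := Ring.inverse)
      (f := fun x : ℂ × ℂ => B - algebraMap ℂ C(AngleSquare, ℂ) x.2) (x := p)
      (analyticAt_inverse (𝕜 := ℂ) u2.unit) a2
    exact (L.analyticAt _).comp (((i1.mul i2).mul (analyticAt_const (v := F * M))))
  refine ((analyticAt_const (v := ((2 * Real.pi * I) * (2 * Real.pi * I))⁻¹)).mul hG).congr ?_
  filter_upwards [ball_mem_nhds p hR] with x hx
  rw [← ball_prod_same] at hx
  simp only [Pi.mul_apply]
  rw [← hfG hx.1 hx.2]
  have := Complex.two_pi_I_ne_zero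
  field_simp

/-! ### The theta quotient for `g3Sum` -/

lemma zeta3_pow_mul (i j : ℕ) (x τ : ℂ) :
    zeta3 ^ i * expTwoPiI x * expTwoPiI τ ^ j = expTwoPiI (i / 3 + x + j * τ) := by
  rw [zeta3, ← expTwoPiI_nat_mul, ← expTwoPiI_nat_mul, ← expTwoPiI_add, ← expTwoPiI_add]
  ring_nf

lemma zeta3_pow_mul_ne_one {α τ : ℂ} (h : ∀ m n : ℤ, 3 * α ≠ 3 * n * τ + m) (i j : ℕ) :
    zeta3 ^ i * expTwoPiI α * expTwoPiI τ ^ j ≠ 1 := by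
  rw [zeta3_pow_mul, Ne, expTwoPiI_eq_one_iff]
  rintro ⟨n, hn⟩
  refine h (3 * n - i) (-j) ?_
  push_cast
  linear_combination 3 * hn

lemma div_zeta3_pow_mul_ne_one {α τ : ℂ} (h : ∀ m n : ℤ, 3 * α ≠ 3 * n * τ + m) (i j : ℕ) :
    expTwoPiI τ / (zeta3 ^ i * expTwoPiI α) * expTwoPiI τ ^ j ≠ 1 := by
  have e : expTwoPiI τ / (zeta3 ^ i * expTwoPiI α) * expTwoPiI τ ^ j
      = expTwoPiI ((j + 1) * τ - i / 3 - α) := by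
    rw [zeta3, ← expTwoPiI_nat_mul, ← expTwoPiI_nat_mul, ← expTwoPiI_add, ← expTwoPiI_sub,
      ← expTwoPiI_add]
    ring_nf
  rw [e, Ne, expTwoPiI_eq_one_iff]
  rintro ⟨n, hn⟩
  refine h (-3 * n - i) (j + 1) ?_
  push_cast
  linear_combination (-3) * hn

lemma three_mul_ne_iff (α : ℂ) {τ : ℂ} (hτ : 0 < τ.im) :
    (∀ m n : ℤ, 3 * α ≠ 3 * n * τ + m) ↔ kleinTheta (3 * α) (3 * τ) ≠ 0 := by
  rw [Ne, kleinTheta_eq_zero_iff _ (by simpa using hτ)]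
  push Not
  rw [forall_comm]
  refine forall_congr' fun n => forall_congr' fun m => ?_
  rw [show (n : ℂ) * (3 * τ) = 3 * n * τ by ring]

lemma summable_g3Term_zeta3 {α τ : ℂ} (hτ : 0 < τ.im) (h : ∀ m n : ℤ, 3 * α ≠ 3 * n * τ + m)
    (i : ℕ) : Summable (g3Term (zeta3 ^ i * expTwoPiI α) (expTwoPiI τ)) :=
  summable_g3Term (norm_expTwoPiI_lt_one hτ) (zeta3_pow_mul_ne_one h i)
    (div_zeta3_pow_mul_ne_one h i)

/-- The sum of `g₃` over the three cube roots of unity as an eta-theta quotient. -/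
theorem g3Sum_eq_oddTheta {α τ : ℂ} (hτ : 0 < τ.im) (h : ∀ m n : ℤ, 3 * α ≠ 3 * n * τ + m) :
    g3Sum α τ
      = 3 * ModularForm.eta (3 * τ) ^ 3 / (ModularForm.eta τ * oddTheta (3 * α) (3 * τ)) := by
  have h3τ : 0 < (3 * τ).im := by simpa using hτ
  have hK := (three_mul_ne_iff α hτ).1 h
  have hθ : oddTheta (3 * α) (3 * τ) ≠ 0 := fun e => hK (by rw [kleinTheta, e, zero_div])
  have hη := ModularForm.eta_ne_zero (z := τ) hτ
  have key := universalG3_add_add zeta3_sq_add (expTwoPiI_ne_zero α) (expTwoPiI_ne_zero τ)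
    (norm_expTwoPiI_lt_one hτ) (zeta3_pow_mul_ne_one h) (div_zeta3_pow_mul_ne_one h)
  have e3 (x : ℂ) : expTwoPiI (3 * x) = expTwoPiI x ^ 3 := by
    rw [← expTwoPiI_nat_mul]; norm_num
  rw [eq_div_iff (mul_ne_zero hη hθ), g3Sum, eta_eq_qPochInf τ, eta_eq_qPochInf (3 * τ),
    oddTheta_eq_thetaProd _ h3τ, e3 τ, e3 α, mul_pow]
  -- The prefactor w^{3/2} q^{-1/24} cancels the fractional powers of η(τ) and ϑ(3α; 3τ), leaving
  -- that of η(3τ)³.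
  have e4 : expTwoPiI (3 / 2 * α) * expTwoPiI (-1 / 24 * τ) *
      (expTwoPiI (τ / 24) * expTwoPiI (3 * τ / 8 - 3 * α / 2))
      = expTwoPiI (3 * τ / 24) ^ 3 := by
    rw [← expTwoPiI_nat_mul, ← expTwoPiI_add, ← expTwoPiI_add, ← expTwoPiI_add]; push_cast; ring_nf
  rw [← e4]
  linear_combination (expTwoPiI (3 / 2 * α) * expTwoPiI (-1 / 24 * τ) *
    (expTwoPiI (τ / 24) * expTwoPiI (3 * τ / 8 - 3 * α / 2)) *
    qPochInf (expTwoPiI τ ^ 3) (expTwoPiI τ ^ 3)) * key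

lemma g3Sum_eq_kleinTheta {α τ : ℂ} (hτ : 0 < τ.im) (h : kleinTheta (3 * α) (3 * τ) ≠ 0) :
    g3Sum α τ = 3 / (ModularForm.eta τ * kleinTheta (3 * α) (3 * τ)) := by
  have h3η := ModularForm.eta_ne_zero (z := 3 * τ) (show 0 < (3 * τ).im by simpa using hτ)
  have hη := ModularForm.eta_ne_zero (z := τ) hτ
  rw [g3Sum_eq_oddTheta hτ ((three_mul_ne_iff α hτ).2 h)]
  rw [kleinTheta] at h ⊢
  have hθ : oddTheta (3 * α) (3 * τ) ≠ 0 := fun e => h (by rw [e, zero_div])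
  field_simp

/-! ### Poles and the elliptic law of `g3Sum` -/

lemma isOpen_im_pos : IsOpen {x : ℂ × ℂ | 0 < x.2.im} :=
  isOpen_lt continuous_const (by fun_prop)

lemma differentiableAt_eta_mul_kleinTheta (z : ℂ) {τ : ℂ} (hτ : 0 < τ.im) :
    DifferentiableAt ℂ
      (fun x : ℂ × ℂ => ModularForm.eta x.2 * kleinTheta (3 * x.1) (3 * x.2)) (z, τ) := by
  have h1 : DifferentiableAt ℂ (fun x : ℂ × ℂ => ModularForm.eta x.2) (z, τ) :=
    DifferentiableAt.comp (z, τ) (f := Prod.snd) (g := ModularForm.eta)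
      (ModularForm.differentiableAt_eta_of_mem_upperHalfPlaneSet (z := τ) hτ)
      differentiableAt_snd
  have h2 := DifferentiableAt.comp (z, τ) (f := fun x : ℂ × ℂ => (3 * x.1, 3 * x.2))
    (g := fun x : ℂ × ℂ => kleinTheta x.1 x.2)
    (differentiableAt_kleinTheta (3 * z) (τ := 3 * τ) (by simpa using hτ)) (by fun_prop)
  exact h1.mul h2

lemma analyticAt_eta_mul_kleinTheta (z : ℂ) {τ : ℂ} (hτ : 0 < τ.im) :
    AnalyticAt ℂ
      (fun x : ℂ × ℂ => ModularForm.eta x.2 * kleinTheta (3 * x.1) (3 * x.2)) (z, τ) :=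
  analyticAt_of_eventually_differentiableAt <| by
    filter_upwards [isOpen_im_pos.mem_nhds (x := (z, τ)) hτ] with x hx using
      differentiableAt_eta_mul_kleinTheta x.1 hx

lemma eta_mul_kleinTheta_ne_zero_iff {z τ : ℂ} (hτ : 0 < τ.im) :
    ModularForm.eta τ * kleinTheta (3 * z) (3 * τ) ≠ 0 ↔ kleinTheta (3 * z) (3 * τ) ≠ 0 := by
  simp [ModularForm.eta_ne_zero (z := τ) hτ]

/-- The zeros of `α ↦ kleinTheta (3 α) (3 τ)` are nowhere dense. -/
lemma frequently_kleinTheta_ne_zero (z : ℂ) {τ : ℂ} (hτ : 0 < τ.im) :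
    ∃ᶠ x in 𝓝 (z, τ), kleinTheta (3 * x.1) (3 * x.2) ≠ 0 := by
  have h3τ : 0 < (3 * τ).im := by simpa using hτ
  have hd : Differentiable ℂ fun w : ℂ => kleinTheta (3 * w) (3 * τ) := fun w =>
    DifferentiableAt.comp w (f := fun w : ℂ => (3 * w, 3 * τ))
      (g := fun x : ℂ × ℂ => kleinTheta x.1 x.2) (differentiableAt_kleinTheta (3 * w) h3τ)
      (by fun_prop)
  have hf : ∃ᶠ w in 𝓝 z, kleinTheta (3 * w) (3 * τ) ≠ 0 := by
    intro hev
    simp only [ne_eq, not_not] at hev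
    have h0 := (hd.differentiableOn.analyticOnNhd isOpen_univ).eqOn_zero_of_preconnected_of_eventuallyEq_zero
      isPreconnected_univ (Set.mem_univ z) hev
    -- By the identity theorem theta would vanish for every w, yet 3 · 1/6 = 1/2 is not a lattice
    -- point.
    have h1 := h0 (Set.mem_univ (1 / 6 : ℂ))
    simp only [Pi.zero_apply] at h1
    rw [kleinTheta_eq_zero_iff _ h3τ] at h1
    obtain ⟨l, m, h⟩ := h1
    have him := congrArg Complex.im h
    simp only [Complex.add_im, Complex.mul_im] at him
    norm_num at him
    rcases him with hl | hl
    · rw [hl] at h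
      have h2 : (1 : ℂ) = 2 * m := by
        rw [Int.cast_zero, zero_mul, zero_add] at h
        rw [← h]; norm_num
      have h3 : (1 : ℤ) = 2 * m := by exact_mod_cast h2
      omega
    · exact hτ.ne' hl
  have hc : Tendsto (fun w : ℂ => (w, τ)) (𝓝 z) (𝓝 (z, τ)) := by
    have : Continuous fun w : ℂ => (w, τ) := by fun_prop
    exact this.tendsto z
  exact hc.frequently hf

/-- `g3Sum` is singular along the zeros of the theta function. -/
lemma kleinTheta_ne_zero_of_regularAt {z τ : ℂ} (hτ : 0 < τ.im) (h : RegularAt g3Sum z τ) :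
    kleinTheta (3 * z) (3 * τ) ≠ 0 := by
  intro h0
  -- At a zero of theta this product would be continuous with value 0, but it equals 3 at points
  -- arbitrarily close by. The value of `g3Sum` at the pole itself plays no role.
  have hc := (h.continuousAt.mul (analyticAt_eta_mul_kleinTheta z hτ).continuousAt)
  rw [ContinuousAt] at hc
  simp only [Pi.mul_apply] at hc
  rw [h0, mul_zero, mul_zero] at hc
  have hev := hc.eventually (isOpen_ne.mem_nhds (show (0 : ℂ) ≠ 3 by norm_num))
  have hev2 := isOpen_im_pos.mem_nhds (x := (z, τ)) hτ
  obtain ⟨x, hx, hx1, hx2⟩ :=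
    ((frequently_kleinTheta_ne_zero z hτ).and_eventually (hev.and hev2)).exists
  refine hx1 ?_
  rw [Pi.mul_apply, g3Sum_eq_kleinTheta hx2 hx, div_mul_cancel₀ _ ((eta_mul_kleinTheta_ne_zero_iff hx2).2 hx)]

lemma meromorphicAtTwoVar_g3Sum (z : ℂ) {τ : ℂ} (hτ : 0 < τ.im) :
    MeromorphicAtTwoVar g3Sum (z, τ) := by
  refine ⟨fun _ => 3, _, analyticAt_const, analyticAt_eta_mul_kleinTheta z hτ, ?_, ?_⟩
  · intro hev
    obtain ⟨x, hx, hx1, hx2⟩ := ((frequently_kleinTheta_ne_zero z hτ).and_eventually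
      (hev.and (isOpen_im_pos.mem_nhds (x := (z, τ)) hτ))).exists
    exact (eta_mul_kleinTheta_ne_zero_iff hx2).2 hx hx1
  · filter_upwards [isOpen_im_pos.mem_nhds (x := (z, τ)) hτ] with x hx h
    exact g3Sum_eq_kleinTheta hx ((eta_mul_kleinTheta_ne_zero_iff hx).1 h)

lemma neg_one_zpow_odd_mul (M k : ℤ) (hM : Odd M) : (-1 : ℂ) ^ (M * k) = (-1) ^ k := by
  rw [zpow_mul, hM.neg_one_zpow]

lemma neg_one_zpow_inv (k : ℤ) : ((-1 : ℂ) ^ k)⁻¹ = (-1) ^ k := by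
  rw [← inv_zpow]; norm_num

lemma g3Sum_add_lattice {z τ : ℂ} (hτ : 0 < τ.im) (l m : ℤ)
    (h : kleinTheta (3 * z) (3 * τ) ≠ 0) :
    g3Sum (z + l * τ + m) τ
      = (-1 : ℂ) ^ (l + m) * expTwoPiI (3 / 2 * (l ^ 2 * τ + 2 * l * z)) * g3Sum z τ := by
  have h3τ : 0 < (3 * τ).im := by simpa using hτ
  have e : kleinTheta (3 * (z + l * τ + m)) (3 * τ)
      = (-1) ^ (l + m) * (expTwoPiI (3 / 2 * (l ^ 2 * τ + 2 * l * z)))⁻¹ *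
        kleinTheta (3 * z) (3 * τ) := by
    have e1 : 3 * (z + l * τ + m) = 3 * z + l * (3 * τ) + ((3 * m : ℤ) : ℂ) := by
      push_cast; ring
    have e2 : (-1 : ℂ) ^ (l + 3 * m) = (-1) ^ (l + m) := by
      rw [zpow_add₀ (by norm_num), zpow_add₀ (by norm_num),
        neg_one_zpow_odd_mul 3 m (by decide)]
    rw [e1, kleinTheta_add_lattice _ h3τ, e2, ← expTwoPiI_neg]
    ring_nf
  have hs : (-1 : ℂ) ^ (l + m) ≠ 0 := zpow_ne_zero _ (by norm_num)
  have h' : kleinTheta (3 * (z + l * τ + m)) (3 * τ) ≠ 0 := by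
    rw [e]
    exact mul_ne_zero (mul_ne_zero hs (inv_ne_zero (expTwoPiI_ne_zero _))) h
  rw [g3Sum_eq_kleinTheta hτ h', g3Sum_eq_kleinTheta hτ h, e]
  nth_rw 2 [← neg_one_zpow_inv]
  have := expTwoPiI_ne_zero (3 / 2 * (l ^ 2 * τ + 2 * l * z))
  have := ModularForm.eta_ne_zero (z := τ) hτ
  field_simp

/-! ### Modular transformations of `g3Sum` -/

/-- The matrix `diag(3, 1) A` is the product of a unimodular and an upper triangular matrix. -/
lemma exists_triangular_factor (A : SL(2, ℤ)) : ∃ (B : SL(2, ℤ)) (p t b : ℤ), 0 < p ∧ 0 < t ∧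
    p * t = 3 ∧ B 0 0 * p = 3 * A 0 0 ∧ B 1 0 * p = A 1 0 ∧ B 0 0 * b + B 0 1 * t = 3 * A 0 1 ∧
    B 1 0 * b + B 1 1 * t = A 1 1 := by
  have hd := A.det_coe
  rw [Matrix.det_fin_two] at hd
  by_cases h : (3 : ℤ) ∣ A 1 0
  · obtain ⟨δ, hδ⟩ := exists_isDiagConj_of_dvd h
    exact ⟨δ, 3, 1, 0, by norm_num, by norm_num, by norm_num, by rw [hδ.1]; ring,
      by rw [hδ.2.2.1]; ring, by rw [hδ.2.1]; ring, by rw [hδ.2.2.2]; ring⟩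
  · have h3 : (3 : ℤ) ∣ 1 - A 1 0 ^ 2 := by
      have : A 1 0 % 3 = 1 ∨ A 1 0 % 3 = 2 := by omega
      rw [Int.dvd_iff_emod_eq_zero, Int.sub_emod, pow_two, Int.mul_emod]
      rcases this with e | e <;> simp [e]
    obtain ⟨k, hk⟩ := h3
    -- Integrality of B needs cb ≡ d mod 3; as c² ≡ 1 mod 3, the choice b = cd works.
    refine ⟨⟨!![3 * A 0 0, A 0 1 - A 0 0 * (A 1 0 * A 1 1); A 1 0, k * A 1 1], ?_⟩, 1, 3,
      A 1 0 * A 1 1, by norm_num, by norm_num, by norm_num, ?_, ?_, ?_, ?_⟩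
    · rw [Matrix.det_fin_two_of]
      linear_combination hd - A 0 0 * A 1 1 * hk
    · simp
    · simp
    · simp; ring
    · simp
      linear_combination -A 1 1 * hk

/-- The transform of `g3Sum` under `A`, in terms of a triangular factorization of
`diag(3, 1) A`. -/
lemma jacobiSlash_g3Sum_eq {A B : SL(2, ℤ)} {p t b : ℤ} (hp : 0 < p) (ht : 0 < t)
    (hpt : p * t = 3) (h00 : B 0 0 * p = 3 * A 0 0) (h10 : B 1 0 * p = A 1 0)
    (h01 : B 0 0 * b + B 0 1 * t = 3 * A 0 1) (h11 : B 1 0 * b + B 1 1 * t = A 1 1) {ε : ℂ}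
    (hε0 : ε ≠ 0) {τ : ℍ} (hε : ModularForm.eta ((A • τ : ℍ) : ℂ) * autDenom A τ ^ (-(1 / 2) : ℂ)
      = ε * ModularForm.eta τ) {z : ℂ} :
    (kleinTheta (3 * (z / autDenom A τ)) (3 * ((A • τ : ℍ) : ℂ)) ≠ 0 ↔
      kleinTheta (p * z) ((p * τ + b) / t) ≠ 0) ∧
    (kleinTheta (p * z) ((p * τ + b) / t) ≠ 0 → jacobiSlash 1 (-3) A g3Sum z τ
      = 3 / (t * ε * (ModularForm.eta τ * kleinTheta (p * z) ((p * τ + b) / t)))) := by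
  have ht0 : (t : ℂ) ≠ 0 := by exact_mod_cast ht.ne'
  have hp0 : (p : ℂ) ≠ 0 := by exact_mod_cast hp.ne'
  have n := autDenom_ne_zero A τ
  have hη := ModularForm.eta_ne_zero (z := τ) τ.2
  have hηA := ModularForm.eta_ne_zero (z := (A • τ : ℍ)) (A • τ).2
  have him : 0 < (((p : ℂ) * τ + b) / t).im := by
    rw [Complex.div_intCast_im]
    have h1 : (0 : ℝ) < p := by exact_mod_cast hp
    have h2 : (0 : ℝ) < t := by exact_mod_cast ht
    have := τ.im_pos
    simp
    positivity
  have hpt' : (p : ℂ) * t = 3 := by exact_mod_cast hpt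
  have h00' : (B 0 0 : ℂ) * p = 3 * A 0 0 := by exact_mod_cast h00
  have h10' : (B 1 0 : ℂ) * p = A 1 0 := by exact_mod_cast h10
  have h01' : (B 0 0 : ℂ) * b + B 0 1 * t = 3 * A 0 1 := by exact_mod_cast h01
  have h11' : (B 1 0 : ℂ) * b + B 1 1 * t = A 1 1 := by exact_mod_cast h11
  let τ' : ℍ := ⟨(p * τ + b) / t, him⟩
  have hτ' : (τ' : ℂ) = (p * τ + b) / t := rfl
  have hj : autDenom B τ' = autDenom A τ / t := by
    rw [hτ', autDenom, autDenom]
    field_simp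
    linear_combination (τ : ℂ) * h10' + h11'
  -- Thus 3·Aτ = Bτ' with τ' = (pτ + b)/t, and the law of `kleinTheta` under B brings everything
  -- back to the cusp ∞.
  have hB : ((B • τ' : ℍ) : ℂ) = 3 * ((A • τ : ℍ) : ℂ) := by
    rw [coe_SL2_smul, coe_SL2_smul, hj, hτ']
    field_simp
    linear_combination (τ : ℂ) * h00' + h01'
  have key := kleinTheta_smul B (p * z) τ'
  have e1 : (p : ℂ) * z / (autDenom A τ / t) = 3 * (z / autDenom A τ) := by
    field_simp
    linear_combination z * hpt'
  have e2 : (B 1 0 : ℂ) * (p * z) ^ 2 / (2 * (autDenom A τ / t))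
      = -(-3 / 2) * A 1 0 * z ^ 2 / autDenom A τ := by
    rw [← hpt', ← h10']
    field_simp
  rw [hB, hj, hτ', e1, e2] at key
  have e5 : autDenom A τ ^ (-(1 / 2) : ℂ) * autDenom A τ ^ (-(1 / 2) : ℂ)
      = (autDenom A τ)⁻¹ := by
    rw [← Complex.cpow_add _ _ n]; norm_num [Complex.cpow_neg_one]
  have e4 : autDenom A τ ^ (-((1 : ℤ) : ℂ) / 2) = autDenom A τ ^ (-(1 / 2) : ℂ) := by
    norm_num [neg_div]
  have hX := expTwoPiI_ne_zero (-(-3 / 2) * A 1 0 * z ^ 2 / autDenom A τ)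
  have hs : autDenom A τ ^ (-(1 / 2) : ℂ) ≠ 0 := by simp [Complex.cpow_eq_zero_iff, n]
  have hiff : kleinTheta (3 * (z / autDenom A τ)) (3 * ((A • τ : ℍ) : ℂ)) ≠ 0 ↔
      kleinTheta (p * z) ((p * τ + b) / t) ≠ 0 := by
    rw [key]
    exact ⟨right_ne_zero_of_mul, mul_ne_zero (mul_ne_zero (inv_ne_zero (div_ne_zero n ht0)) hX)⟩
  refine ⟨hiff, fun h => ?_⟩
  rw [jacobiSlash, g3Sum_eq_kleinTheta (A • τ).2 (hiff.2 h), key, e4, inv_div, div_eq_mul_inv (t : ℂ),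
    ← e5]
  push_cast
  generalize autDenom A τ ^ (-(1 / 2) : ℂ) = s at *
  generalize expTwoPiI (-(-3 / 2) * A 1 0 * z ^ 2 / autDenom A τ) = X at *
  generalize kleinTheta (p * z) ((p * τ + b) / t) = K at *
  rw [show ModularForm.eta ((A • τ : ℍ) : ℂ) * (t * (s * s) * X * K)
    = ModularForm.eta ((A • τ : ℍ) : ℂ) * s * (t * s * X * K) by ring, hε]
  field_simp

/-- The modular transformation of `g3Sum` under a matrix whose lower left entry is divisible
by `3`. -/
lemma jacobiSlash_g3Sum {γ : SL(2, ℤ)} (hγ : (3 : ℤ) ∣ γ 1 0) {ε : ℂ} (hε0 : ε ≠ 0) {τ : ℍ}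
    (hε : ModularForm.eta ((γ • τ : ℍ) : ℂ) * autDenom γ τ ^ (-(1 / 2) : ℂ)
      = ε * ModularForm.eta τ) {z : ℂ} (h : kleinTheta (3 * z) (3 * τ) ≠ 0) :
    jacobiSlash 1 (-3) γ g3Sum z τ = ε⁻¹ * g3Sum z τ := by
  obtain ⟨δ, hδ⟩ := exists_isDiagConj_of_dvd hγ
  have key := (jacobiSlash_g3Sum_eq (B := δ) (p := 3) (t := 1) (b := 0) three_pos one_pos
    (by norm_num) (by rw [hδ.1]; ring) (by rw [hδ.2.2.1]; ring) (by rw [hδ.2.1]; ring)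
    (by rw [hδ.2.2.2]; ring) hε0 hε (z := z)).2
  push_cast at key
  rw [add_zero, div_one, one_mul] at key
  rw [key h, g3Sum_eq_kleinTheta τ.2 h, ← div_div, div_right_comm, inv_mul_eq_div]

/-! ### Growth at the cusps -/

/-- `g` is bounded below by an exponential in `Im τ` as `Im τ → ∞`. -/
def HasExpLowerBound (g : ℍ → ℂ) : Prop :=
  ∃ C : ℝ, ∀ᶠ τ : ℍ in UpperHalfPlane.atImInfty, Real.exp (C * τ.im) ≤ ‖g τ‖

namespace HasExpLowerBound

variable {g h : ℍ → ℂ}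

lemma mul (hg : HasExpLowerBound g) (hh : HasExpLowerBound h) :
    HasExpLowerBound fun τ => g τ * h τ := by
  obtain ⟨C, hC⟩ := hg
  obtain ⟨D, hD⟩ := hh
  refine ⟨C + D, ?_⟩
  filter_upwards [hC, hD] with τ h1 h2
  rw [add_mul, Real.exp_add, norm_mul]
  gcongr

lemma congr (hg : HasExpLowerBound g) (e : ∀ τ, h τ = g τ) : HasExpLowerBound h := by
  rwa [funext e]

lemma of_tendsto {a : ℂ} (ha : a ≠ 0) (hg : Tendsto g UpperHalfPlane.atImInfty (𝓝 a)) :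
    HasExpLowerBound g := by
  -- Any negative exponent would do: the exponential falls below |a|/2.
  refine ⟨-1, ?_⟩
  have h1 : Tendsto (fun τ : ℍ => Real.exp (-1 * τ.im)) UpperHalfPlane.atImInfty (𝓝 0) := by
    simp only [neg_one_mul]
    exact Real.tendsto_exp_neg_atTop_nhds_zero.comp tendsto_comap
  have h2 := norm_pos_iff.2 ha
  filter_upwards [h1.eventually (gt_mem_nhds (half_pos h2)),
    hg.norm.eventually (lt_mem_nhds (half_lt_self h2))] with τ a1 a2
  exact (a1.trans a2).le

end HasExpLowerBound

lemma norm_expTwoPiI_mul_add (R S : ℝ) (τ : ℂ) :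
    ‖expTwoPiI (R * τ + S)‖ = Real.exp (-2 * Real.pi * R * τ.im) := by
  rw [norm_expTwoPiI]; simp; ring_nf

lemma hasExpLowerBound_expTwoPiI (R S : ℝ) :
    HasExpLowerBound fun τ => expTwoPiI (R * τ + S) :=
  ⟨-2 * Real.pi * R, Eventually.of_forall fun τ => by
    rw [norm_expTwoPiI_mul_add]; rfl⟩

lemma tendsto_expTwoPiI_zero {R : ℝ} (hR : 0 < R) (S : ℝ) :
    Tendsto (fun τ : ℍ => expTwoPiI (R * τ + S)) UpperHalfPlane.atImInfty (𝓝 0) := by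
  rw [tendsto_zero_iff_norm_tendsto_zero]
  simp only [norm_expTwoPiI_mul_add, UpperHalfPlane.coe_im]
  have h : Tendsto (fun y : ℝ => (2 * Real.pi * R) * y) atTop atTop :=
    tendsto_id.const_mul_atTop (by positivity)
  have := Real.tendsto_exp_neg_atTop_nhds_zero.comp
    (h.comp (tendsto_comap : Tendsto UpperHalfPlane.im UpperHalfPlane.atImInfty atTop))
  refine this.congr fun τ => ?_
  simp only [Function.comp_apply]
  ring_nf

lemma tendsto_qPochInf_one {u : ℍ → ℂ} (hu : Tendsto u UpperHalfPlane.atImInfty (𝓝 0)) :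
    Tendsto (fun τ : ℍ => qPochInf (u τ) (expTwoPiI τ)) UpperHalfPlane.atImInfty (𝓝 1) := by
  have hq : Tendsto (fun τ : ℍ => expTwoPiI τ) UpperHalfPlane.atImInfty (𝓝 0) := by
    simpa using tendsto_expTwoPiI_zero one_pos 0
  rw [← tendsto_sub_nhds_zero_iff]
  refine squeeze_zero_norm (fun τ => norm_qPochInf_sub_one_le (u τ) (norm_expTwoPiI_lt_one τ.2)) ?_
  have h1 : Tendsto (fun τ : ℍ => ‖u τ‖ / (1 - ‖expTwoPiI τ‖)) UpperHalfPlane.atImInfty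
      (𝓝 (‖(0 : ℂ)‖ / (1 - ‖(0 : ℂ)‖))) :=
    hu.norm.div (hq.norm.const_sub 1) (by simp)
  have h2 := ((Real.continuous_exp.tendsto _).comp h1).sub_const 1
  simpa using h2

lemma kleinTheta_eq_thetaProd (z : ℂ) {τ : ℂ} (hτ : 0 < τ.im) :
    kleinTheta z τ = expTwoPiI (-(z / 2)) * (thetaProd (expTwoPiI z) (expTwoPiI τ) *
      (qPochInf (expTwoPiI τ) (expTwoPiI τ) * qPochInf (expTwoPiI τ) (expTwoPiI τ))⁻¹) := by
  have hq := norm_expTwoPiI_lt_one hτ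
  have h0 := qPochInf_ne_zero_of_norm_lt_one hq hq
  have e : expTwoPiI (τ / 8 - z / 2) = expTwoPiI (-(z / 2)) * expTwoPiI (τ / 24) ^ 3 := by
    rw [← expTwoPiI_nat_mul, ← expTwoPiI_add]; push_cast; ring_nf
  have := expTwoPiI_ne_zero (τ / 24)
  rw [kleinTheta, oddTheta_eq_thetaProd z hτ, eta_eq_qPochInf, e]
  field_simp

/-- For 0 ≤ R < 1 the infinite products tend to 1. Only 1 - e^{2πi(Rτ+S)} could tend to 0, and it
does so exactly when R = 0 and S is an integer. -/
lemma hasExpLowerBound_kleinTheta_of_mem_Ico {R S : ℝ} (h0 : 0 ≤ R) (h1 : R < 1)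
    (h : R = 0 → ∀ m : ℤ, S ≠ m) : HasExpLowerBound fun τ => kleinTheta (R * τ + S) τ := by
  have hq : Tendsto (fun τ : ℍ => expTwoPiI τ) UpperHalfPlane.atImInfty (𝓝 0) := by
    simpa using tendsto_expTwoPiI_zero one_pos 0
  have t1 : Tendsto (fun τ : ℍ => expTwoPiI (R * τ + S) * expTwoPiI τ)
      UpperHalfPlane.atImInfty (𝓝 0) := by
    refine (tendsto_expTwoPiI_zero (R := R + 1) (by linarith) S).congr fun τ => ?_
    rw [← expTwoPiI_add]; push_cast; ring_nf
  have t2 : Tendsto (fun τ : ℍ => expTwoPiI τ / expTwoPiI (R * τ + S))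
      UpperHalfPlane.atImInfty (𝓝 0) := by
    refine (tendsto_expTwoPiI_zero (R := 1 - R) (by linarith) (-S)).congr fun τ => ?_
    rw [← expTwoPiI_sub]; push_cast; ring_nf
  have b1 : HasExpLowerBound fun τ => expTwoPiI (-((R * τ + S) / 2)) :=
    (hasExpLowerBound_expTwoPiI (-(R / 2)) (-(S / 2))).congr fun τ => by push_cast; ring_nf
  have b2 : HasExpLowerBound fun τ => 1 - expTwoPiI (R * τ + S) := by
    rcases h0.eq_or_lt with rfl | hR
    · refine HasExpLowerBound.of_tendsto (a := 1 - expTwoPiI S) ?_ ?_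
      · rw [sub_ne_zero, ne_comm, Ne, expTwoPiI_eq_one_iff]
        rintro ⟨m, hm⟩
        exact h rfl m (by exact_mod_cast hm)
      · simp
    · refine HasExpLowerBound.of_tendsto one_ne_zero ?_
      simpa using (tendsto_expTwoPiI_zero hR S).const_sub 1
  have p0 := tendsto_qPochInf_one hq
  have b3 := HasExpLowerBound.of_tendsto one_ne_zero (by
    simpa using ((tendsto_qPochInf_one t1).mul (tendsto_qPochInf_one t2)).mul
      ((p0.mul p0).inv₀ (by simp)))
  refine ((b1.mul b2).mul b3).congr fun τ => ?_
  rw [kleinTheta_eq_thetaProd _ τ.2, thetaProd,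
    qPochInf_eq_one_sub_mul (expTwoPiI (R * τ + S)) (norm_expTwoPiI_lt_one τ.2)]
  ring

/-- Torsion values of `ϑ / η³` decay at most exponentially. -/
lemma hasExpLowerBound_kleinTheta {R S : ℝ} (h : ¬ ((∃ l : ℤ, R = l) ∧ ∃ m : ℤ, S = m)) :
    HasExpLowerBound fun τ => kleinTheta (R * τ + S) τ := by
  have h1 := hasExpLowerBound_kleinTheta_of_mem_Ico (S := S) (Int.fract_nonneg R) (Int.fract_lt_one R)
    (fun h0 m hm => h ⟨⟨⌊R⌋, by linarith [Int.floor_add_fract R]⟩, ⟨m, hm⟩⟩)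
  have h2 := hasExpLowerBound_expTwoPiI (-((⌊R⌋ : ℝ) ^ 2 / 2) - ⌊R⌋ * Int.fract R) (-(⌊R⌋ * S))
  have h3 : HasExpLowerBound fun _ => (-1 : ℂ) ^ ⌊R⌋ :=
    HasExpLowerBound.of_tendsto (zpow_ne_zero _ (by norm_num)) tendsto_const_nhds
  refine ((h3.mul h2).mul h1).congr fun τ => ?_
  have e : (R : ℂ) * τ + S = (Int.fract R : ℝ) * τ + S + (⌊R⌋ : ℤ) * τ + ((0 : ℤ) : ℂ) := by
    have : (R : ℂ) = ((⌊R⌋ + Int.fract R : ℝ) : ℂ) := by rw [Int.floor_add_fract]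
    rw [this]; push_cast; ring
  rw [e, kleinTheta_add_lattice _ τ.2, add_zero]
  push_cast
  ring_nf

lemma hasExpLowerBound_eta : HasExpLowerBound fun τ => ModularForm.eta τ := by
  have hq : Tendsto (fun τ : ℍ => expTwoPiI τ) UpperHalfPlane.atImInfty (𝓝 0) := by
    simpa using tendsto_expTwoPiI_zero one_pos 0
  refine ((hasExpLowerBound_expTwoPiI (1 / 24) 0).mul
    (HasExpLowerBound.of_tendsto one_ne_zero (tendsto_qPochInf_one hq))).congr fun τ => ?_
  rw [eta_eq_qPochInf]
  push_cast
  ring_nf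

/-- The transforms of `g3Sum` are meromorphic at the cusps along torsion curves. -/
theorem isBigO_jacobiSlash_g3Sum (A : SL(2, ℤ)) (r s : ℝ)
    (h : ∀ᶠ τ : ℍ in UpperHalfPlane.atImInfty,
      kleinTheta (3 * ((r * τ + s) / autDenom A τ)) (3 * ((A • τ : ℍ) : ℂ)) ≠ 0) :
    ∃ C : ℝ, (fun τ : ℍ => expTwoPiI (-3 / 2 * r ^ 2 * τ)
        * jacobiSlash 1 (-3) A g3Sum (r * τ + s) τ)
      =O[UpperHalfPlane.atImInfty] (fun τ : ℍ => Real.exp (C * τ.im)) := by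
  obtain ⟨B, p, t, b, hp, ht, hpt, h00, h10, h01, h11⟩ := exists_triangular_factor A
  obtain ⟨ε, hε24, hε⟩ := exists_eta_smul A
  have hε0 : ε ≠ 0 := by rintro rfl; norm_num at hε24
  have main (τ : ℍ) := jacobiSlash_g3Sum_eq hp ht hpt h00 h10 h01 h11 hε0 (hε τ)
    (z := r * τ + s)
  have hp' : (0 : ℝ) < p := by exact_mod_cast hp
  have ht' : (0 : ℝ) < t := by exact_mod_cast ht
  have ht0 : (t : ℂ) ≠ 0 := by exact_mod_cast ht.ne'
  have him (τ : ℍ) : 0 < (((p : ℂ) * τ + b) / t).im := by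
    rw [Complex.div_intCast_im]
    have := τ.im_pos
    simp
    positivity
  let φ : ℍ → ℍ := fun τ => ⟨(p * τ + b) / t, him τ⟩
  have hφ (τ : ℍ) : (φ τ : ℂ) = (p * τ + b) / t := rfl
  have hφim (τ : ℍ) : (φ τ).im = p / t * τ.im := by
    rw [← UpperHalfPlane.coe_im, hφ, Complex.div_intCast_im]
    simp
    ring
  have hφt : Tendsto φ UpperHalfPlane.atImInfty UpperHalfPlane.atImInfty := by
    refine tendsto_comap_iff.2 ?_
    have : Tendsto (fun y : ℝ => p / t * y) atTop atTop :=
      tendsto_id.const_mul_atTop (by positivity)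
    exact (this.comp (tendsto_comap : Tendsto UpperHalfPlane.im _ atTop)).congr fun τ =>
      (hφim τ).symm
  -- In the variable φ τ the curve is again a line Rφ + S, with R = rt and S = ps - rb. If both were
  -- integers theta would vanish identically on it, against the hypothesis.
  have hz (τ : ℍ) : (p : ℂ) * (r * τ + s) = (r * t : ℝ) * (φ τ : ℂ) + (p * s - r * b : ℝ) := by
    rw [hφ]; push_cast; field_simp; ring
  have hne : ¬ ((∃ l : ℤ, r * t = l) ∧ ∃ m : ℤ, p * s - r * b = m) := by
    rintro ⟨⟨l, hl⟩, m, hm⟩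
    obtain ⟨τ, hτ⟩ := h.exists
    have h1 := (main τ).1.1 hτ
    rw [hz, ← hφ, hl, hm, Ne, kleinTheta_eq_zero_iff _ (φ τ).2] at h1
    exact h1 ⟨l, m, by push_cast; rfl⟩
  obtain ⟨C1, hC1⟩ := hasExpLowerBound_kleinTheta hne
  obtain ⟨C2, hC2⟩ := hasExpLowerBound_eta
  refine ⟨3 * Real.pi * r ^ 2 - C2 - C1 * (p / t),
    Asymptotics.IsBigO.of_bound (3 / ‖(t : ℂ) * ε‖) ?_⟩
  filter_upwards [h, hφt.eventually hC1, hC2] with τ h1 h2 h3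
  have h4 := (main τ).1.1 h1
  rw [(main τ).2 h4, Real.norm_of_nonneg (Real.exp_pos _).le, norm_mul, norm_div, norm_mul _ (_ * _),
    norm_mul (ModularForm.eta τ)]
  rw [← hz, hφim, hφ] at h2
  have e1 : ‖expTwoPiI (-3 / 2 * r ^ 2 * τ)‖ = Real.exp (3 * Real.pi * r ^ 2 * τ.im) := by
    have := norm_expTwoPiI_mul_add (-3 / 2 * r ^ 2) 0 τ
    push_cast at this
    rw [add_zero] at this
    rw [this, UpperHalfPlane.coe_im]
    ring_nf
  have e2 : Real.exp ((3 * Real.pi * r ^ 2 - C2 - C1 * (p / t)) * τ.im)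
      = Real.exp (3 * Real.pi * r ^ 2 * τ.im) /
        (Real.exp (C2 * τ.im) * Real.exp (C1 * (p / t * τ.im))) := by
    rw [← Real.exp_add, ← Real.exp_sub]; ring_nf
  have e3 : ‖(3 : ℂ)‖ = 3 := by simp
  have hpos : 0 < ‖(t : ℂ) * ε‖ := norm_pos_iff.2 (mul_ne_zero ht0 hε0)
  rw [e1, e2, e3]
  have h5 : Real.exp (C2 * τ.im) * Real.exp (C1 * (p / t * τ.im))
      ≤ ‖ModularForm.eta τ‖ * ‖kleinTheta (p * (r * τ + s)) ((p * τ + b) / t)‖ := by gcongr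
  calc Real.exp (3 * Real.pi * r ^ 2 * τ.im) * (3 / (‖(t : ℂ) * ε‖ *
        (‖ModularForm.eta τ‖ * ‖kleinTheta (p * (r * τ + s)) ((p * τ + b) / t)‖)))
      ≤ Real.exp (3 * Real.pi * r ^ 2 * τ.im) * (3 / (‖(t : ℂ) * ε‖ *
        (Real.exp (C2 * τ.im) * Real.exp (C1 * (p / t * τ.im))))) := by gcongr
    _ = _ := by field_simp

/-! ### `g3Sum` as a Jacobi form and its torsion specializations -/

/-- `g3Sum` is a meromorphic Jacobi form of weight `1/2` and index `-3/2` on `Γ₀(3)`. -/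
theorem isMeromorphicJacobiForm_g3Sum :
    IsMeromorphicJacobiForm 1 (-3) (CongruenceSubgroup.Gamma0 3) g3Sum where
  meromorphic z τ := meromorphicAtTwoVar_g3Sum z τ.2
  modular := by
    choose ε hε1 hε using exists_eta_smul
    refine ⟨fun γ => (ε γ)⁻¹, ⟨24, by norm_num, fun γ _ => by rw [inv_pow, hε1, inv_one]⟩, ?_⟩
    intro γ hγ z τ h1 _
    have hdvd : (3 : ℤ) ∣ γ 1 0 := by
      rw [CongruenceSubgroup.Gamma0_mem] at hγ
      exact (ZMod.intCast_zmod_eq_zero_iff_dvd (γ 1 0) 3).1 hγ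
    have hε0 : ε γ ≠ 0 := fun e => by simpa [e] using hε1 γ
    exact jacobiSlash_g3Sum hdvd hε0 (hε γ τ) (kleinTheta_ne_zero_of_regularAt τ.2 h1)
  elliptic l m z τ h _ := by
    rw [g3Sum_add_lattice τ.2 l m (kleinTheta_ne_zero_of_regularAt τ.2 h),
      neg_one_zpow_odd_mul (-3) _ (by decide)]
    push_cast
    ring_nf
  growth A r s h := by
    have := isBigO_jacobiSlash_g3Sum A r s (h.mono fun τ hτ => by
      simpa using kleinTheta_ne_zero_of_regularAt (A • τ).2 hτ)
    push_cast at this ⊢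
    exact this

/-! ### Specialization to torsion curves -/

lemma three_mul_add_ne {r s : ℚ} (h : ¬ ((∃ n : ℤ, r = n) ∧ ∃ m : ℤ, 3 * s = m)) {τ : ℂ}
    (hτ : 0 < τ.im) : kleinTheta (3 * (r * τ + s)) (3 * τ) ≠ 0 := by
  refine (three_mul_ne_iff _ hτ).1 fun m n e => h ?_
  have him := congrArg Complex.im e
  have e1 : 3 * ((r : ℂ) * τ + s) = ((3 * r : ℝ) : ℂ) * τ + ((3 * s : ℝ) : ℂ) := by
    push_cast; ring
  have e2 : 3 * (n : ℂ) * τ + m = ((3 * n : ℝ) : ℂ) * τ + ((m : ℝ) : ℂ) := by push_cast; ring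
  rw [e1, e2] at him
  simp only [Complex.add_im, Complex.im_ofReal_mul, Complex.ofReal_im,
    add_zero] at him
  have hr : (r : ℝ) = n := by
    have := mul_right_cancel₀ hτ.ne' him
    linarith
  have hr' : r = n := by exact_mod_cast hr
  refine ⟨⟨n, hr'⟩, m, ?_⟩
  have hs : (3 * s : ℂ) = m := by
    rw [hr'] at e
    push_cast at e
    linear_combination e
  exact_mod_cast hs

/-- The factor q^{-3r²/2} is what completes κ(3(rτ + s); 3τ) to a Klein form with characteristic (r,
3s) at 3τ. -/
lemma torsion_g3Sum_eq {r s : ℚ} (h : ¬ ((∃ n : ℤ, r = n) ∧ ∃ m : ℤ, 3 * s = m)) {τ : ℂ}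
    (hτ : 0 < τ.im) : expTwoPiI (-3 * r ^ 2 / 2 * τ) * g3Sum (r * τ + s) τ
      = 3 * expTwoPiI (3 * r * s / 2) / (ModularForm.eta τ * kleinForm r (3 * s) (3 * τ)) := by
  have e : (r : ℂ) * (3 * τ) + 3 * s = 3 * (r * τ + s) := by ring
  have e2 : expTwoPiI (r * (3 * (r * τ + s)) / 2)
      = expTwoPiI (3 * r * s / 2) * (expTwoPiI (-3 * r ^ 2 / 2 * τ))⁻¹ := by
    rw [← expTwoPiI_neg, ← expTwoPiI_add]; ring_nf
  rw [g3Sum_eq_kleinTheta hτ (three_mul_add_ne h hτ), kleinForm, e, e2]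
  have := expTwoPiI_ne_zero (3 * r * s / 2)
  have := expTwoPiI_ne_zero (-3 * r ^ 2 / 2 * τ)
  field_simp

lemma differentiableOn_torsion_g3Sum {r s : ℚ}
    (h : ¬ ((∃ n : ℤ, r = n) ∧ ∃ m : ℤ, 3 * s = m)) :
    DifferentiableOn ℂ (fun τ : ℂ => expTwoPiI (-3 * r ^ 2 / 2 * τ) * g3Sum (r * τ + s) τ)
      {τ : ℂ | 0 < τ.im} := by
  have hd : DifferentiableOn ℂ (fun τ : ℂ => expTwoPiI (-3 * r ^ 2 / 2 * τ) *
      (3 / (ModularForm.eta τ * kleinTheta (3 * (r * τ + s)) (3 * τ)))) {τ : ℂ | 0 < τ.im} := by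
    intro τ hτ
    have h1 : DifferentiableAt ℂ (fun τ : ℂ =>
        ModularForm.eta τ * kleinTheta (3 * (r * τ + s)) (3 * τ)) τ :=
      DifferentiableAt.comp τ (f := fun τ : ℂ => ((r : ℂ) * τ + s, τ))
        (differentiableAt_eta_mul_kleinTheta ((r : ℂ) * τ + s) hτ) (by fun_prop)
    have h2 : DifferentiableAt ℂ (fun τ : ℂ => expTwoPiI (-3 * r ^ 2 / 2 * τ)) τ := by
      unfold expTwoPiI; fun_prop
    exact (h2.mul ((differentiableAt_const _).div h1
      ((eta_mul_kleinTheta_ne_zero_iff hτ).2 (three_mul_add_ne h hτ)))).differentiableWithinAt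
  exact hd.congr fun τ hτ => by rw [g3Sum_eq_kleinTheta hτ (three_mul_add_ne h hτ)]

/-- The automorphy factor of the Klein form at 3τ cancels that of ηθ, so the quotient by θ is
invariant. -/
lemma torsion_g3Sum_smul {r s : ℚ} (h : ¬ ((∃ n : ℤ, r = n) ∧ ∃ m : ℤ, 3 * s = m)) {n : ℕ}
    {R S : ℤ} (hR : n * (r : ℂ) = R) (hS : n * (3 * s : ℂ) = S) {γ : SL(2, ℤ)}
    (hγ : γ ∈ CongruenceSubgroup.Gamma (3 * (2 * n ^ 2))) {τ : ℍ}
    (hη : ModularForm.eta ((γ • τ : ℍ) : ℂ) * jacobiTheta (2 * ((γ • τ : ℍ) : ℂ))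
      = autDenom γ τ ^ (1 : ℤ) * (ModularForm.eta τ * jacobiTheta (2 * (τ : ℂ)))) :
    expTwoPiI (-3 * r ^ 2 / 2 * ((γ • τ : ℍ) : ℂ)) *
        g3Sum (r * ((γ • τ : ℍ) : ℂ) + s) ((γ • τ : ℍ) : ℂ)
      = jacobiTheta (2 * ((γ • τ : ℍ) : ℂ)) / jacobiTheta (2 * (τ : ℂ)) *
        (expTwoPiI (-3 * r ^ 2 / 2 * (τ : ℂ)) * g3Sum (r * (τ : ℂ) + s) τ) := by
  have hd : (3 : ℤ) ∣ γ 1 0 :=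
    (Gamma_mem_iff_dvd.1 (Gamma_mono (dvd_mul_right 3 _) hγ)).2.2.1
  obtain ⟨δ, hδ⟩ := exists_isDiagConj_of_dvd hd
  obtain ⟨τ', hτ'⟩ := exists_coe_eq_mul τ three_pos
  have hτ'' : (τ' : ℂ) = (3 : ℤ) * τ := by rw [hτ']; push_cast; rfl
  have hk := kleinForm_smul_of_mem_Gamma hR hS (hδ.mem_Gamma (k := 3) three_pos hγ) τ'
  rw [hδ.coe_smul hτ'', hτ'', hδ.autDenom] at hk
  push_cast at hk
  rw [torsion_g3Sum_eq h τ.2, torsion_g3Sum_eq h (γ • τ).2, hk]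
  have n := autDenom_ne_zero γ τ
  have h1 := ModularForm.eta_ne_zero τ.2
  have h2 := ModularForm.eta_ne_zero (γ • τ).2
  have him (τ : ℍ) : 0 < (2 * (τ : ℂ)).im := by simpa using τ.2
  have h3 := jacobiTheta_ne_zero (him τ)
  rw [zpow_one] at hη
  have h5 : kleinForm r (3 * s) (3 * τ) ≠ 0 := by
    refine mul_ne_zero (expTwoPiI_ne_zero _) ?_
    rw [show (r : ℂ) * (3 * τ) + 3 * s = 3 * (r * τ + s) by ring]
    exact three_mul_add_ne h τ.2
  field_simp
  linear_combination -expTwoPiI (3 * r * s / 2) * hη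

/-- With (r', s') = (r, s)A, the function is, up to a constant, the transform F|A on the curve r'τ +
s' with its factor q^{-3r'²/2}; its growth is already known. -/
lemma isBigO_torsion_g3Sum {r s : ℚ} (h : ¬ ((∃ n : ℤ, r = n) ∧ ∃ m : ℤ, 3 * s = m))
    (A : SL(2, ℤ)) : ∃ C : ℝ, (fun τ : ℍ => autDenom A τ ^ (-((1 : ℤ) : ℂ) / 2) *
        (expTwoPiI (-3 * r ^ 2 / 2 * ((A • τ : ℍ) : ℂ)) *
          g3Sum (r * ((A • τ : ℍ) : ℂ) + s) ((A • τ : ℍ) : ℂ)))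
      =O[UpperHalfPlane.atImInfty] (fun τ : ℍ => Real.exp (C * τ.im)) := by
  let r' : ℝ := r * A 0 0 + s * A 1 0
  let s' : ℝ := r * A 0 1 + s * A 1 1
  have d := SL2_det A
  have hz (τ : ℍ) : (r' * τ + s' : ℂ) / autDenom A τ = r * ((A • τ : ℍ) : ℂ) + s := by
    have n := autDenom_ne_zero A τ
    rw [coe_SL2_smul]
    field_simp
    simp only [r', s', autDenom]
    push_cast
    ring
  obtain ⟨C, hC⟩ := isBigO_jacobiSlash_g3Sum A r' s' (Eventually.of_forall fun τ => by
    rw [hz]; exact three_mul_add_ne h (A • τ).2)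
  refine ⟨C, (hC.const_mul_left (expTwoPiI (3 / 2 * (r * s - r' * s')))).congr_left fun τ => ?_⟩
  have n := autDenom_ne_zero A τ
  have key : (-3 * (r : ℂ) ^ 2 / 2 * ((A • τ : ℍ) : ℂ)) = 3 / 2 * (r * s - r' * s') +
      -3 / 2 * r' ^ 2 * τ + -(((-3 : ℤ) : ℂ) / 2) * A 1 0 * (r' * τ + s') ^ 2 / autDenom A τ := by
    rw [coe_SL2_smul]
    field_simp
    simp only [r', s', autDenom]
    push_cast
    linear_combination (3 * r * (r * (A 0 0 * τ + A 0 1) + s * (A 1 0 * τ + A 1 1)) : ℂ) * d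
  rw [jacobiSlash, hz, key, expTwoPiI_add, expTwoPiI_add]
  ring

/-- The specializations of `g3Sum` to torsion curves are weakly holomorphic modular forms of weight
`1/2` on a common congruence subgroup. -/
theorem exists_isWeaklyHolomorphicHalfIntegral_g3Sum (r : ℚ) {d : ℕ} (hd : 0 < d) :
    ∃ Γ : Subgroup SL(2, ℤ), CongruenceSubgroup.IsCongruenceSubgroup Γ ∧
      ∀ s : ℚ, s.den ∣ d → ¬ ((∃ n : ℤ, r = n) ∧ ∃ m : ℤ, 3 * s = m) →
        IsWeaklyHolomorphicHalfIntegral 1 Γ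
          (fun τ : ℂ => expTwoPiI (-3 * r ^ 2 / 2 * τ) * g3Sum (r * τ + s) τ) := by
  obtain ⟨N, hN, H⟩ := isCongruenceInvariant_eta_mul_jacobiTheta
  have hpos : 0 < 4 * (3 * (2 * (r.den * d) ^ 2)) * N := by
    have := r.den_pos
    positivity
  have := NeZero.of_pos hpos
  -- The level collects 4 for Γ₀(4), N for ηθ, and 3 · 2n² for the Klein form at 3τ. Here n = `r.den
  -- * d` clears the denominators of r and 3s for every admissible s, so one group serves all of
  -- them.
  refine ⟨CongruenceSubgroup.Gamma (4 * (3 * (2 * (r.den * d) ^ 2)) * N),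
    CongruenceSubgroup.Gamma_is_cong_sub _, fun s hs h =>
    ⟨odd_one, fun γ hγ => ?_, differentiableOn_torsion_g3Sum h, fun γ hγ τ => ?_,
      isBigO_torsion_g3Sum h⟩⟩
  · have h4 := (Gamma_mem_iff_dvd.1
      (Gamma_mono ((dvd_mul_right 4 _).trans (dvd_mul_right _ N)) hγ)).2.2.1
    rw [CongruenceSubgroup.Gamma0_mem]
    exact (ZMod.intCast_zmod_eq_zero_iff_dvd (γ 1 0) 4).2 h4
  · obtain ⟨k, rfl⟩ := hs
    have hr : (r.den : ℂ) * r = r.num := by exact_mod_cast Rat.den_mul_eq_num r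
    have hs : (s.den : ℂ) * s = s.num := by exact_mod_cast Rat.den_mul_eq_num s
    rw [zpow_one]
    refine torsion_g3Sum_smul h (n := r.den * (s.den * k)) (R := s.den * k * r.num)
      (S := 3 * r.den * k * s.num) ?_ ?_
      (Gamma_mono ((dvd_mul_left _ 4).trans (dvd_mul_right _ N)) hγ)
      (H γ (Gamma_mono (dvd_mul_left N _) hγ) τ)
    · push_cast; linear_combination (s.den * k : ℂ) * hr
    · push_cast; linear_combination (3 * r.den * k : ℂ) * hs

end

theorem theorem1p3 :
    (∀ (α : ℂ) (τ : ℍ), (∀ m n : ℤ, 3 * α ≠ 3 * n * (τ : ℂ) + m) →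
      (∀ j ∈ Finset.range 3, Summable (g3Term (zeta3 ^ j * expTwoPiI α) (expTwoPiI τ))) ∧
      expTwoPiI (3 / 2 * α) * expTwoPiI (-1 / 24 * τ) *
          (universalG3 (expTwoPiI α) (expTwoPiI τ)
            + universalG3 (zeta3 * expTwoPiI α) (expTwoPiI τ)
            + universalG3 (zeta3 ^ 2 * expTwoPiI α) (expTwoPiI τ))
        = 3 * ModularForm.eta (3 * τ) ^ 3 / (ModularForm.eta τ * oddTheta (3 * α) (3 * τ))) ∧
    IsMeromorphicJacobiForm 1 (-3) (CongruenceSubgroup.Gamma0 3) g3Sum ∧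
    (∀ (r : ℚ) (d : ℕ), 0 < d →
      ∃ Γ : Subgroup SL(2, ℤ), CongruenceSubgroup.IsCongruenceSubgroup Γ ∧
        ∀ s : ℚ, s.den ∣ d → ¬ ((∃ n : ℤ, r = n) ∧ ∃ m : ℤ, 3 * s = m) →
          IsWeaklyHolomorphicHalfIntegral 1 Γ
            (fun τ : ℂ => expTwoPiI (-3 * r ^ 2 / 2 * τ) * g3Sum (r * τ + s) τ)) := by
  refine ⟨fun α τ h => ⟨fun j _ => summable_g3Term_zeta3 τ.2 h j, g3Sum_eq_oddTheta τ.2 h⟩,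
    isMeromorphicJacobiForm_g3Sum, fun r d hd => exists_isWeaklyHolomorphicHalfIntegral_g3Sum r hd⟩
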